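/- **Definitions.** For integers $A,B$ with $B^2(A^2-4B)\neq 0$ let $E: y^2=x^3+Ax^2+Bx$, $\Delta(E)=B^2(A^2-4B)$, and let $E': y^2=x^3-2Ax^2+(A^2-4B)x$. Let $M(E)=\{\infty\}\cup\{p \text{ prime}: p\mid\Delta(E)\}$, $\mathbb{Q}_\infty=\mathbb{R}$, and let $D(E)$ be the subgroup of $\mathbb{Q}^*/{\mathbb{Q}^*}^2$ generated by $-1$ and the primes dividing $\Delta(E)$. For $v\in M(E)$ let $\delta'_v:E(\mathbb{Q}_v)\to\mathbb{Q}_v^*/{\mathbb{Q}_v^*}^2$ be given by $O\mapsto 1$, $(0,0)\mapsto B$, $(x,y)\mapsto x$ for $x\ne0$, and let $\delta_v:E'(\mathbb{Q}_v)\to\mathbb{Q}_v^*/{\mathbb{Q}_v^*}^2$ be the same map for $E'$, with $(0,0)\mapsto A^2-4B$. Put $$S(E)=\{d\in D(E): d\in\mathrm{Im}(\delta_v)\ \forall v\in M(E)\},\qquad S'(E)=\{d\in D(E): d\in\mathrm{Im}(\delta'_v)\ \forall v\in M(E)\}.$$ For a square-free integer $m\neq0,\pm1$ let $G(m)$ be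 the directed graph whose vertex set $V$ consists of the primes dividing $m$, together with $-1$ if $m<0$, and which has an arc $p\to v$ exactly when $p\in V$ is a prime with $p\equiv1\pmod 3$, $v\in V$ and $\left(\frac{v}{p}\right)=-1$. A partition $\{V_1,\overline V_1\}$ of $V$ is nontrivial if both parts are nonempty; it is odd if some vertex has an odd number of arcs to the part not containing it. A directed graph is odd if all its nontrivial partitions are odd. Write $d(V_1)=\prod_{v\in V_1}v$. **Theorem 5.1.** Let $n=3p_1\cdots p_tq_1\cdots q_s\equiv3,9,15\pmod{24}$, where $p_i\equiv1\pmod3$ $(1\le i\le t)$ and $q_j\equiv2\pmod 3$ $(1\le j\le s)$ are distinct odd primes and $t+s\ge1$. Let $P=p_1\cdots p_t$, $Q=q_1\cdots q_s$ and $E=E_{n,\pi/3}: y^2=x(x-n)(x+3n)$. (I.1) If $PQ\equiv1\pmod3$, then $S'(E)=\{1,n,-\frac n3,-3\}$ if and only if $s=0$ and $G(n)$ is an odd graph. (I.2) If $PQ\equiv2\pmod3$, then $S'(E)=\{1,n,-\frac n3,-3\}$ if and only if $s=1$ and, in the graph $G(n)$, all nontrivial partitions $\{V_1,\overline V_1\}$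 of $V=\{3,p_1,\dots,p_t,q_1\}$ with $V_1\subseteq\{p_1,\dots,p_t\}$ are odd. (II.1) If $PQ\equiv1\pmod3$ and $s=0$, then $S(E)=\{1\}$ if and only if $n\equiv9\pmod{24}$ and $G(n/3)$ is an odd graph. (II.2) If $PQ\equiv2\pmod3$ and $s=1$, then $S(E)=\{1\}$ if and only if, in the graph $G(-n)$, all nontrivial partitions $\{V_1,\overline V_1\}$ of $V=\{-1,3,p_1,\dots,p_t,q_1\}$ with $V_1\subseteq\{3,p_1,\dots,p_t\}$, $d(V_1)\equiv1\pmod4$ and $\left(\frac{d(V_1)}{q_1}\right)=1$ are odd. -/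

import Mathlib

open Finset

noncomputable section

/-- The group `Kˣ / (Kˣ)²` of square classes of a field `K`. -/
abbrev SqClass (K : Type) [Field K] : Type :=
  Kˣ ⧸ (powMonoidHom 2 : Kˣ →* Kˣ).range

open Classical in
/-- The square class of a nonzero `x : K` (junk value `1` at `x = 0`, which is never used below). -/
def sqClass {K : Type} [Field K] (x : K) : SqClass K :=
  if h : x = 0 then 1 else QuotientGroup.mk (Units.mk0 x h)

/-- The natural map `ℚˣ / (ℚˣ)² → Kˣ / (Kˣ)²` for a field `K` of characteristic zero. -/
def sqClassMap (K : Type) [Field K] [CharZero K] : SqClass ℚ →* SqClass K :=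
  QuotientGroup.map _ _ (Units.map (Rat.castHom K : ℚ →* K)) (by
    rintro _ ⟨u, rfl⟩
    exact ⟨Units.map (Rat.castHom K : ℚ →* K) u, by simp⟩)

theorem sqClassMap_sqClass (K : Type) [Field K] [CharZero K] (x : ℚ) (hx : x ≠ 0) :
    sqClassMap K (sqClass x) = sqClass (x : K) := by
  have hx' : (x : K) ≠ 0 := by exact_mod_cast hx
  rw [sqClass, sqClass, dif_neg hx, dif_neg hx', sqClassMap, QuotientGroup.map_mk]
  congr 1
  ext
  simp

/-- Integral coefficients `A, B` of a curve `y² = x³ + A x² + B x`. -/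
structure CurveData where
  A : ℤ
  B : ℤ

namespace CurveData

/-- The Weierstrass curve `y² = x³ + A x² + B x` over a field `K`. -/
def curve (E : CurveData) (K : Type) [Field K] : WeierstrassCurve.Affine K :=
  { a₁ := 0, a₂ := (E.A : K), a₃ := 0, a₄ := (E.B : K), a₆ := 0 }

/-- The quantity `Δ(E) = B² (A² - 4B)`. -/
def disc (E : CurveData) : ℤ := E.B ^ 2 * (E.A ^ 2 - 4 * E.B)

/-- The associated curve `E' : y² = x³ + A' x² + B' x` with `A' = -2A`, `B' = A² - 4B`. -/
def dual (E : CurveData) : CurveData := ⟨-2 * E.A, E.A ^ 2 - 4 * E.B⟩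

open Classical in
/-- The descent map `E(K) → Kˣ / (Kˣ)²`: `O ↦ 1`, `(0,0) ↦ B`, `(x,y) ↦ x` otherwise. -/
def descent (E : CurveData) (K : Type) [Field K] : (E.curve K).Point → SqClass K
  | .zero => 1
  | .some x _ _ => if x = 0 then sqClass (E.B : K) else sqClass x

/-- The subgroup `D(E)` of `ℚˣ / (ℚˣ)²` generated by `-1` and the primes dividing `Δ(E)`. -/
def genSubgroup (E : CurveData) : Subgroup (SqClass ℚ) :=
  Subgroup.closure ({sqClass (-1 : ℚ)} ∪
    {c | ∃ p : ℕ, p.Prime ∧ (p : ℤ) ∣ E.disc ∧ c = sqClass (p : ℚ)})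

/-- Those `d ∈ D(E)` whose image in `ℚ_vˣ / (ℚ_vˣ)²` lies in the image of the local descent map of
the curve `F` for every place `v ∈ M(E) = {∞} ∪ {p : p ∣ Δ(E)}`. -/
def localConditions (E F : CurveData) : Set (SqClass ℚ) :=
  {d | d ∈ E.genSubgroup ∧
    sqClassMap ℝ d ∈ Set.range (F.descent ℝ) ∧
    ∀ (p : ℕ) [Fact p.Prime], (p : ℤ) ∣ E.disc →
      sqClassMap ℚ_[p] d ∈ Set.range (F.descent ℚ_[p])}

/-- The Selmer group `S(E)`, defined by the descent maps `δ_v` on `E'(ℚ_v)`. -/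
def selmer (E : CurveData) : Set (SqClass ℚ) := E.localConditions E.dual

/-- The Selmer group `S'(E)`, defined by the descent maps `δ'_v` on `E(ℚ_v)`. -/
def selmer' (E : CurveData) : Set (SqClass ℚ) := E.localConditions E

end CurveData

/-- The curve `E_{n,π/3} : y² = x (x - n) (x + 3n)`, that is `y² = x³ + 2n x² - 3n² x`. -/
def curvePiThird (n : ℕ) : CurveData := ⟨2 * n, -3 * (n : ℤ) ^ 2⟩

theorem curvePiThird_equation (n : ℕ) (K : Type) [Field K] (x y : K) :
    ((curvePiThird n).curve K).Equation x y ↔ y ^ 2 = x * (x - n) * (x + 3 * n) := by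
  rw [WeierstrassCurve.Affine.equation_iff]
  simp only [curvePiThird, CurveData.curve]
  push_cast
  constructor <;> intro h <;> linear_combination h

/-- The vertices of `G(m)`: the primes dividing `m`, together with `-1` if `m < 0`. -/
def graphVertices (m : ℤ) : Finset ℤ :=
  m.natAbs.primeFactors.image (fun p : ℕ => (p : ℤ)) ∪ (if m < 0 then {-1} else ∅)

/-- The directed graph `G(m)`: there is an arc `p → v` exactly when `p` is a prime vertex with
`p ≡ 1 (mod 3)` and the Legendre symbol `(v / p)` is `-1` (the Jacobi symbol at a prime is the
Legendre symbol). -/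
def graphG (m : ℤ) : Digraph (graphVertices m) where
  Adj u v := ∃ p : ℕ, p.Prime ∧ (u : ℤ) = p ∧ p % 3 = 1 ∧ jacobiSym (v : ℤ) p = -1

section Partitions

variable {V : Type} [Fintype V] [DecidableEq V]

/-- The partition `{V₁, V₁ᶜ}` is nontrivial. -/
def IsNontrivialPartition (V₁ : Finset V) : Prop := V₁.Nonempty ∧ V₁ᶜ.Nonempty

/-- The partition `{V₁, V₁ᶜ}` is odd: some vertex has an odd number of arcs to the part that does
not contain it. -/
def IsOddPartition (Γ : Digraph V) (V₁ : Finset V) : Prop :=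
  (∃ u ∈ V₁, Odd {v : V | v ∈ V₁ᶜ ∧ Γ.Adj u v}.ncard) ∨
    (∃ u ∈ V₁ᶜ, Odd {v : V | v ∈ V₁ ∧ Γ.Adj u v}.ncard)

/-- A directed graph is odd if all its nontrivial partitions are odd. -/
def IsOddGraph (Γ : Digraph V) : Prop :=
  ∀ V₁ : Finset V, IsNontrivialPartition V₁ → IsOddPartition Γ V₁

end Partitions

/-- `d(V₁)`, the product of the elements of a set `V₁` of vertices of `G(m)`. -/
def vertexProd {m : ℤ} (V₁ : Finset (graphVertices m)) : ℤ := ∏ v ∈ V₁, (v : ℤ)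

end

/-! Both Selmer groups are cut out by local conditions. The proof determines every local descent
image, then reads membership of a class as congruences and Legendre symbols of its squarefree
representative `D ∣ 2n`. That two elements `a`, `b` have the same square class is expressed
throughout as `IsSquare (a * b)`.

The decisive places are the primes `p ∣ n` with `p ≡ 1 (mod 3)`. There `-3` is a square, so both
cubics split over `ℚ_p` with nonzero roots of equal odd valuation, and the images are `{1, n}` on
`E` and `{1, -n}` on `E'`. At a prime `q ∣ n` with `q ≡ 2 (mod 3)`, `-3` is a nonsquare unit: the
image on `E` is everything and the image on `E'` is trivial. At infinity `E` imposes nothing and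
`E'` imposes positivity. At `2`, `E` forces `D` to be odd and `E'` forces `D ≡ 1 (mod 4)`. At `3`
the images depend on `n / 3` modulo `3`. The outcome is `mem_selmer'_iff` and `mem_selmer_iff`.

The graph enters because `D` or `m D` is a square in `ℚ_p` exactly when the Legendre symbol at `p`
of `D` (if `p ∤ D`) or of `m / D` (if `p ∣ D`) is `1`. For `D = d(V₁)` this symbol is the product of
the symbols of the vertices lying in the part without `p`, so its sign is the parity of the number
of arcs from `p` to that part. Hence the conditions at all `p ≡ 1 (mod 3)` hold exactly when the
partition is not odd (`not_isOddPartition_iff`).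

The group `S'(E)` always contains the group generated by `n` and `-3`, coming from the 2-torsion of
`E`. Multiplication by `n` exchanges `V₁` with its complement, and multiplication by `-3` changes
the sign and toggles the factor `3`, so one may normalise `D` before reading it as a partition; the
trivial partitions give `1` and `n`. The bound on `s` is a pigeonhole argument (`two_pow_card_le`):
two subsets of the primes `p_i`, `q_j` with the same local behaviour have products differing by an
element of `S'(E)` outside the torsion classes.

For `S(E)` the representative is positive and not divisible by any `q_j`. If `s = 0` and `n / 3 ≡ 1
(mod 3)`, it divides `n / 3`, and the condition modulo `4` selects at least one part of every
partition exactly when `n / 3 ≡ 3 (mod 4)`. If `s = 1`, the conditions modulo `4` and at `q₁` remain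
as restrictions on `V₁`, while the condition at `3` is automatic. -/

theorem isSquare_mul_trans {K : Type*} [Field K] {a b c : K} (hb : b ≠ 0)
    (h₁ : IsSquare (a * b)) (h₂ : IsSquare (b * c)) : IsSquare (a * c) := by
  obtain ⟨r, hr⟩ := h₁
  obtain ⟨s, hs⟩ := h₂
  refine ⟨r * s / b, ?_⟩
  field_simp
  linear_combination b * c * hr + r ^ 2 * hs

theorem isSquare_of_isSquare_mul {K : Type*} [Field K] {a b : K} (hb : b ≠ 0)
    (h₁ : IsSquare (a * b)) (h₂ : IsSquare b) : IsSquare a := by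
  simpa using isSquare_mul_trans (c := 1) hb h₁ (by simpa using h₂)

theorem isSquare_mul_sq_iff {K : Type*} [Field K] {a b : K} (hb : b ≠ 0) :
    IsSquare (a * b ^ 2) ↔ IsSquare a :=
  ⟨fun h => isSquare_of_isSquare_mul (pow_ne_zero 2 hb) h (IsSquare.sq b),
    fun h => h.mul (IsSquare.sq b)⟩

/-! ### Square classes of a field. -/

section SquareClasses

variable {K : Type} [Field K]

theorem sqClass_eq_mk {x : K} (hx : x ≠ 0) :
    sqClass x = (QuotientGroup.mk (Units.mk0 x hx) : SqClass K) := by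
  rw [sqClass, dif_neg hx]

theorem sqClass_one : sqClass (1 : K) = 1 := by
  rw [sqClass_eq_mk one_ne_zero, Units.mk0_one, QuotientGroup.mk_one]

theorem sqClass_mul {x y : K} (hx : x ≠ 0) (hy : y ≠ 0) :
    sqClass (x * y) = sqClass x * sqClass y := by
  rw [sqClass_eq_mk hx, sqClass_eq_mk hy, sqClass_eq_mk (mul_ne_zero hx hy), Units.mk0_mul,
    QuotientGroup.mk_mul]

theorem sqClass_eq_one_iff {x : K} (hx : x ≠ 0) : sqClass x = 1 ↔ IsSquare x := by
  rw [sqClass_eq_mk hx, QuotientGroup.eq_one_iff]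
  constructor
  · rintro ⟨u, hu⟩
    refine ⟨u, ?_⟩
    have := congrArg Units.val hu
    simpa [pow_two] using this.symm
  · rintro ⟨y, rfl⟩
    have hy : y ≠ 0 := left_ne_zero_of_mul hx
    exact ⟨Units.mk0 y hy, by ext; simp [pow_two]⟩

theorem SqClass.mul_self (c : SqClass K) : c * c = 1 := by
  induction c using QuotientGroup.induction_on with
  | H u =>
    rw [← QuotientGroup.mk_mul, QuotientGroup.eq_one_iff]
    exact ⟨u, by simp [pow_two]⟩

theorem SqClass.inv_eq_self (c : SqClass K) : c⁻¹ = c :=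
  inv_eq_of_mul_eq_one_left (SqClass.mul_self c)

theorem sqClass_eq_iff {x y : K} (hx : x ≠ 0) (hy : y ≠ 0) :
    sqClass x = sqClass y ↔ IsSquare (x * y) := by
  rw [← sqClass_eq_one_iff (mul_ne_zero hx hy), sqClass_mul hx hy, mul_eq_one_iff_eq_inv,
    SqClass.inv_eq_self]

end SquareClasses

/-! ### Descent images read off the equation of a curve. -/

namespace CurveData

/-- The image of the local descent map, in terms of the equation of the curve. -/
theorem sqClass_mem_range_descent_iff (F : CurveData) (K : Type) [Field K] [CharZero K]
    (hF : F.disc ≠ 0) {c : K} (hc : c ≠ 0) :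
    sqClass c ∈ Set.range (F.descent K) ↔
      IsSquare c ∨ IsSquare (c * F.B) ∨
        ∃ x : K, x ≠ 0 ∧ IsSquare (x * (x ^ 2 + F.A * x + F.B)) ∧ IsSquare (c * x) := by
  have hB : (F.B : K) ≠ 0 := by
    intro h
    have : F.B = 0 := by exact_mod_cast h
    simp [disc, this] at hF
  have hΔ : (F.curve K).Δ ≠ 0 := by
    have h16 : (F.curve K).Δ = ((16 * F.disc : ℤ) : K) := by
      simp only [curve, disc, WeierstrassCurve.Δ, WeierstrassCurve.b₂, WeierstrassCurve.b₄,
        WeierstrassCurve.b₆, WeierstrassCurve.b₈]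
      push_cast
      ring
    rw [h16, Int.cast_ne_zero]
    exact mul_ne_zero (by norm_num) hF
  have heq : ∀ x y : K, (F.curve K).Equation x y ↔ y ^ 2 = x * (x ^ 2 + F.A * x + F.B) := by
    intro x y
    rw [WeierstrassCurve.Affine.equation_iff]
    simp only [curve]
    constructor <;> intro h <;> linear_combination h
  constructor
  · rintro ⟨P, hP⟩
    cases P with
    | zero => exact Or.inl ((sqClass_eq_one_iff hc).1 hP.symm)
    | some x y h =>
      simp only [descent] at hP
      split_ifs at hP with hx
      · exact Or.inr (Or.inl ((sqClass_eq_iff hc hB).1 hP.symm))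
      · refine Or.inr (Or.inr ⟨x, hx, ⟨y, ?_⟩, (sqClass_eq_iff hc hx).1 hP.symm⟩)
        rw [← (heq x y).1 h.1, pow_two]
  · rintro (h | h | ⟨x, hx, ⟨y, hy⟩, h⟩)
    · exact ⟨.zero, ((sqClass_eq_one_iff hc).2 h).symm⟩
    · refine ⟨.some 0 0 ((WeierstrassCurve.Affine.equation_iff_nonsingular_of_Δ_ne_zero hΔ).1
        ((heq 0 0).2 (by simp))), ?_⟩
      simp only [descent, if_true]
      exact ((sqClass_eq_iff hc hB).2 h).symm
    · refine ⟨.some x y ((WeierstrassCurve.Affine.equation_iff_nonsingular_of_Δ_ne_zero hΔ).1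
        ((heq x y).2 (by rw [hy, pow_two]))), ?_⟩
      simp only [descent, if_neg hx]
      exact ((sqClass_eq_iff hc hx).2 h).symm

end CurveData

/-! ### Squares and square classes in the p-adic numbers. -/

section Padic

variable {p : ℕ} [hp : Fact p.Prime]

open Polynomial in
-- Hensel's lemma for `X² - z` at the approximate root `a`, where the derivative is `2a`.
theorem PadicInt.isSquare_of_norm_sub_sq_lt {z a : ℤ_[p]} (h : ‖z - a ^ 2‖ < ‖2 * a‖ ^ 2) :
    IsSquare z := by
  obtain ⟨w, hw, -⟩ := hensels_lemma (p := p) (R := ℤ_[p]) (F := X ^ 2 - C z) (a := a) (by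
    simpa [aeval_def, norm_sub_rev, one_add_one_eq_two] using h)
  refine ⟨w, ?_⟩
  simp [aeval_def] at hw
  linear_combination -hw

namespace Padic

theorem norm_two (hp2 : p ≠ 2) : ‖(2 : ℚ_[p])‖ = 1 := by
  have h := (norm_natCast_eq_one_iff (p := p) (n := 2)).2
    ((Nat.coprime_primes hp.out Nat.prime_two).2 hp2)
  exact_mod_cast h

theorem norm_eq_one_of_norm_sub_one_lt {z : ℚ_[p]} (h : ‖z - 1‖ < 1) : ‖z‖ = 1 := by
  have := norm_eq_of_norm_sub_lt_right (z1 := z) (z2 := 1) (by simpa using h)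
  simpa using this

theorem isSquare_of_norm_sub_one_lt (hp2 : p ≠ 2) {z : ℚ_[p]} (h : ‖z - 1‖ < 1) :
    IsSquare z := by
  have h1 := norm_eq_one_of_norm_sub_one_lt h
  obtain ⟨w, hw⟩ := PadicInt.isSquare_of_norm_sub_sq_lt (z := (⟨z, h1.le⟩ : ℤ_[p])) (a := 1) (by
    have h2 : ‖(2 : ℤ_[p])‖ = 1 := by
      rw [PadicInt.norm_def]; exact_mod_cast norm_two hp2
    rw [one_pow, mul_one, h2, one_pow]
    exact h)
  exact ⟨w, by simpa using congrArg (fun t : ℤ_[p] => (t : ℚ_[p])) hw⟩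

/-- Hensel at `a = 1` asks for a norm below `‖2‖² = 1/4`, and `1/8` is the next value: units
congruent to `1` modulo `8` are squares. -/
theorem isSquare_of_norm_sub_one_lt_two {z : ℚ_[2]} (h : ‖z - 1‖ ≤ 1 / 8) :
    IsSquare z := by
  have h1 := norm_eq_one_of_norm_sub_one_lt (h.trans_lt (by norm_num))
  obtain ⟨w, hw⟩ := PadicInt.isSquare_of_norm_sub_sq_lt (z := (⟨z, h1.le⟩ : ℤ_[2])) (a := 1) (by
    have h2 : ‖(2 : ℤ_[2])‖ = 1 / 2 := by
      simpa using PadicInt.norm_p (p := 2)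
    simp only [one_pow, mul_one, h2]
    refine lt_of_le_of_lt (b := 1 / 8) ?_ (by norm_num)
    exact h)
  exact ⟨w, by simpa using congrArg (fun t : ℤ_[2] => (t : ℚ_[2])) hw⟩

/-- The quotient `x / a` is a 1-unit, hence a square. This is the leading-term principle behind all
computations at odd primes: a sum has the square class of its dominant term. -/
theorem isSquare_mul_of_norm_sub_lt (hp2 : p ≠ 2) {x a : ℚ_[p]} (h : ‖x - a‖ < ‖a‖) :
    IsSquare (x * a) := by
  have ha : a ≠ 0 := by
    rintro rfl
    simp at h
    exact absurd h (not_lt.2 (norm_nonneg _))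
  have ha' : 0 < ‖a‖ := norm_pos_iff.2 ha
  have : IsSquare (x / a) := isSquare_of_norm_sub_one_lt hp2 (by
    rw [div_sub_one ha, norm_div, div_lt_one ha']
    exact h)
  rw [← isSquare_mul_sq_iff ha, pow_two, ← mul_assoc, div_mul_cancel₀ _ ha] at this
  exact this

theorem norm_eq_norm_iff {x y : ℚ_[p]} (hx : x ≠ 0) (hy : y ≠ 0) :
    ‖x‖ = ‖y‖ ↔ x.valuation = y.valuation := by
  have hp1 : (1 : ℝ) < p := by exact_mod_cast hp.out.one_lt
  rw [norm_eq_zpow_neg_valuation hx, norm_eq_zpow_neg_valuation hy,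
    zpow_right_inj₀ (by positivity) hp1.ne', neg_inj]

theorem norm_lt_norm_iff {x y : ℚ_[p]} (hx : x ≠ 0) (hy : y ≠ 0) :
    ‖x‖ < ‖y‖ ↔ y.valuation < x.valuation := by
  have hp1 : (1 : ℝ) < p := by exact_mod_cast hp.out.one_lt
  rw [norm_eq_zpow_neg_valuation hx, norm_eq_zpow_neg_valuation hy,
    zpow_lt_zpow_iff_right₀ hp1, neg_lt_neg_iff]

theorem even_valuation_of_isSquare {z : ℚ_[p]} (h : IsSquare z) : Even z.valuation := by
  obtain ⟨r, rfl⟩ := h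
  by_cases hr : r = 0
  · simp [hr]
  · exact ⟨_, valuation_mul hr hr⟩

/-- If `x w` is a square and `w` has the norm of a square, then `x` has even valuation. -/
theorem even_valuation_of_isSquare_mul {x w c : ℚ_[p]} (hx : x ≠ 0) (hc : c ≠ 0)
    (h : IsSquare (x * w)) (hw : ‖w‖ = ‖c‖ ^ 2) : Even x.valuation := by
  have hw0 : w ≠ 0 := by
    rw [← norm_ne_zero_iff, hw]
    exact pow_ne_zero 2 (norm_ne_zero_iff.2 hc)
  have h1 := even_valuation_of_isSquare h
  rw [valuation_mul hx hw0] at h1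
  have h2 : w.valuation = (c ^ 2).valuation :=
    (norm_eq_norm_iff hw0 (pow_ne_zero 2 hc)).1 (by rw [hw, norm_pow])
  rw [h2, valuation_pow] at h1
  rcases h1 with ⟨k, hk⟩
  exact ⟨k - c.valuation, by push_cast at hk; omega⟩

theorem valuation_intCast_eq_zero {a : ℤ} (ha : ¬(p : ℤ) ∣ a) : (a : ℚ_[p]).valuation = 0 := by
  rw [valuation_intCast, padicValInt.eq_zero_of_not_dvd ha, Nat.cast_zero]

theorem norm_intCast_eq_one {a : ℤ} (ha : ¬(p : ℤ) ∣ a) : ‖(a : ℚ_[p])‖ = 1 :=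
  le_antisymm (norm_int_le_one a) (not_lt.1 fun h => ha (norm_intCast_lt_one_iff.1 h))

theorem valuation_intCast_of_dvd_of_squarefree {a : ℤ} (ha : (p : ℤ) ∣ a) (hsq : Squarefree a) :
    (a : ℚ_[p]).valuation = 1 := by
  obtain ⟨b, rfl⟩ := ha
  have hb : ¬(p : ℤ) ∣ b := by
    rintro ⟨c, rfl⟩
    have := hsq p ⟨c, by ring⟩
    exact (Nat.prime_iff_prime_int.1 hp.out).not_isUnit this
  have hb0 : (b : ℚ_[p]) ≠ 0 := by
    rw [Int.cast_ne_zero]; rintro rfl; exact hb (dvd_zero _)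
  have hp0 : (p : ℚ_[p]) ≠ 0 := by exact_mod_cast hp.out.ne_zero
  push_cast
  rw [valuation_mul hp0 hb0, valuation_intCast_eq_zero hb, valuation_p, add_zero]

theorem exists_intCast_norm_sub_le {x : ℚ_[p]} (hx : ‖x‖ ≤ 1) (k : ℕ) :
    ∃ a : ℤ, ‖x - a‖ ≤ (p : ℝ) ^ (-k : ℤ) := by
  have h := PadicInt.appr_spec k (⟨x, hx⟩ : ℤ_[p])
  rw [← PadicInt.norm_le_pow_iff_mem_span_pow] at h
  exact ⟨(PadicInt.appr ⟨x, hx⟩ k : ℕ), h⟩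

theorem exists_intCast_norm_sub_lt_one {x : ℚ_[p]} (hx : ‖x‖ ≤ 1) :
    ∃ a : ℤ, ‖x - a‖ < 1 := by
  obtain ⟨a, ha⟩ := exists_intCast_norm_sub_le hx 1
  refine ⟨a, ha.trans_lt ?_⟩
  have hp1 : (1 : ℝ) < p := by exact_mod_cast hp.out.one_lt
  simpa using inv_lt_one_of_one_lt₀ hp1

/-- An integer prime to the odd prime `p` is a square in `ℚ_p` iff it is a square mod `p`. -/
theorem isSquare_intCast_iff (hp2 : p ≠ 2) {a : ℤ} (ha : ¬(p : ℤ) ∣ a) :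
    IsSquare (a : ℚ_[p]) ↔ jacobiSym a p = 1 := by
  have ha0 : (a : ZMod p) ≠ 0 := by
    rwa [Ne, ZMod.intCast_zmod_eq_zero_iff_dvd]
  rw [← jacobiSym.legendreSym.to_jacobiSym, legendreSym.eq_one_iff p ha0]
  constructor
  · rintro ⟨r, hr⟩
    have hr1 : ‖r‖ = 1 := by
      have := norm_intCast_eq_one ha
      rw [hr, norm_mul, ← pow_two] at this
      exact (pow_eq_one_iff_of_nonneg (norm_nonneg _) two_ne_zero).1 this
    obtain ⟨b, hb⟩ := exists_intCast_norm_sub_lt_one hr1.le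
    refine ⟨b, ?_⟩
    rw [← Int.cast_mul, ZMod.intCast_eq_intCast_iff_dvd_sub, ← norm_intCast_lt_one_iff]
    push_cast
    rw [hr]
    have : (b : ℚ_[p]) * b - r * r = -((r - b) * (r + b)) := by ring
    rw [this, norm_neg, norm_mul]
    have h2 : ‖r + b‖ ≤ 1 := (nonarchimedean _ _).trans (max_le hr1.le (norm_int_le_one b))
    exact (mul_le_of_le_one_right (norm_nonneg _) h2).trans_lt hb
  · rintro ⟨r, hr⟩
    obtain ⟨b, rfl⟩ := ZMod.intCast_surjective r
    rw [← Int.cast_mul, ZMod.intCast_eq_intCast_iff_dvd_sub] at hr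
    have hb : ¬(p : ℤ) ∣ b := by
      intro hb
      exact ha ((dvd_sub_right (hb.mul_right b)).1 hr)
    have hb0 : (b : ℚ_[p]) ≠ 0 := by
      rw [Int.cast_ne_zero]; rintro rfl; exact hb (dvd_zero _)
    have h : IsSquare ((a : ℚ_[p]) * (b * b : ℤ)) := by
      refine isSquare_mul_of_norm_sub_lt hp2 ?_
      rw [norm_intCast_eq_one (fun h => hb ((Int.Prime.dvd_mul' hp.out h).elim id id)),
        norm_sub_rev, ← Int.cast_sub, norm_intCast_lt_one_iff]
      exact hr
    rw [Int.cast_mul, ← pow_two, isSquare_mul_sq_iff hb0] at h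
    exact h

theorem jacobiSym_eq_one_or {a : ℤ} (ha : ¬(p : ℤ) ∣ a) :
    jacobiSym a p = 1 ∨ jacobiSym a p = -1 := by
  apply jacobiSym.eq_one_or_neg_one
  rw [Int.gcd_comm, ← Int.isCoprime_iff_gcd_eq_one]
  exact (Int.isCoprime_iff_gcd_eq_one).2 (by
    rw [← Int.isCoprime_iff_gcd_eq_one]
    exact (Prime.coprime_iff_not_dvd (Nat.prime_iff_prime_int.1 hp.out)).2 ha)

theorem isSquare_intCast_mul (hp2 : p ≠ 2) {a b : ℤ} (ha : ¬(p : ℤ) ∣ a) (hb : ¬(p : ℤ) ∣ b)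
    (h : jacobiSym a p = jacobiSym b p) : IsSquare ((a : ℚ_[p]) * b) := by
  rw [← Int.cast_mul, isSquare_intCast_iff hp2
    (fun h => (Int.Prime.dvd_mul' hp.out h).elim ha hb), jacobiSym.mul_left, h]
  rcases jacobiSym_eq_one_or hb with h | h <;> simp [h]

/-- A unit of `ℤ_p` has the square class of an integer. -/
theorem exists_intCast_isSquare_mul (hp2 : p ≠ 2) {x : ℚ_[p]} (hx : ‖x‖ = 1) :
    ∃ a : ℤ, ¬(p : ℤ) ∣ a ∧ IsSquare (x * a) := by
  obtain ⟨a, ha⟩ := exists_intCast_norm_sub_lt_one hx.le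
  have h1 : ‖(a : ℚ_[p])‖ = 1 := by
    rw [← hx]
    rw [norm_sub_rev] at ha
    exact norm_eq_of_norm_sub_lt_right (by rwa [hx])
  refine ⟨a, ?_, isSquare_mul_of_norm_sub_lt hp2 (by rwa [h1])⟩
  rw [← norm_intCast_lt_one_iff, h1]
  exact lt_irrefl 1

/-- Two nonsquare units of `ℤ_p`, `p` odd, have the same square class. -/
theorem isSquare_mul_of_not_isSquare (hp2 : p ≠ 2) {x u : ℚ_[p]} (hx : ‖x‖ = 1) (hu : ‖u‖ = 1)
    (h1 : ¬IsSquare x) (h2 : ¬IsSquare u) : IsSquare (x * u) := by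
  obtain ⟨a, ha, hxa⟩ := exists_intCast_isSquare_mul hp2 hx
  obtain ⟨b, hb, hub⟩ := exists_intCast_isSquare_mul hp2 hu
  have ha0 : (a : ℚ_[p]) ≠ 0 := by
    rw [Int.cast_ne_zero]; rintro rfl; exact ha (dvd_zero _)
  have hb0 : (b : ℚ_[p]) ≠ 0 := by
    rw [Int.cast_ne_zero]; rintro rfl; exact hb (dvd_zero _)
  have ja : jacobiSym a p = -1 := (jacobiSym_eq_one_or ha).resolve_left fun h =>
    h1 (isSquare_of_isSquare_mul ha0 hxa ((isSquare_intCast_iff hp2 ha).2 h))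
  have jb : jacobiSym b p = -1 := (jacobiSym_eq_one_or hb).resolve_left fun h =>
    h2 (isSquare_of_isSquare_mul hb0 hub ((isSquare_intCast_iff hp2 hb).2 h))
  have hab := isSquare_intCast_mul hp2 ha hb (ja.trans jb.symm)
  exact isSquare_mul_trans hb0 (isSquare_mul_trans ha0 hxa hab) (by rwa [mul_comm])

/-- The four square classes of `ℚ_p` for odd `p`. -/
theorem isSquare_or_of_not_isSquare (hp2 : p ≠ 2) {u ϖ c : ℚ_[p]} (hu : ‖u‖ = 1)
    (hu' : ¬IsSquare u) (hϖ : ϖ.valuation = 1) (hc : c ≠ 0) :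
    IsSquare c ∨ IsSquare (c * u) ∨ IsSquare (c * ϖ) ∨ IsSquare (c * (u * ϖ)) := by
  have hϖ0 : ϖ ≠ 0 := by rintro rfl; simp at hϖ
  have hu0 : u ≠ 0 := by rintro rfl; simp at hu
  -- An element of even valuation becomes a unit after multiplication by an even power of `ϖ`, and
  -- units have only the two classes `1` and `u`.
  have key : ∀ d : ℚ_[p], d ≠ 0 → Even d.valuation → IsSquare d ∨ IsSquare (d * u) := by
    rintro d hd ⟨k, hk⟩
    have hd' : ‖d * (ϖ ^ (-k)) ^ 2‖ = 1 := by
      have h0 : (ϖ ^ (-k)) ^ 2 ≠ 0 := pow_ne_zero 2 (zpow_ne_zero _ hϖ0)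
      rw [← norm_one (α := ℚ_[p]), norm_eq_norm_iff (mul_ne_zero hd h0) one_ne_zero,
        valuation_mul hd h0, valuation_pow, valuation_zpow, hϖ, hk, valuation_one]
      push_cast; ring
    by_cases hs : IsSquare (d * (ϖ ^ (-k)) ^ 2)
    · exact Or.inl ((isSquare_mul_sq_iff (zpow_ne_zero _ hϖ0)).1 hs)
    · refine Or.inr ((isSquare_mul_sq_iff (zpow_ne_zero (-k) hϖ0)).1 ?_)
      have := isSquare_mul_of_not_isSquare hp2 hd' hu hs hu'
      rwa [mul_right_comm] at this
  rcases Int.even_or_odd c.valuation with h | h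
  · rcases key c hc h with h | h
    · exact Or.inl h
    · exact Or.inr (Or.inl h)
  · rcases key (c * ϖ) (mul_ne_zero hc hϖ0) (by
      rw [valuation_mul hc hϖ0, hϖ]; exact h.add_one) with h | h
    · exact Or.inr (Or.inr (Or.inl h))
    · refine Or.inr (Or.inr (Or.inr ?_))
      rwa [mul_assoc, mul_comm ϖ] at h

/-- A unit of `ℤ_2` is congruent to an odd integer mod `8`. -/
theorem exists_odd_norm_sub_le {x : ℚ_[2]} (hx : ‖x‖ = 1) :
    ∃ a : ℤ, Odd a ∧ ‖x - a‖ ≤ 1 / 8 := by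
  obtain ⟨a, ha⟩ := exists_intCast_norm_sub_le hx.le 3
  have ha' : ‖x - a‖ ≤ 1 / 8 := by
    refine ha.trans (le_of_eq ?_)
    norm_num
  refine ⟨a, ?_, ha'⟩
  have h1 : ‖(a : ℚ_[2])‖ = 1 := by
    rw [← hx]
    rw [norm_sub_rev] at ha'
    exact norm_eq_of_norm_sub_lt_right (ha'.trans_lt (by rw [hx]; norm_num))
  rw [← Int.not_even_iff_odd, even_iff_two_dvd]
  intro h
  have := (norm_intCast_lt_one_iff (p := 2) (k := a)).2 (by exact_mod_cast h)
  exact absurd h1 this.ne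

theorem eight_dvd_iff_norm_le (a : ℤ) : ‖(a : ℚ_[2])‖ ≤ 1 / 8 ↔ (8 : ℤ) ∣ a := by
  have h := norm_int_le_pow_iff_dvd (p := 2) a 3
  norm_num at h
  norm_num
  exact h

theorem norm_intCast_two_of_odd {a : ℤ} (ha : Odd a) : ‖(a : ℚ_[2])‖ = 1 :=
  norm_intCast_eq_one (by
    intro h
    exact (Int.not_even_iff_odd.2 ha) (even_iff_two_dvd.2 (by exact_mod_cast h)))

theorem isSquare_mul_of_norm_sub_le {x : ℚ_[2]} {a : ℤ} (ha : Odd a)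
    (h : ‖x - a‖ ≤ 1 / 8) : IsSquare (x * a) := by
  have h1 := norm_intCast_two_of_odd ha
  have ha0 : (a : ℚ_[2]) ≠ 0 := by rw [← norm_ne_zero_iff, h1]; exact one_ne_zero
  have : IsSquare (x / a) := isSquare_of_norm_sub_one_lt_two (by
    rw [div_sub_one ha0, norm_div, h1, div_one]
    exact h)
  rw [← isSquare_mul_sq_iff ha0, pow_two, ← mul_assoc, div_mul_cancel₀ _ ha0] at this
  exact this

theorem isSquare_intCast_two_iff {a : ℤ} (ha : Odd a) : IsSquare (a : ℚ_[2]) ↔ a % 8 = 1 := by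
  constructor
  · rintro ⟨r, hr⟩
    have hr1 : ‖r‖ = 1 := by
      have := norm_intCast_two_of_odd ha
      rw [hr, norm_mul, ← pow_two] at this
      exact (pow_eq_one_iff_of_nonneg (norm_nonneg _) two_ne_zero).1 this
    obtain ⟨b, hb, hrb⟩ := exists_odd_norm_sub_le hr1
    have h8 : (8 : ℤ) ∣ a - b ^ 2 := by
      rw [← eight_dvd_iff_norm_le]
      push_cast
      have : (a : ℚ_[2]) - b ^ 2 = (r - b) * (r + b) := by rw [hr]; ring
      rw [this, norm_mul]
      have h2 : ‖r + b‖ ≤ 1 := (nonarchimedean _ _).trans (max_le hr1.le (norm_int_le_one b))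
      exact (mul_le_of_le_one_right (norm_nonneg _) h2).trans hrb
    have hb8 : b ^ 2 % 8 = 1 := by
      rcases hb with ⟨k, rfl⟩
      have : (2 * k + 1) ^ 2 = 4 * (k * (k + 1)) + 1 := by ring
      obtain ⟨j, hj⟩ := Int.even_mul_succ_self k
      omega
    omega
  · intro h
    have h8 : (8 : ℤ) ∣ a - 1 := by omega
    rw [← eight_dvd_iff_norm_le] at h8
    exact isSquare_of_norm_sub_one_lt_two (by exact_mod_cast h8)

end Padic

end Padic

theorem IsSquare.of_eq {K : Type*} [Mul K] {a b : K} (h : IsSquare a) (e : a = b) : IsSquare b :=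
  e ▸ h

/-! ### The descent maps of E and E' in explicit form. -/

section DescentPiThird

variable {K : Type} [Field K] [CharZero K] {n : ℕ}

theorem curvePiThird_disc_ne_zero (hn : n ≠ 0) : (curvePiThird n).disc ≠ 0 := by
  have : (curvePiThird n).disc = 144 * (n : ℤ) ^ 6 := by
    simp only [CurveData.disc, curvePiThird]; ring
  rw [this]
  positivity

theorem curvePiThird_dual_disc_ne_zero (hn : n ≠ 0) : (curvePiThird n).dual.disc ≠ 0 := by
  have : (curvePiThird n).dual.disc = -12288 * (n : ℤ) ^ 6 := by
    simp only [CurveData.disc, CurveData.dual, curvePiThird]; ring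
  rw [this]
  have : (n : ℤ) ^ 6 ≠ 0 := by positivity
  omega

/-- The alternative `-3` is the point `(0,0)`, since `B = -3n²`. -/
theorem mem_range_descent_piThird_iff (hn : n ≠ 0) {c : K} (hc : c ≠ 0) :
    sqClass c ∈ Set.range ((curvePiThird n).descent K) ↔
      IsSquare c ∨ IsSquare (c * (-3)) ∨
        ∃ x : K, x ≠ 0 ∧ IsSquare (x * ((x - n) * (x + 3 * n))) ∧ IsSquare (c * x) := by
  have hn' : (n : K) ≠ 0 := by exact_mod_cast hn
  rw [CurveData.sqClass_mem_range_descent_iff _ _ (curvePiThird_disc_ne_zero hn) hc]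
  have h1 : c * (((curvePiThird n).B : ℤ) : K) = c * (-3) * (n : K) ^ 2 := by
    simp only [curvePiThird]; push_cast; ring
  have h2 : ∀ x : K, x ^ 2 + (((curvePiThird n).A : ℤ) : K) * x + (((curvePiThird n).B : ℤ) : K)
      = (x - n) * (x + 3 * n) := by
    intro x; simp only [curvePiThird]; push_cast; ring
  simp only [h1, h2, isSquare_mul_sq_iff hn']

/-- For `E'` the coefficients are `-4n` and `16n²`; the latter is a square, so `(0,0)` contributes
only the trivial class and its alternative disappears. -/
theorem mem_range_descent_piThird_dual_iff (hn : n ≠ 0) {c : K} (hc : c ≠ 0) :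
    sqClass c ∈ Set.range ((curvePiThird n).dual.descent K) ↔
      IsSquare c ∨
        ∃ x : K, x ≠ 0 ∧ IsSquare (x * (x ^ 2 - 4 * n * x + 16 * n ^ 2)) ∧ IsSquare (c * x) := by
  have hn' : (4 * n : K) ≠ 0 := by exact_mod_cast (by omega : 4 * n ≠ 0)
  rw [CurveData.sqClass_mem_range_descent_iff _ _ (curvePiThird_dual_disc_ne_zero hn) hc]
  have h1 : c * (((curvePiThird n).dual.B : ℤ) : K) = c * (4 * n : K) ^ 2 := by
    simp only [curvePiThird, CurveData.dual]; push_cast; ring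
  have h2 : ∀ x : K, x ^ 2 + (((curvePiThird n).dual.A : ℤ) : K) * x
      + (((curvePiThird n).dual.B : ℤ) : K) = x ^ 2 - 4 * n * x + 16 * n ^ 2 := by
    intro x; simp only [curvePiThird, CurveData.dual]; push_cast; ring
  simp only [h1, h2, isSquare_mul_sq_iff hn', or_self_left]

/-- Realised by the 2-torsion point `(n, 0)`; the next lemma uses `(-3n, 0)`. -/
theorem mem_range_descent_of_isSquare_mul_n (hn : n ≠ 0) {c : K} (hc : c ≠ 0)
    (h : IsSquare (c * n)) : sqClass c ∈ Set.range ((curvePiThird n).descent K) :=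
  (mem_range_descent_piThird_iff hn hc).2
    (Or.inr (Or.inr ⟨n, by exact_mod_cast hn, by simp, h⟩))

theorem mem_range_descent_of_isSquare_mul_neg_three_n (hn : n ≠ 0) {c : K} (hc : c ≠ 0)
    (h : IsSquare (c * (-3 * n))) : sqClass c ∈ Set.range ((curvePiThird n).descent K) :=
  (mem_range_descent_piThird_iff hn hc).2 (Or.inr (Or.inr ⟨-3 * n,
    mul_ne_zero (by norm_num) (by exact_mod_cast hn), by simp, h⟩))

/-! ### The real place -/

/-- The 2-torsion points with abscissas `n` and `-3n` already give both signs. -/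
theorem mem_range_descent_real (hn : n ≠ 0) {c : ℝ} (hc : c ≠ 0) :
    sqClass c ∈ Set.range ((curvePiThird n).descent ℝ) := by
  have hn' : (0 : ℝ) < n := by exact_mod_cast Nat.pos_of_ne_zero hn
  rcases lt_or_gt_of_ne hc with h | h
  · exact mem_range_descent_of_isSquare_mul_neg_three_n hn hc
      (Real.isSquare_iff.2 (by nlinarith))
  · exact mem_range_descent_of_isSquare_mul_n hn hc (Real.isSquare_iff.2 (by positivity))

theorem mem_range_dual_descent_real_iff (hn : n ≠ 0) {c : ℝ} (hc : c ≠ 0) :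
    sqClass c ∈ Set.range ((curvePiThird n).dual.descent ℝ) ↔ 0 < c := by
  have hn' : (0 : ℝ) < n := by exact_mod_cast Nat.pos_of_ne_zero hn
  rw [mem_range_descent_piThird_dual_iff hn hc]
  constructor
  · rintro (h | ⟨x, hx, h1, h2⟩)
    · exact lt_of_le_of_ne (Real.isSquare_iff.1 h) hc.symm
    · rw [Real.isSquare_iff] at h1 h2
      -- The quadratic factor is `(x - 2n)² + 12n²`.
      have h3 : 0 < x ^ 2 - 4 * n * x + 16 * n ^ 2 := by nlinarith [sq_nonneg (x - 2 * n)]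
      have h4 : 0 < x := lt_of_le_of_ne (nonneg_of_mul_nonneg_left h1 h3) hx.symm
      exact lt_of_le_of_ne (nonneg_of_mul_nonneg_left h2 h4) hc.symm
  · exact fun h => Or.inl (Real.isSquare_iff.2 h.le)

end DescentPiThird

/-! ### Local images at the primes dividing n other than 3. -/

namespace Padic

section Odd

variable {p : ℕ} [hp : Fact p.Prime]

theorem norm_sub_le_of_le {x y : ℚ_[p]} {r : ℝ} (hx : ‖x‖ ≤ r) (hy : ‖y‖ ≤ r) : ‖x - y‖ ≤ r := by
  rw [sub_eq_add_neg]
  exact (nonarchimedean _ _).trans (max_le hx (by rwa [norm_neg]))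

theorem norm_add_lt_of_lt {x y : ℚ_[p]} {r : ℝ} (hx : ‖x‖ < r) (hy : ‖y‖ < r) : ‖x + y‖ < r :=
  (nonarchimedean _ _).trans_lt (max_lt hx hy)

/-- On `y² = x (x² + a x + b)` with `‖a‖ ≤ r` and `‖b‖ = r²`, the points with `‖x‖ ≠ r` have
`x` in the class of `1` or `b`. -/
theorem isSquare_or_of_norm_ne (hp2 : p ≠ 2) {x a b : ℚ_[p]} {r : ℝ} (hx : x ≠ 0) (hr : 0 < r)
    (ha : ‖a‖ ≤ r) (hb : ‖b‖ = r ^ 2) (h : IsSquare (x * (x ^ 2 + a * x + b)))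
    (hxr : ‖x‖ ≠ r) : IsSquare x ∨ IsSquare (x * b) := by
  have hx' : 0 < ‖x‖ := norm_pos_iff.2 hx
  have hb0 : b ≠ 0 := by rw [← norm_ne_zero_iff, hb]; positivity
  rcases lt_or_gt_of_ne hxr with hlt | hgt
  · right
    -- For `‖x‖ < r` the constant term dominates the quadratic factor; for `‖x‖ > r`, treated below,
    -- `x²` does.
    have h1 : IsSquare ((x ^ 2 + a * x + b) * b) := isSquare_mul_of_norm_sub_lt hp2 (by
      rw [add_sub_cancel_right, hb]
      refine norm_add_lt_of_lt ?_ ?_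
      · rw [norm_pow]; gcongr
      · rw [norm_mul, pow_two]
        exact mul_lt_mul' ha hlt hx'.le hr)
    have h0 : x ^ 2 + a * x + b ≠ 0 := by
      intro h0
      have h2 : ‖x ^ 2 + a * x‖ < ‖b‖ := by
        rw [hb]
        refine norm_add_lt_of_lt ?_ ?_
        · rw [norm_pow]; gcongr
        · rw [norm_mul, pow_two]
          exact mul_lt_mul' ha hlt hx'.le hr
      rw [eq_neg_of_add_eq_zero_left h0, norm_neg] at h2
      exact lt_irrefl _ h2
    exact isSquare_mul_trans h0 h h1
  · left
    have h2 : ‖a * x + b‖ < ‖x ^ 2‖ := by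
      refine norm_add_lt_of_lt ?_ ?_
      · rw [norm_mul, norm_pow, pow_two]
        exact mul_lt_mul_of_pos_right (ha.trans_lt hgt) hx'
      · rw [hb, norm_pow]; gcongr
    have h1 : IsSquare ((x ^ 2 + a * x + b) * x ^ 2) := isSquare_mul_of_norm_sub_lt hp2 (by
      rwa [add_assoc, add_sub_cancel_left])
    rw [isSquare_mul_sq_iff hx] at h1
    have h0 : x ^ 2 + a * x + b ≠ 0 := by
      intro h0
      rw [add_assoc] at h0
      rw [eq_neg_of_add_eq_zero_right h0, norm_neg] at h2
      exact lt_irrefl _ h2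
    exact isSquare_of_isSquare_mul h0 h h1

/-- The possible classes of `x` on `y² = x (x - a) (x - b)` if `a` and `b` have the same odd
valuation. -/
theorem isSquare_or_of_odd_valuation (hp2 : p ≠ 2) {x a b : ℚ_[p]} (hx : x ≠ 0)
    (hab : ‖a‖ = ‖b‖) (ha : Odd a.valuation) (h : IsSquare (x * ((x - a) * (x - b)))) :
    IsSquare x ∨ IsSquare (x * (a * b)) ∨ IsSquare (x * a) ∨ IsSquare (x * b) := by
  have ha0 : a ≠ 0 := by rintro rfl; simp at ha
  by_cases hxa : ‖x‖ = ‖a‖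
  · by_cases h1 : ‖x - a‖ < ‖a‖
    · exact Or.inr (Or.inr (Or.inl (isSquare_mul_of_norm_sub_lt hp2 h1)))
    by_cases h2 : ‖x - b‖ < ‖b‖
    · exact Or.inr (Or.inr (Or.inr (isSquare_mul_of_norm_sub_lt hp2 h2)))
    -- If `x` is close to neither root, then `(x - a)(x - b)` has the norm of `a²`, so `x` has even
    -- valuation, against `‖x‖ = ‖a‖`.
    exfalso
    have h1' : ‖x - a‖ = ‖a‖ := le_antisymm (norm_sub_le_of_le hxa.le le_rfl) (not_lt.1 h1)
    have h2' : ‖x - b‖ = ‖a‖ := by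
      rw [hab]
      exact le_antisymm (norm_sub_le_of_le (hxa.trans hab).le le_rfl) (not_lt.1 h2)
    have := even_valuation_of_isSquare_mul hx ha0 h (by rw [norm_mul, h1', h2', pow_two])
    rw [(norm_eq_norm_iff hx ha0).1 hxa] at this
    exact Int.not_even_iff_odd.2 ha this
  · have := isSquare_or_of_norm_ne (a := -(a + b)) (b := a * b) (r := ‖a‖) hp2 hx
      (norm_pos_iff.2 ha0)
      (by rw [norm_neg]; exact (nonarchimedean _ _).trans (max_le le_rfl hab.ge))
      (by rw [norm_mul, ← hab, pow_two]) (h.of_eq (by ring)) hxa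
    tauto

variable {n : ℕ}

theorem natCast_ne_zero_of_valuation (hv : (n : ℚ_[p]).valuation = 1) : (n : ℚ_[p]) ≠ 0 := by
  intro h; simp [h] at hv

theorem ne_zero_of_valuation (hv : (n : ℚ_[p]).valuation = 1) : n ≠ 0 := by
  rintro rfl; simp at hv

theorem norm_three (hp3 : p ≠ 3) : ‖(3 : ℚ_[p])‖ = 1 := by
  have h := (norm_natCast_eq_one_iff (p := p) (n := 3)).2
    ((Nat.coprime_primes hp.out Nat.prime_three).2 hp3)
  exact_mod_cast h

/-- The roots `n` and `-3n` have the same odd valuation, so `isSquare_or_of_odd_valuation` leaves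
only the classes of the 2-torsion points. As `-3` is a square, these collapse to `1` and `n`. -/
theorem mem_range_descent_split_iff (hp2 : p ≠ 2) (hp3 : p ≠ 3)
    (hv : (n : ℚ_[p]).valuation = 1) (h3 : IsSquare (-3 : ℚ_[p])) {c : ℚ_[p]} (hc : c ≠ 0) :
    sqClass c ∈ Set.range ((curvePiThird n).descent ℚ_[p]) ↔ IsSquare c ∨ IsSquare (c * n) := by
  have hn := natCast_ne_zero_of_valuation hv
  constructor
  · rw [mem_range_descent_piThird_iff (ne_zero_of_valuation hv) hc]
    rintro (h | h | ⟨x, hx, h1, h2⟩)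
    · exact Or.inl h
    · exact Or.inl (isSquare_of_isSquare_mul (by norm_num) h h3)
    · have h3n : IsSquare (x * n * (-3)) → IsSquare (x * n) := fun h =>
        isSquare_of_isSquare_mul (by norm_num) h h3
      rcases isSquare_or_of_odd_valuation (a := n) (b := -3 * n) hp2 hx
        (by rw [norm_mul, norm_neg, norm_three hp3, one_mul]) (by rw [hv]; exact odd_one)
        (h1.of_eq (by ring)) with h | h | h | h
      · exact Or.inl (isSquare_of_isSquare_mul hx h2 h)
      · have : IsSquare (x * (-3)) := by
          exact (isSquare_mul_sq_iff hn).1 (h.of_eq (by ring))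
        exact Or.inl (isSquare_of_isSquare_mul hx h2
          (isSquare_of_isSquare_mul (by norm_num) this h3))
      · exact Or.inr (isSquare_mul_trans hx h2 h)
      · exact Or.inr (isSquare_mul_trans hx h2 (h3n (h.of_eq (by ring))))
  · rintro (h | h)
    · exact (mem_range_descent_piThird_iff (ne_zero_of_valuation hv) hc).2 (Or.inl h)
    · exact mem_range_descent_of_isSquare_mul_n (ne_zero_of_valuation hv) hc h

/-- With `√-3` available, `x² - 4nx + 16n²` has the roots `4nα` and `4nβ`, where `α`, `β` are the
primitive sixth roots of unity. Since `α = -β²` and `β = -α²`, both roots have the class of `-n`,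
and `isSquare_or_of_odd_valuation` applies again. -/
theorem mem_range_dual_descent_split_iff (hp2 : p ≠ 2)
    (hv : (n : ℚ_[p]).valuation = 1) (h3 : IsSquare (-3 : ℚ_[p])) {c : ℚ_[p]} (hc : c ≠ 0) :
    sqClass c ∈ Set.range ((curvePiThird n).dual.descent ℚ_[p]) ↔
      IsSquare c ∨ IsSquare (c * (-n)) := by
  have hn := natCast_ne_zero_of_valuation hv
  obtain ⟨s, hs⟩ := h3
  have h20 : (2 : ℚ_[p]) ≠ 0 := by norm_num
  -- Here `s` is a square root of `-3`, so `α` and `β` are the roots of `X² - X + 1`.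
  set α : ℚ_[p] := (1 + s) / 2 with hα
  set β : ℚ_[p] := (1 - s) / 2 with hβ
  have hsum : α + β = 1 := by rw [hα, hβ]; field_simp; ring
  have hprod : α * β = 1 := by
    rw [hα, hβ]; field_simp; linear_combination hs
  have hα2 : α = -(β ^ 2) := by linear_combination (1 + β) * hsum - hprod
  have hβ2 : β = -(α ^ 2) := by linear_combination (1 + α) * hsum - hprod
  have hα0 : α ≠ 0 := by intro h; simp [h] at hprod
  have hβ0 : β ≠ 0 := by intro h; simp [h] at hprod
  have hnα : ‖α‖ = 1 := by
    have h1 := congrArg norm hprod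
    rw [hβ2, mul_neg, norm_neg, norm_mul, norm_pow, norm_one, ← pow_succ'] at h1
    exact (pow_eq_one_iff_of_nonneg (norm_nonneg _) three_ne_zero).1 h1
  have hnβ : ‖β‖ = 1 := by rw [hβ2, norm_neg, norm_pow, hnα, one_pow]
  have hn4 : ‖(4 * n : ℚ_[p])‖ = ‖(n : ℚ_[p])‖ := by
    rw [show (4 : ℚ_[p]) = 2 * 2 by norm_num, norm_mul, norm_mul, norm_two hp2]; ring
  have hcl : ∀ {x γ δ : ℚ_[p]}, δ ≠ 0 → γ = -(δ ^ 2) → IsSquare (x * (4 * n * γ)) →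
      IsSquare (x * (-n)) := by
    intro x γ δ hδ hγ h
    rw [← isSquare_mul_sq_iff (mul_ne_zero h20 hδ)]
    exact h.of_eq (by rw [hγ]; ring)
  rw [mem_range_descent_piThird_dual_iff (ne_zero_of_valuation hv) hc]
  constructor
  · rintro (h | ⟨x, hx, h1, h2⟩)
    · exact Or.inl h
    · rcases isSquare_or_of_odd_valuation (a := 4 * n * α) (b := 4 * n * β) hp2 hx
        (by rw [norm_mul, norm_mul _ β, hnα, hnβ])
        (by
          rw [(norm_eq_norm_iff (mul_ne_zero (mul_ne_zero (by norm_num) hn) hα0) hn).1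
            (by rw [norm_mul, hnα, mul_one, hn4]), hv]
          exact odd_one)
        (h1.of_eq (by linear_combination (4 * n * x ^ 2) * hsum - x * 16 * n ^ 2 * hprod)) with h | h | h | h
      · exact Or.inl (isSquare_of_isSquare_mul hx h2 h)
      · have : IsSquare x := by
          rw [← isSquare_mul_sq_iff (mul_ne_zero (mul_ne_zero h20 h20) hn)]
          exact h.of_eq (by linear_combination x * 16 * n ^ 2 * hprod)
        exact Or.inl (isSquare_of_isSquare_mul hx h2 this)
      · exact Or.inr (isSquare_mul_trans hx h2 (hcl hβ0 hα2 h))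
      · exact Or.inr (isSquare_mul_trans hx h2 (hcl hα0 hβ2 h))
  · rintro (h | h)
    · exact Or.inl h
    · refine Or.inr ⟨4 * n * α, mul_ne_zero (mul_ne_zero (by norm_num) hn) hα0, ?_, ?_⟩
      · refine IsSquare.zero.of_eq ?_
        linear_combination -(4 * n * α) * ((16 * n ^ 2) * (α * hsum - hprod))
      · rw [← isSquare_mul_sq_iff (mul_ne_zero h20 hβ0)] at h
        exact h.of_eq (by rw [hα2]; ring)

/-- The nonsquare unit `-3` and the uniformiser `n` generate all four square classes, and each of
`1`, `-3`, `n`, `-3n` comes from a 2-torsion point. -/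
theorem mem_range_descent_of_not_isSquare (hp2 : p ≠ 2) (hp3 : p ≠ 3)
    (hv : (n : ℚ_[p]).valuation = 1) (h3 : ¬IsSquare (-3 : ℚ_[p])) {c : ℚ_[p]} (hc : c ≠ 0) :
    sqClass c ∈ Set.range ((curvePiThird n).descent ℚ_[p]) := by
  have hn := ne_zero_of_valuation hv
  rcases isSquare_or_of_not_isSquare hp2 (by rw [norm_neg, norm_three hp3]) h3 hv hc
    with h | h | h | h
  · exact (mem_range_descent_piThird_iff hn hc).2 (Or.inl h)
  · exact (mem_range_descent_piThird_iff hn hc).2 (Or.inr (Or.inl h))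
  · exact mem_range_descent_of_isSquare_mul_n hn hc h
  · exact mem_range_descent_of_isSquare_mul_neg_three_n hn hc h

/-- The constant term `(4n)²` is a square, so both alternatives of `isSquare_or_of_norm_ne`
coincide. Only `‖x‖ = ‖n‖` then needs separate treatment. -/
theorem isSquare_of_norm_ne_of_isSquare_dual (hp2 : p ≠ 2) (hn : (n : ℚ_[p]) ≠ 0) {x : ℚ_[p]}
    (hx : x ≠ 0) (h : IsSquare (x * (x ^ 2 - 4 * n * x + 16 * n ^ 2)))
    (hxn : ‖x‖ ≠ ‖(n : ℚ_[p])‖) : IsSquare x := by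
  have h4 : ‖(4 : ℚ_[p])‖ = 1 := by
    rw [show (4 : ℚ_[p]) = 2 * 2 by norm_num, norm_mul, norm_two hp2, one_mul]
  have := isSquare_or_of_norm_ne (a := -(4 * n)) (b := (4 * n) ^ 2) (r := ‖(n : ℚ_[p])‖) hp2 hx
    (norm_pos_iff.2 hn) (by rw [norm_neg, norm_mul, h4, one_mul])
    (by rw [norm_pow, norm_mul, h4, one_mul]) (h.of_eq (by ring)) hxn
  rwa [isSquare_mul_sq_iff (mul_ne_zero (by norm_num) hn), or_self] at this

/-- The quadratic factor is `(x - 2n)² - (-3)(2n)²`, where no cancellation can occur because `-3` is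
not a square. So for `‖x‖ = ‖n‖` it has norm `‖n‖²`, which forces `x` to have even valuation
although `n` has valuation `1`. -/
theorem mem_range_dual_descent_of_not_isSquare_iff (hp2 : p ≠ 2) (hp3 : p ≠ 3)
    (hv : (n : ℚ_[p]).valuation = 1) (h3 : ¬IsSquare (-3 : ℚ_[p])) {c : ℚ_[p]} (hc : c ≠ 0) :
    sqClass c ∈ Set.range ((curvePiThird n).dual.descent ℚ_[p]) ↔ IsSquare c := by
  have hn := natCast_ne_zero_of_valuation hv
  rw [mem_range_descent_piThird_dual_iff (ne_zero_of_valuation hv) hc]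
  refine ⟨?_, Or.inl⟩
  rintro (h | ⟨x, hx, h1, h2⟩)
  · exact h
  refine isSquare_of_isSquare_mul hx h2 ?_
  by_cases hxn : ‖x‖ = ‖(n : ℚ_[p])‖
  · exfalso
    set w := x ^ 2 - 4 * n * x + 16 * n ^ 2 with hw
    have h12 : ‖(-3 * (2 * n) ^ 2 : ℚ_[p])‖ = ‖(n : ℚ_[p])‖ ^ 2 := by
      rw [norm_mul, norm_neg, norm_three hp3, one_mul, norm_pow, norm_mul, norm_two hp2, one_mul]
    have hle : ‖(x - 2 * n) ^ 2‖ ≤ ‖(n : ℚ_[p])‖ ^ 2 := by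
      rw [norm_pow]
      gcongr
      exact norm_sub_le_of_le hxn.le (by rw [norm_mul, norm_two hp2, one_mul])
    have hw' : w = (x - 2 * n) ^ 2 - -3 * (2 * n) ^ 2 := by rw [hw]; ring
    by_cases hlt : ‖w‖ < ‖(n : ℚ_[p])‖ ^ 2
    -- Cancellation would put the two terms in the same square class and make `-3` a square.
    · have h4 : IsSquare ((x - 2 * n) ^ 2 * (-3 * (2 * n) ^ 2) : ℚ_[p]) :=
        isSquare_mul_of_norm_sub_lt hp2 (by rw [← hw', h12]; exact hlt)
      have h0 : x - 2 * n ≠ 0 := by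
        intro h0
        rw [hw', h0, zero_pow two_ne_zero, zero_sub, norm_neg, h12] at hlt
        exact lt_irrefl _ hlt
      rw [mul_comm, isSquare_mul_sq_iff h0,
        isSquare_mul_sq_iff (mul_ne_zero (by norm_num) hn)] at h4
      exact h3 h4
    · have := even_valuation_of_isSquare_mul hx hn h1
        (le_antisymm (by rw [hw']; exact norm_sub_le_of_le hle h12.le) (not_lt.1 hlt))
      rw [(norm_eq_norm_iff hx hn).1 hxn, hv] at this
      exact absurd this (by decide)
  · exact isSquare_of_norm_ne_of_isSquare_dual hp2 hn hx h1 hxn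

end Odd

/-! ### Local images at 3. -/

section Three

variable {m : ℤ} {n : ℕ}

theorem isSquare_intCast_three_iff {a : ℤ} (ha : ¬(3 : ℤ) ∣ a) :
    IsSquare (a : ℚ_[3]) ↔ a % 3 = 1 := by
  rw [isSquare_intCast_iff (by norm_num) (by exact_mod_cast ha), jacobiSym.mod_left]
  have : a % 3 = 1 ∨ a % 3 = 2 := by omega
  rcases this with h | h
  · simp [h]
  · rw [show a % ((3 : ℕ) : ℤ) = 2 from h, h]; norm_num

theorem valuation_three_mul (h : ¬(3 : ℤ) ∣ m) (hn : (n : ℤ) = 3 * m) :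
    (n : ℚ_[3]).valuation = 1 := by
  have hm0 : (m : ℚ_[3]) ≠ 0 := by
    rw [Int.cast_ne_zero]; rintro rfl; exact h (dvd_zero _)
  have h1 : (n : ℚ_[3]) = (3 : ℕ) * (m : ℚ_[3]) := by exact_mod_cast congrArg (Int.cast (R := ℚ_[3])) hn
  rw [h1, valuation_mul (by norm_num) hm0, valuation_p,
    valuation_intCast_eq_zero (by exact_mod_cast h), add_zero]

/-- Here `-m` is a nonsquare unit and `n` a uniformiser. The identities `-3n = -m · 3²` and `-mn =
-3m²` show that the 2-torsion classes `1`, `-3n`, `n`, `-3` are all four classes. -/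
theorem mem_range_descent_three (hm : m % 3 = 1) (hn : (n : ℤ) = 3 * m) {c : ℚ_[3]}
    (hc : c ≠ 0) : sqClass c ∈ Set.range ((curvePiThird n).descent ℚ_[3]) := by
  have hv := valuation_three_mul (m := m) (by omega) hn
  have hn0 := ne_zero_of_valuation hv
  have h1 : (n : ℚ_[3]) = 3 * (m : ℚ_[3]) := by exact_mod_cast congrArg (Int.cast (R := ℚ_[3])) hn
  have hm1 : ¬IsSquare ((-m : ℤ) : ℚ_[3]) := by
    rw [isSquare_intCast_three_iff (by omega)]; omega
  have h30 : (3 : ℚ_[3]) ≠ 0 := by norm_num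
  have hm0 : (m : ℚ_[3]) ≠ 0 := by
    rw [Int.cast_ne_zero]; rintro rfl; simp at hm
  rcases isSquare_or_of_not_isSquare (by norm_num)
    (norm_intCast_eq_one (p := 3) (a := -m) (by push_cast; omega)) hm1 hv hc with h | h | h | h
  · exact (mem_range_descent_piThird_iff hn0 hc).2 (Or.inl h)
  · refine mem_range_descent_of_isSquare_mul_neg_three_n hn0 hc ?_
    rw [← isSquare_mul_sq_iff h30] at h
    exact h.of_eq (by rw [h1]; push_cast; ring)
  · exact mem_range_descent_of_isSquare_mul_n hn0 hc h
  · refine (mem_range_descent_piThird_iff hn0 hc).2 (Or.inr (Or.inl ?_))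
    rw [← isSquare_mul_sq_iff hm0]
    exact h.of_eq (by rw [h1]; push_cast; ring)

theorem norm_three_three : ‖(3 : ℚ_[3])‖ = 1 / 3 := by
  simpa using norm_p (p := 3)

/-- Now `-3n = -m · 3²` is a square, so `n` and `-3` have the same class and the torsion gives only
two classes. That nothing else occurs is a case analysis on the position of `‖x‖` relative to `‖3n‖
< ‖n‖`, the norms of the nonzero roots: away from the roots dominant terms decide the class or force
an odd valuation to be even, and near a root `x` has the class of that root. -/
theorem mem_range_descent_three_iff (hm : m % 3 = 2) (hn : (n : ℤ) = 3 * m) {c : ℚ_[3]}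
    (hc : c ≠ 0) : sqClass c ∈ Set.range ((curvePiThird n).descent ℚ_[3]) ↔
      IsSquare c ∨ IsSquare (c * (-3)) := by
  have hv := valuation_three_mul (m := m) (by omega) hn
  have hn0 := ne_zero_of_valuation hv
  have hn' := natCast_ne_zero_of_valuation hv
  have h1 : (n : ℚ_[3]) = 3 * (m : ℚ_[3]) := by exact_mod_cast congrArg (Int.cast (R := ℚ_[3])) hn
  have hm1 : IsSquare ((-m : ℤ) : ℚ_[3]) := by
    rw [isSquare_intCast_three_iff (by omega)]; omega
  have h30 : (3 : ℚ_[3]) ≠ 0 := by norm_num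
  have h2p : (3 : ℕ) ≠ 2 := by norm_num
  have hneg : IsSquare ((n : ℚ_[3]) * (-3)) := by
    rw [← isSquare_mul_sq_iff h30] at hm1
    exact hm1.of_eq (by rw [h1]; push_cast; ring)
  rw [mem_range_descent_piThird_iff hn0 hc]
  constructor
  · rintro (h | h | ⟨x, hx, h2, h3⟩)
    · exact Or.inl h
    · exact Or.inr h
    suffices h : IsSquare x ∨ IsSquare (x * n) by
      rcases h with h | h
      · exact Or.inl (isSquare_of_isSquare_mul hx h3 h)
      · exact Or.inr (isSquare_mul_trans hx h3 (isSquare_mul_trans hn' h hneg))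
    have hnpos : 0 < ‖(n : ℚ_[3])‖ := norm_pos_iff.2 hn'
    have h3n : ‖(3 * n : ℚ_[3])‖ = ‖(n : ℚ_[3])‖ / 3 := by
      rw [norm_mul, norm_three_three]; ring
    have h3lt : ‖(3 * n : ℚ_[3])‖ < ‖(n : ℚ_[3])‖ := by rw [h3n]; linarith
    have hodd : ¬Even (n : ℚ_[3]).valuation := by rw [hv]; decide
    have hodd' : ¬IsSquare (-n : ℚ_[3]) := by
      intro h
      have := even_valuation_of_isSquare h
      rw [(norm_eq_norm_iff (neg_ne_zero.2 hn') hn').1 (norm_neg _)] at this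
      exact hodd this
    rcases lt_or_ge ‖(3 * n : ℚ_[3])‖ ‖x‖ with hlt | hge
    -- For `‖x‖ > ‖3n‖` the factor `x + 3n` has the class of `x`, so the equation says that `x - n`
    -- is a square.
    · have hx3 : x + 3 * n ≠ 0 := by
        intro h
        rw [eq_neg_of_add_eq_zero_left h, norm_neg] at hlt
        exact lt_irrefl _ hlt
      have h4 : IsSquare ((x + 3 * n) * x) :=
        isSquare_mul_of_norm_sub_lt h2p (by rwa [add_sub_cancel_left])
      have h5 : IsSquare (x - n) :=
        isSquare_of_isSquare_mul (mul_ne_zero hx3 hx) (h2.of_eq (by ring)) h4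
      rcases lt_trichotomy ‖x‖ ‖(n : ℚ_[3])‖ with hxn | hxn | hxn
      · have h6 : IsSquare ((x - n) * (-n)) :=
          isSquare_mul_of_norm_sub_lt h2p (by rwa [sub_neg_eq_add, sub_add_cancel, norm_neg])
        have hne : x - n ≠ 0 := by
          intro h
          rw [sub_eq_zero.1 h] at hxn
          exact lt_irrefl _ hxn
        exact absurd (isSquare_of_isSquare_mul hne (by rwa [mul_comm]) h5) hodd'
      · by_cases h6 : ‖x - n‖ < ‖(n : ℚ_[3])‖
        · exact Or.inr (isSquare_mul_of_norm_sub_lt h2p h6)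
        · have h7 : ‖x - n‖ = ‖(n : ℚ_[3])‖ :=
            le_antisymm (norm_sub_le_of_le hxn.le le_rfl) (not_lt.1 h6)
          have h8 : x - n ≠ 0 := by rw [← norm_ne_zero_iff, h7]; exact hnpos.ne'
          have := even_valuation_of_isSquare h5
          rw [(norm_eq_norm_iff h8 hn').1 h7] at this
          exact absurd this hodd
      · have h6 : IsSquare ((x - n) * x) :=
          isSquare_mul_of_norm_sub_lt h2p (by rwa [sub_sub_cancel_left, norm_neg])
        have hne : x - n ≠ 0 := by
          intro h
          rw [sub_eq_zero.1 h] at hxn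
          exact lt_irrefl _ hxn
        exact Or.inl (isSquare_of_isSquare_mul hne (by rwa [mul_comm]) h5)
    -- For `‖x‖ ≤ ‖3n‖` the factor `x - n` has the class of `-n`.
    · have hxn : ‖x‖ < ‖(n : ℚ_[3])‖ := hge.trans_lt h3lt
      have h6 : IsSquare ((x - n) * (-n)) :=
        isSquare_mul_of_norm_sub_lt h2p (by rwa [sub_neg_eq_add, sub_add_cancel, norm_neg])
      have hne : x - n ≠ 0 := by
        intro h
        rw [sub_eq_zero.1 h] at hxn
        exact lt_irrefl _ hxn
      have h7 : IsSquare (x * (x + 3 * n) * (-n)) :=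
        isSquare_mul_trans hne (h2.of_eq (by ring)) h6
      have h3n0 : (3 * n : ℚ_[3]) ≠ 0 := mul_ne_zero h30 hn'
      rcases hge.lt_or_eq with hlt | heq
      · have h8 : IsSquare ((x + 3 * n) * (3 * n)) :=
          isSquare_mul_of_norm_sub_lt h2p (by rwa [add_sub_cancel_right])
        have hx3 : x + 3 * n ≠ 0 := by
          intro h
          rw [eq_neg_of_add_eq_zero_left h, norm_neg] at hlt
          exact lt_irrefl _ hlt
        have h9 : IsSquare (x * (-n) * (3 * n)) :=
          isSquare_mul_trans hx3 (h7.of_eq (by ring)) h8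
        have h10 : IsSquare (x * (-3)) :=
          (isSquare_mul_sq_iff hn').1 (h9.of_eq (by ring))
        exact Or.inr (isSquare_mul_trans (by norm_num) h10 (by rwa [mul_comm]))
      · by_cases h8 : ‖x + 3 * n‖ < ‖(3 * n : ℚ_[3])‖
        · have h9 : IsSquare (x * (-(3 * n))) :=
            isSquare_mul_of_norm_sub_lt h2p (by rwa [sub_neg_eq_add, norm_neg])
          exact Or.inl (isSquare_of_isSquare_mul (mul_ne_zero hn' (by norm_num : (-3 : ℚ_[3]) ≠ 0))
            (h9.of_eq (by ring)) hneg)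
        · have h9 : ‖x + 3 * n‖ = ‖x‖ := le_antisymm
            ((nonarchimedean _ _).trans (max_le le_rfl heq.ge)) (by rw [heq]; exact not_lt.1 h8)
          have h10 : x + 3 * n ≠ 0 := by
            rw [← norm_ne_zero_iff, h9]; exact norm_ne_zero_iff.2 hx
          exact absurd (even_valuation_of_isSquare_mul hn' hx (h7.of_eq
            (show _ = n * (x * -(x + 3 * n)) by ring))
            (by rw [norm_mul, norm_neg, h9, pow_two])) hodd
  · rintro (h | h)
    · exact Or.inl h
    · exact Or.inr (Or.inl h)

theorem norm_le_div_of_norm_lt {p : ℕ} [hp : Fact p.Prime] {a b : ℚ_[p]} (h : ‖a‖ < ‖b‖) :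
    ‖a‖ ≤ ‖b‖ / p := by
  have hb : 0 < ‖b‖ := (norm_nonneg a).trans_lt h
  have h1 : ‖a / b‖ < (p : ℝ) ^ (0 : ℤ) := by rwa [norm_div, zpow_zero, div_lt_one hb]
  rw [norm_lt_pow_iff_norm_le_pow_sub_one, norm_div, div_le_iff₀ hb] at h1
  refine h1.trans (le_of_eq ?_)
  rw [zero_sub, zpow_neg_one]
  field_simp

/-- In `(x - 2n)² + 3(2n)²` the terms have valuations of different parity, so one dominates. In the
critical case `‖x‖ = ‖n‖`, dominance of the first gives the factor norm `‖n‖²`, which contradicts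
the odd valuation of `x`. Dominance of the second puts `x` in the class of `3`; since `x` is then
also close to `2n = 6m`, the unit `2m` is a square, that is, `m ≡ 2 (mod 3)`. -/
theorem isSquare_of_isSquare_dual_three (hm : ¬(3 : ℤ) ∣ m) (hn : (n : ℤ) = 3 * m) {x : ℚ_[3]}
    (hx : x ≠ 0) (h : IsSquare (x * (x ^ 2 - 4 * n * x + 16 * n ^ 2))) :
    IsSquare x ∨ IsSquare (x * 3) ∧ m % 3 = 2 := by
  have hv := valuation_three_mul hm hn
  have hn' := natCast_ne_zero_of_valuation hv
  have h1 : (n : ℚ_[3]) = 3 * (m : ℚ_[3]) := by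
    exact_mod_cast congrArg (Int.cast (R := ℚ_[3])) hn
  have h2p : (3 : ℕ) ≠ 2 := by norm_num
  have hnpos : 0 < ‖(n : ℚ_[3])‖ := norm_pos_iff.2 hn'
  by_cases hxn : ‖x‖ = ‖(n : ℚ_[3])‖
  swap
  · exact Or.inl (isSquare_of_norm_ne_of_isSquare_dual h2p hn' hx h hxn)
  set w := x ^ 2 - 4 * n * x + 16 * n ^ 2 with hw
  have hw' : w = (x - 2 * n) ^ 2 + 3 * (2 * n) ^ 2 := by rw [hw]; ring
  have h2n : ‖(2 * n : ℚ_[3])‖ = ‖(n : ℚ_[3])‖ := by rw [norm_mul, norm_two h2p, one_mul]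
  have h12 : ‖(3 * (2 * n) ^ 2 : ℚ_[3])‖ = ‖(n : ℚ_[3])‖ ^ 2 / 3 := by
    rw [norm_mul, norm_three_three, norm_pow, h2n]; ring
  by_cases hlt : ‖x - 2 * n‖ < ‖(n : ℚ_[3])‖
  · have h3 : IsSquare (x * (2 * n)) := isSquare_mul_of_norm_sub_lt h2p (by rwa [h2n])
    have h4 : ‖x - 2 * n‖ ≤ ‖(n : ℚ_[3])‖ / 3 := by exact_mod_cast norm_le_div_of_norm_lt hlt
    have h5 : ‖(x - 2 * n) ^ 2‖ < ‖(3 * (2 * n) ^ 2 : ℚ_[3])‖ := by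
      rw [h12, norm_pow]
      calc ‖x - 2 * n‖ ^ 2 ≤ (‖(n : ℚ_[3])‖ / 3) ^ 2 := by gcongr
        _ < ‖(n : ℚ_[3])‖ ^ 2 / 3 := by
          have : 0 < ‖(n : ℚ_[3])‖ ^ 2 := by positivity
          linarith
    have h6 : IsSquare (w * (3 * (2 * n) ^ 2)) :=
      isSquare_mul_of_norm_sub_lt h2p (by rwa [hw', add_sub_cancel_right])
    have hw0 : w ≠ 0 := by
      intro h0
      rw [hw'] at h0
      rw [eq_neg_of_add_eq_zero_left h0, norm_neg] at h5
      exact lt_irrefl _ h5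
    have h20 : (2 * n : ℚ_[3]) ≠ 0 := mul_ne_zero (by norm_num) hn'
    have h7 : IsSquare (x * 3) := (isSquare_mul_sq_iff h20).1
      ((isSquare_mul_trans hw0 h h6).of_eq (by ring))
    have h8 : IsSquare ((2 * n : ℚ_[3]) * 3) :=
      isSquare_mul_trans hx (by rwa [mul_comm]) h7
    have h9 : IsSquare ((2 * m : ℤ) : ℚ_[3]) :=
      (isSquare_mul_sq_iff (by norm_num : (3 : ℚ_[3]) ≠ 0)).1
        (h8.of_eq (by rw [h1]; push_cast; ring))
    rw [isSquare_intCast_three_iff (by omega)] at h9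
    exact Or.inr ⟨h7, by omega⟩
  · exfalso
    have h3 : ‖x - 2 * n‖ = ‖(n : ℚ_[3])‖ :=
      le_antisymm (norm_sub_le_of_le hxn.le h2n.le) (not_lt.1 hlt)
    have h4 : ‖w‖ = ‖(n : ℚ_[3])‖ ^ 2 := by
      have hlt' : ‖(3 * (2 * n) ^ 2 : ℚ_[3])‖ < ‖(x - 2 * n) ^ 2‖ := by
        rw [h12, norm_pow, h3]
        have : 0 < ‖(n : ℚ_[3])‖ ^ 2 := by positivity
        linarith
      rw [hw', add_eq_max_of_ne hlt'.ne', max_eq_left hlt'.le, norm_pow, h3]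
    have := even_valuation_of_isSquare_mul hx hn' h h4
    rw [(norm_eq_norm_iff hx hn').1 hxn, hv] at this
    exact absurd this (by decide)

theorem mem_range_dual_descent_three_of_one_iff (hm : m % 3 = 1) (hn : (n : ℤ) = 3 * m)
    {c : ℚ_[3]} (hc : c ≠ 0) :
    sqClass c ∈ Set.range ((curvePiThird n).dual.descent ℚ_[3]) ↔ IsSquare c := by
  have hn0 := ne_zero_of_valuation (valuation_three_mul (m := m) (by omega) hn)
  rw [mem_range_descent_piThird_dual_iff hn0 hc]
  refine ⟨?_, Or.inl⟩
  rintro (h | ⟨x, hx, h1, h2⟩)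
  · exact h
  · rcases isSquare_of_isSquare_dual_three (by omega) hn hx h1 with h | ⟨-, h⟩
    · exact isSquare_of_isSquare_mul hx h2 h
    · omega

theorem mem_range_dual_descent_three_of_two_iff (hm : m % 3 = 2) (hn : (n : ℤ) = 3 * m)
    {c : ℚ_[3]} (hc : c ≠ 0) :
    sqClass c ∈ Set.range ((curvePiThird n).dual.descent ℚ_[3]) ↔
      IsSquare c ∨ IsSquare (c * 3) := by
  have hv := valuation_three_mul (m := m) (by omega) hn
  have hn0 := ne_zero_of_valuation hv
  have h1 : (n : ℚ_[3]) = 3 * (m : ℚ_[3]) := by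
    exact_mod_cast congrArg (Int.cast (R := ℚ_[3])) hn
  rw [mem_range_descent_piThird_dual_iff hn0 hc]
  constructor
  · rintro (h | ⟨x, hx, h1, h2⟩)
    · exact Or.inl h
    · rcases isSquare_of_isSquare_dual_three (by omega) hn hx h1 with h | ⟨h, -⟩
      · exact Or.inl (isSquare_of_isSquare_mul hx h2 h)
      · exact Or.inr (isSquare_mul_trans hx h2 h)
  · rintro (h | h)
    · exact Or.inl h
    · have h2 : IsSquare ((2 * m : ℤ) : ℚ_[3]) := by
        rw [isSquare_intCast_three_iff (by omega)]; omega
      -- At `x = 2n` the quadratic factor is `12n²`, and `24n³ = 2m (18m)²` because `n = 3m`.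
      refine Or.inr ⟨2 * n, mul_ne_zero (by norm_num) (natCast_ne_zero_of_valuation hv), ?_, ?_⟩
      · exact (h2.mul (IsSquare.sq (18 * m : ℚ_[3]))).of_eq (by rw [h1]; push_cast; ring)
      · exact (h.mul h2).of_eq (by rw [h1]; push_cast; ring)

end Three

end Padic

/-! ### Local images at 2. -/

namespace Padic

section Two

variable {n : ℕ}

/-- For `n ≡ 3, 7 (mod 8)` the torsion classes `1`, `-3`, `n`, `-3n` are all the odd residues modulo
`8`. For `n ≡ 1` they give only `1` and `5`, but `n` is then a 2-adic square and the points with `x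
= -n` and `x = 3n`, where the cubic equals `n(2n)²` and `n(6n)²`, supply `7` and `3`. -/
theorem mem_range_descent_two (hn : n % 8 = 1 ∨ n % 8 = 3 ∨ n % 8 = 7) {a : ℤ} (ha : Odd a) :
    sqClass (a : ℚ_[2]) ∈ Set.range ((curvePiThird n).descent ℚ_[2]) := by
  have hn0 : n ≠ 0 := by omega
  have hn' : (n : ℚ_[2]) ≠ 0 := by exact_mod_cast hn0
  have ha0 : (a : ℚ_[2]) ≠ 0 := by rw [Int.cast_ne_zero]; rintro rfl; simp at ha
  have hnodd : Odd (n : ℤ) := by rw [Int.odd_iff]; omega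
  have key : ∀ b : ℤ, Odd b → a * b % 8 = 1 → IsSquare ((a : ℚ_[2]) * b) := by
    intro b hb h
    rw [← Int.cast_mul, isSquare_intCast_two_iff (ha.mul hb)]
    exact h
  have h3 : Odd (-3 : ℤ) := by decide
  have ha8 : a % 8 = 1 ∨ a % 8 = 3 ∨ a % 8 = 5 ∨ a % 8 = 7 := by
    rw [Int.odd_iff] at ha; omega
  have hn8 : (n : ℤ) % 8 = 1 ∨ (n : ℤ) % 8 = 3 ∨ (n : ℤ) % 8 = 7 := by omega
  have hcases : a % 8 = 1 ∨ a * (-3) % 8 = 1 ∨ a * n % 8 = 1 ∨ a * (-3 * n) % 8 = 1 ∨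
      ((n : ℤ) % 8 = 1 ∧ a * (-n) % 8 = 1) ∨ ((n : ℤ) % 8 = 1 ∧ a * (3 * n) % 8 = 1) := by
    have h1 := Int.mul_emod a n 8
    rw [show a * (-3 * n) = -3 * (a * n) by ring, show a * (-(n : ℤ)) = -(a * n) by ring,
      show a * (3 * n) = 3 * (a * n) by ring]
    rcases ha8 with h | h | h | h <;> rcases hn8 with h' | h' | h' <;>
      rw [h, h'] at h1 <;> omega
  rcases hcases with h | h | h | h | ⟨h', h⟩ | ⟨h', h⟩
  · exact (mem_range_descent_piThird_iff hn0 ha0).2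
      (Or.inl ((isSquare_intCast_two_iff ha).2 h))
  · exact (mem_range_descent_piThird_iff hn0 ha0).2
      (Or.inr (Or.inl ((key _ h3 h).of_eq (by push_cast; ring))))
  · exact mem_range_descent_of_isSquare_mul_n hn0 ha0 ((key _ hnodd h).of_eq (by push_cast; ring))
  · exact mem_range_descent_of_isSquare_mul_neg_three_n hn0 ha0
      ((key _ (h3.mul hnodd) h).of_eq (by push_cast; ring))
  · have hsq : IsSquare ((n : ℤ) : ℚ_[2]) := (isSquare_intCast_two_iff hnodd).2 h'
    refine (mem_range_descent_piThird_iff hn0 ha0).2 (Or.inr (Or.inr ⟨-n, neg_ne_zero.2 hn',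
      ?_, (key _ hnodd.neg h).of_eq (by push_cast; ring)⟩))
    exact (hsq.mul (IsSquare.sq (2 * n : ℚ_[2]))).of_eq (by push_cast; ring)
  · refine (mem_range_descent_piThird_iff hn0 ha0).2 (Or.inr (Or.inr ⟨3 * n,
      mul_ne_zero (by norm_num) hn',
      ?_, (key (3 * n) ((by decide : Odd (3 : ℤ)).mul hnodd) h).of_eq (by push_cast; ring)⟩))
    have hsq : IsSquare ((n : ℤ) : ℚ_[2]) := (isSquare_intCast_two_iff hnodd).2 h'
    exact (hsq.mul (IsSquare.sq (6 * n : ℚ_[2]))).of_eq (by push_cast; ring)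

theorem norm_natCast_two_of_odd (hn : Odd n) : ‖(n : ℚ_[2])‖ = 1 := by
  have := norm_intCast_two_of_odd (a := n) (by exact_mod_cast hn)
  exact_mod_cast this

/-- Since `n` and `3n` are units, `(x - n)(x + 3n)` has norm `1` if `‖x‖ < 1` and `‖x‖²` if `‖x‖ >
1`; either way `x` has even valuation. -/
theorem even_valuation_of_mem_range_descent_two (hn : Odd n) {c : ℚ_[2]} (hc : c ≠ 0)
    (h : sqClass c ∈ Set.range ((curvePiThird n).descent ℚ_[2])) : Even c.valuation := by
  have hn0 : n ≠ 0 := by rintro rfl; simp at hn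
  have hn' : (n : ℚ_[2]) ≠ 0 := by exact_mod_cast hn0
  have hnn := norm_natCast_two_of_odd hn
  have h3 : ‖(3 * n : ℚ_[2])‖ = 1 := by rw [norm_mul, norm_three (by norm_num), hnn, one_mul]
  have h30 : ‖(-3 : ℚ_[2])‖ = 1 := by rw [norm_neg, norm_three (by norm_num)]
  rcases (mem_range_descent_piThird_iff hn0 hc).1 h with h | h | ⟨x, hx, h1, h2⟩
  · exact even_valuation_of_isSquare h
  · exact even_valuation_of_isSquare_mul hc one_ne_zero h (by rw [h30, norm_one, one_pow])
  have hx2 : Even x.valuation := by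
    rcases lt_trichotomy ‖x‖ 1 with hlt | heq | hgt
    · refine even_valuation_of_isSquare_mul hx one_ne_zero h1 ?_
      rw [norm_mul, sub_eq_add_neg, add_eq_max_of_ne (by rw [norm_neg, hnn]; exact hlt.ne),
        add_eq_max_of_ne (by rw [h3]; exact hlt.ne), norm_neg, hnn, h3, max_eq_right hlt.le,
        norm_one]
      norm_num
    · rw [(norm_eq_norm_iff hx one_ne_zero).1 (by rw [heq, norm_one]), valuation_one]
      exact Even.zero
    · refine even_valuation_of_isSquare_mul hx hx h1 ?_
      rw [norm_mul, sub_eq_add_neg, add_eq_max_of_ne (by rw [norm_neg, hnn]; exact hgt.ne'),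
        add_eq_max_of_ne (by rw [h3]; exact hgt.ne'), norm_neg, hnn, h3, max_eq_left hgt.le,
        pow_two]
  have := even_valuation_of_isSquare h2
  rw [valuation_mul hc hx, Int.even_add] at this
  exact this.2 hx2

theorem isSquare_or_of_mul_intCast {x : ℚ_[2]} {k : ℤ} (hk : k % 4 = 1)
    (h : IsSquare (x * k)) : IsSquare x ∨ IsSquare (x * 5) := by
  have hk0 : (k : ℚ_[2]) ≠ 0 := by rw [Int.cast_ne_zero]; rintro rfl; simp at hk
  have hodd : Odd k := by rw [Int.odd_iff]; omega
  have : k % 8 = 1 ∨ k % 8 = 5 := by omega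
  rcases this with h' | h'
  · exact Or.inl (isSquare_of_isSquare_mul hk0 h ((isSquare_intCast_two_iff hodd).2 h'))
  · have h5 : IsSquare ((k * 5 : ℤ) : ℚ_[2]) :=
      (isSquare_intCast_two_iff (hodd.mul (by decide))).2 (by omega)
    exact Or.inr (isSquare_mul_trans hk0 h (h5.of_eq (by push_cast; ring)))

theorem four_dvd_iff_norm_le (a : ℤ) : ‖(a : ℚ_[2])‖ ≤ 1 / 4 ↔ (4 : ℤ) ∣ a := by
  have h := norm_int_le_pow_iff_dvd (p := 2) a 2
  norm_num at h
  norm_num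
  exact h

theorem exists_intCast_isSquare_mul_of_norm_sub_one_le {w : ℚ_[2]} (hw : ‖w - 1‖ ≤ 1 / 4) :
    ∃ k : ℤ, k % 4 = 1 ∧ IsSquare (w * k) := by
  have hw1 := norm_eq_one_of_norm_sub_one_lt (hw.trans_lt (by norm_num))
  obtain ⟨k, hk, hwk⟩ := exists_odd_norm_sub_le hw1
  refine ⟨k, ?_, isSquare_mul_of_norm_sub_le hk hwk⟩
  have : (4 : ℤ) ∣ k - 1 := by
    rw [← four_dvd_iff_norm_le]
    push_cast
    rw [show (k : ℚ_[2]) - 1 = (w - 1) - (w - k) by ring]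
    exact norm_sub_le_of_le hw (hwk.trans (by norm_num))
  omega

theorem int_sq_emod_eight {b : ℤ} (hb : Odd b) : b ^ 2 % 8 = 1 := by
  rcases hb with ⟨k, rfl⟩
  have : (2 * k + 1) ^ 2 = 4 * (k * (k + 1)) + 1 := by ring
  obtain ⟨j, hj⟩ := Int.even_mul_succ_self k
  omega

/-- The equation is that of `E'` after dividing `x` by `4`. The quadratic factor is a unit, so `x`
has even positive valuation, hence `4 ∣ x`; then the factor is `1` modulo `4` and has the class of
`1` or `5`. -/
theorem isSquare_or_of_norm_lt_one (hn : Odd n) {x : ℚ_[2]} (hx : x ≠ 0) (hx1 : ‖x‖ < 1)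
    (h : IsSquare (x * (x ^ 2 - n * x + n ^ 2))) : IsSquare x ∨ IsSquare (x * 5) := by
  have hnn := norm_natCast_two_of_odd hn
  set w := x ^ 2 - n * x + n ^ 2 with hw
  have hxn : ‖x - n‖ ≤ 1 := norm_sub_le_of_le hx1.le hnn.le
  have hd : ‖w - n ^ 2‖ ≤ ‖x‖ := by
    rw [show w - n ^ 2 = x * (x - n) by rw [hw]; ring, norm_mul]
    exact mul_le_of_le_one_right (norm_nonneg _) hxn
  have hw1 : ‖w‖ = 1 := by
    have : ‖w‖ = ‖(n ^ 2 : ℚ_[2])‖ := norm_eq_of_norm_sub_lt_right (by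
      rw [norm_pow, hnn, one_pow]; exact hd.trans_lt hx1)
    rw [this, norm_pow, hnn, one_pow]
  have hev : Even x.valuation :=
    even_valuation_of_isSquare_mul hx one_ne_zero h (by rw [hw1, norm_one, one_pow])
  have hpos : 0 < x.valuation := by
    have := (norm_lt_norm_iff hx one_ne_zero).1 (by rwa [norm_one])
    rwa [valuation_one] at this
  -- Parity of the valuation improves `‖x‖ < 1` to `‖x‖ ≤ 1/4`.
  have hx4 : ‖x‖ ≤ 1 / 4 := by
    have h2 : ((2 : ℕ) : ℤ) ≤ x.valuation := by
      rcases hev with ⟨k, hk⟩; omega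
    rw [norm_eq_zpow_neg_valuation hx]
    calc ((2 : ℕ) : ℝ) ^ (-x.valuation) ≤ ((2 : ℕ) : ℝ) ^ (-2 : ℤ) :=
          zpow_le_zpow_right₀ (by norm_num) (by omega)
      _ = 1 / 4 := by norm_num
  have hn1 : ‖(n ^ 2 - 1 : ℚ_[2])‖ ≤ 1 / 4 := by
    have h8 := int_sq_emod_eight (b := n) (by exact_mod_cast hn)
    have := (four_dvd_iff_norm_le ((n : ℤ) ^ 2 - 1)).2 (by omega)
    exact_mod_cast this
  obtain ⟨k, hk, hwk⟩ := exists_intCast_isSquare_mul_of_norm_sub_one_le (w := w) (by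
    rw [show w - 1 = (w - n ^ 2) + (n ^ 2 - 1) by ring]
    exact (nonarchimedean _ _).trans (max_le (hd.trans hx4) hn1))
  have hw0 : w ≠ 0 := by rw [← norm_ne_zero_iff, hw1]; exact one_ne_zero
  exact isSquare_or_of_mul_intCast hk (isSquare_mul_trans hw0 h hwk)

/-- For a unit `x ≡ k (mod 8)` the equation becomes `k(k² - nk + n²) ≡ 1 (mod 8)`, whose solutions
have `k ≡ 1 (mod 4)`. The residue `n ≡ 5` is excluded because `k = 3` would then be a solution. -/
theorem isSquare_or_of_isSquare_dual_two (hn : n % 8 = 1 ∨ n % 8 = 3 ∨ n % 8 = 7) {x : ℚ_[2]}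
    (hx : x ≠ 0) (h : IsSquare (x * (x ^ 2 - n * x + n ^ 2))) :
    IsSquare x ∨ IsSquare (x * 5) := by
  have hodd : Odd n := by rw [Nat.odd_iff]; omega
  have hnn := norm_natCast_two_of_odd hodd
  have hn' : (n : ℚ_[2]) ≠ 0 := by rw [← norm_ne_zero_iff, hnn]; exact one_ne_zero
  rcases lt_trichotomy ‖x‖ 1 with hlt | heq | hgt
  · exact isSquare_or_of_norm_lt_one hodd hx hlt h
  · obtain ⟨k, hk, hxk⟩ := exists_odd_norm_sub_le heq
    have hodd' : Odd (n : ℤ) := by exact_mod_cast hodd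
    have hN : Odd (k * (k ^ 2 - n * k + n ^ 2)) := by
      refine hk.mul ?_
      have : k ^ 2 - n * k + (n : ℤ) ^ 2 = k * (k - n) + n ^ 2 := by ring
      rw [this]
      exact ((hk.sub_odd hodd').mul_left k).add_odd hodd'.pow
    have hk1 : ‖(k : ℚ_[2])‖ ≤ 1 := norm_int_le_one k
    have hsub : ‖x * (x ^ 2 - n * x + n ^ 2) -
        ((k * (k ^ 2 - n * k + (n : ℤ) ^ 2) : ℤ) : ℚ_[2])‖ ≤ 1 / 8 := by
      have : x * (x ^ 2 - n * x + n ^ 2) - ((k * (k ^ 2 - n * k + (n : ℤ) ^ 2) : ℤ) : ℚ_[2]) =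
          (x - k) * ((x * x + k * (x + k)) + (n ^ 2 - n * (x + k))) := by
        push_cast; ring
      rw [this, norm_mul]
      have hxk1 : ‖x + k‖ ≤ 1 := (nonarchimedean _ _).trans (max_le heq.le hk1)
      refine (mul_le_of_le_one_right (norm_nonneg _) ?_).trans hxk
      refine (nonarchimedean _ _).trans (max_le ((nonarchimedean _ _).trans (max_le ?_ ?_))
        (norm_sub_le_of_le ?_ ?_))
      · rw [norm_mul, heq, one_mul]
      · rw [norm_mul]; exact mul_le_one₀ hk1 (norm_nonneg _) hxk1
      · rw [norm_pow, hnn, one_pow]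
      · rw [norm_mul, hnn, one_mul]; exact hxk1
    have h2 := isSquare_mul_of_norm_sub_le hN hsub
    have hNsq : IsSquare ((k * (k ^ 2 - n * k + (n : ℤ) ^ 2) : ℤ) : ℚ_[2]) := by
      have h0 : x * (x ^ 2 - n * x + n ^ 2) ≠ 0 := by
        intro h0
        rw [h0, zero_sub, norm_neg, norm_intCast_two_of_odd hN] at hsub
        norm_num at hsub
      exact isSquare_of_isSquare_mul h0 (by rwa [mul_comm]) h
    rw [isSquare_intCast_two_iff hN] at hNsq
    refine isSquare_or_of_mul_intCast ?_ (isSquare_mul_of_norm_sub_le hk hxk)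
    have hn8 : (n : ℤ) % 8 = 1 ∨ (n : ℤ) % 8 = 3 ∨ (n : ℤ) % 8 = 7 := by omega
    have hk8 : k % 8 = 1 ∨ k % 8 = 3 ∨ k % 8 = 5 ∨ k % 8 = 7 := by
      rw [Int.odd_iff] at hk; omega
    have hred : k * (k ^ 2 - n * k + (n : ℤ) ^ 2) % 8 =
        (k % 8) * ((k % 8) ^ 2 - (n % 8) * (k % 8) + ((n : ℤ) % 8) ^ 2) % 8 := by
      simp [Int.mul_emod, Int.add_emod, Int.sub_emod, pow_two]
    rw [hred] at hNsq
    rcases hk8 with h' | h' | h' | h' <;> rcases hn8 with h'' | h'' | h'' <;>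
      rw [h', h''] at hNsq <;> norm_num at hNsq <;> omega
  -- Translation by `(0,0)` sends `x` to `n² / x`, which has the same square class and reduces `‖x‖
  -- > 1` to `‖x‖ < 1`.
  · have hx' : ((n : ℚ_[2]) ^ 2 / x) ≠ 0 := div_ne_zero (pow_ne_zero 2 hn') hx
    have h1 : ‖(n : ℚ_[2]) ^ 2 / x‖ < 1 := by
      rw [norm_div, norm_pow, hnn, one_pow, div_lt_one (by linarith)]
      exact hgt
    have h2 : IsSquare ((n ^ 2 / x) * ((n ^ 2 / x) ^ 2 - n * (n ^ 2 / x) + n ^ 2 : ℚ_[2])) := by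
      refine (h.mul (IsSquare.sq ((n : ℚ_[2]) ^ 2 / x ^ 2))).of_eq ?_
      field_simp
      ring
    have h3 : IsSquare (x * ((n : ℚ_[2]) ^ 2 / x)) :=
      (IsSquare.sq (n : ℚ_[2])).of_eq (by field_simp)
    rcases isSquare_or_of_norm_lt_one hodd hx' h1 h2 with h4 | h4
    · exact Or.inl (isSquare_of_isSquare_mul hx' h3 h4)
    · exact Or.inr (isSquare_mul_trans hx' h3 h4)

theorem mem_range_dual_descent_two_iff (hn : n % 8 = 1 ∨ n % 8 = 3 ∨ n % 8 = 7) {c : ℚ_[2]}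
    (hc : c ≠ 0) : sqClass c ∈ Set.range ((curvePiThird n).dual.descent ℚ_[2]) ↔
      IsSquare c ∨ IsSquare (c * 5) := by
  have hn0 : n ≠ 0 := by omega
  rw [mem_range_descent_piThird_dual_iff hn0 hc]
  constructor
  · rintro (h | ⟨x, hx, h1, h2⟩)
    · exact Or.inl h
    · have hx4 : x / 4 ≠ 0 := div_ne_zero hx (by norm_num)
      have h3 : IsSquare ((x / 4) * ((x / 4) ^ 2 - n * (x / 4) + n ^ 2)) :=
        (isSquare_mul_sq_iff (by norm_num : (8 : ℚ_[2]) ≠ 0)).1 (h1.of_eq (by ring))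
      have h4 : IsSquare (c * (x / 4)) :=
        (isSquare_mul_sq_iff (by norm_num : (2 : ℚ_[2]) ≠ 0)).1 (h2.of_eq (by ring))
      rcases isSquare_or_of_isSquare_dual_two hn hx4 h3 with h | h
      · exact Or.inl (isSquare_of_isSquare_mul hx4 h4 h)
      · exact Or.inr (isSquare_mul_trans hx4 h4 h)
  · rintro (h | h)
    · exact Or.inl h
    -- The witness is `80 = 5 · 4²`: the cubic takes the value `16² · 5(400 - 20n + n²)`, and the
    -- cofactor of `16²` is `1` modulo `8` for odd `n`.
    · refine Or.inr ⟨80, by norm_num, ?_,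
        ((isSquare_mul_sq_iff (by norm_num : (4 : ℚ_[2]) ≠ 0)).2 h).of_eq (by ring)⟩
      have hodd : Odd (n : ℤ) := by rw [Int.odd_iff]; omega
      have h8 := int_sq_emod_eight hodd
      have h2 : IsSquare ((5 * (400 - 20 * n + (n : ℤ) ^ 2) : ℤ) : ℚ_[2]) := by
        rw [isSquare_intCast_two_iff (by rw [Int.odd_iff]; omega)]
        omega
      exact ((isSquare_mul_sq_iff (by norm_num : (16 : ℚ_[2]) ≠ 0)).2 h2).of_eq
        (by push_cast; ring)

theorem isSquare_or_mul_five_iff {a : ℤ} (ha : Odd a) :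
    IsSquare (a : ℚ_[2]) ∨ IsSquare ((a : ℚ_[2]) * 5) ↔ a % 4 = 1 := by
  have h5 : IsSquare ((a : ℚ_[2]) * 5) ↔ a * 5 % 8 = 1 := by
    rw [← isSquare_intCast_two_iff (ha.mul (by decide))]
    push_cast
    rfl
  rw [isSquare_intCast_two_iff ha, h5]
  omega

end Two

end Padic

/-! ### Square classes of divisors of a squarefree integer -/

/-- If `c` is squarefree and `c d = r²`, then `c ∣ r` and so `c ∣ d`. By symmetry `a = ± b`, and the
minus sign would make `-b²` a square. This gives uniqueness of squarefree representatives. -/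
theorem Int.eq_of_isSquare_mul {N a b : ℤ} (hN : Squarefree N) (ha : a ∣ N) (hb : b ∣ N)
    (h : IsSquare (a * b)) : a = b := by
  have ha0 : a ≠ 0 := ne_zero_of_dvd_ne_zero hN.ne_zero ha
  have key : ∀ {c d : ℤ}, c ∣ N → IsSquare (c * d) → c ∣ d := by
    intro c d hc hcd
    have hsq := hN.squarefree_of_dvd hc
    obtain ⟨r, hr⟩ := hcd
    have h1 : c ∣ r := by
      rw [← hsq.dvd_pow_iff_dvd two_ne_zero, pow_two, ← hr]
      exact dvd_mul_right c d
    obtain ⟨s, rfl⟩ := h1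
    have hc0 : c ≠ 0 := hsq.ne_zero
    exact ⟨s * s, mul_left_cancel₀ hc0 (by rw [hr]; ring)⟩
  rcases (Int.associated_iff.1 (associated_of_dvd_dvd (key ha h)
    (key hb (by rwa [mul_comm])))) with h' | h'
  · exact h'
  · exfalso
    obtain ⟨r, hr⟩ := h
    have : b * b + r * r = 0 := by rw [← hr, h']; ring
    have hb0 : b ≠ 0 := by rintro rfl; exact ha0 (by simpa using h')
    nlinarith [mul_self_nonneg r, mul_self_pos.2 hb0]

theorem sqClass_intCast_injective {N a b : ℤ} (hN : Squarefree N) (ha : a ∣ N) (hb : b ∣ N)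
    (h : sqClass (a : ℚ) = sqClass (b : ℚ)) : a = b := by
  have ha0 : (a : ℚ) ≠ 0 := by exact_mod_cast ne_zero_of_dvd_ne_zero hN.ne_zero ha
  have hb0 : (b : ℚ) ≠ 0 := by exact_mod_cast ne_zero_of_dvd_ne_zero hN.ne_zero hb
  rw [sqClass_eq_iff ha0 hb0, ← Int.cast_mul, Rat.isSquare_intCast_iff] at h
  exact Int.eq_of_isSquare_mul hN ha hb h

/-- The representative is `a b / gcd(a, b)²`, a product of two coprime divisors of `N`. -/
theorem exists_dvd_sqClass_mul {N a b : ℤ} (hN : N ≠ 0) (ha : a ∣ N) (hb : b ∣ N) :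
    ∃ c : ℤ, c ∣ N ∧ sqClass (c : ℚ) = sqClass (a : ℚ) * sqClass (b : ℚ) := by
  have ha0 := ne_zero_of_dvd_ne_zero hN ha
  have hb0 := ne_zero_of_dvd_ne_zero hN hb
  have hg : (Int.gcd a b : ℤ) ≠ 0 := by
    exact_mod_cast fun h => ha0 (Int.gcd_eq_zero_iff.1 h).1
  obtain ⟨a', ha'⟩ := Int.gcd_dvd_left a b
  obtain ⟨b', hb'⟩ := Int.gcd_dvd_right a b
  obtain ⟨g, hgdef⟩ : ∃ g : ℤ, g = ((Int.gcd a b : ℕ) : ℤ) := ⟨_, rfl⟩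
  rw [← hgdef] at hg ha' hb'
  have hcop : IsCoprime a' b' := by
    have h1 := Int.gcd_eq_gcd_ab a b
    rw [← hgdef] at h1
    refine ⟨Int.gcdA a b, Int.gcdB a b, mul_left_cancel₀ hg ?_⟩
    linear_combination -h1 - Int.gcdA a b * ha' - Int.gcdB a b * hb'
  refine ⟨a' * b', hcop.mul_dvd (dvd_trans ⟨g, by rw [ha']; ring⟩ ha)
    (dvd_trans ⟨g, by rw [hb']; ring⟩ hb), ?_⟩
  have ha'0 : a' ≠ 0 := by rintro rfl; exact ha0 (by simpa using ha')
  have hb'0 : b' ≠ 0 := by rintro rfl; exact hb0 (by simpa using hb')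
  rw [← sqClass_mul (by exact_mod_cast ha0) (by exact_mod_cast hb0),
    sqClass_eq_iff (by exact_mod_cast mul_ne_zero ha'0 hb'0)
      (by exact_mod_cast mul_ne_zero ha0 hb0)]
  refine (IsSquare.sq ((g * a' * b' : ℤ) : ℚ)).of_eq ?_
  have : a * b = g * a' * (g * b') := by rw [← ha', ← hb']
  rw [← Int.cast_mul a b, this]
  push_cast
  ring

theorem sqClass_natCast_prod {s : Finset ℕ} (hs : ∀ p ∈ s, p ≠ 0) :
    sqClass ((∏ p ∈ s, p : ℕ) : ℚ) = ∏ p ∈ s, sqClass (p : ℚ) := by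
  classical
  induction s using Finset.induction_on with
  | empty => simp [sqClass_one]
  | insert p s hp ih =>
    rw [prod_insert hp, prod_insert hp, Nat.cast_mul, sqClass_mul, ih]
    · exact fun q hq => hs q (mem_insert_of_mem hq)
    · exact_mod_cast hs p (mem_insert_self p s)
    · exact_mod_cast prod_ne_zero_iff.2 fun q hq => hs q (mem_insert_of_mem hq)

/-! ### The group `D(E)` -/

/-- The integers `n` considered below: odd, squarefree, divisible by `3`, and not `5 mod 8`. -/
structure IsAdmissible (n : ℕ) : Prop where
  squarefree : Squarefree n
  three_dvd : 3 ∣ n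
  mod_eight : n % 8 = 1 ∨ n % 8 = 3 ∨ n % 8 = 7

namespace IsAdmissible

variable {n : ℕ}

theorem ne_zero (h : IsAdmissible n) : n ≠ 0 := h.squarefree.ne_zero

theorem odd (h : IsAdmissible n) : Odd n := by
  have := h.mod_eight
  rw [Nat.odd_iff]; omega

theorem int_squarefree (h : IsAdmissible n) : Squarefree (n : ℤ) := Int.squarefree_natCast.2 h.squarefree

theorem squarefree_two_mul (h : IsAdmissible n) : Squarefree (2 * n : ℤ) := by
  have : Squarefree (2 * n) := (Nat.squarefree_mul (by
    rw [Nat.coprime_two_left]; exact h.odd)).2 ⟨Nat.prime_two.squarefree, h.squarefree⟩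
  exact_mod_cast Int.squarefree_natCast.2 this

theorem prime_dvd_disc_iff (h : IsAdmissible n) {p : ℕ} (hp : p.Prime) :
    (p : ℤ) ∣ (curvePiThird n).disc ↔ p = 2 ∨ p ∣ n := by
  have hd : (curvePiThird n).disc = ((2 ^ 4 * 3 ^ 2 * n ^ 6 : ℕ) : ℤ) := by
    simp only [CurveData.disc, curvePiThird]; push_cast; ring
  rw [hd, Int.natCast_dvd_natCast, hp.dvd_mul, hp.dvd_mul]
  constructor
  · rintro ((h1 | h1) | h1)
    · exact Or.inl ((Nat.prime_dvd_prime_iff_eq hp Nat.prime_two).1 (hp.dvd_of_dvd_pow h1))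
    · exact Or.inr ((hp.dvd_of_dvd_pow h1).trans h.three_dvd)
    · exact Or.inr (hp.dvd_of_dvd_pow h1)
  · rintro (rfl | h1)
    · exact Or.inl (Or.inl (dvd_pow_self 2 (by norm_num)))
    · exact Or.inr (dvd_pow h1 (by norm_num))

theorem mem_genSubgroup_of_dvd (h : IsAdmissible n) {D : ℤ} (hD : D ∣ 2 * n) :
    sqClass (D : ℚ) ∈ (curvePiThird n).genSubgroup := by
  have h2n : Squarefree (2 * n : ℤ) := h.squarefree_two_mul
  have hD0 : D ≠ 0 := ne_zero_of_dvd_ne_zero h2n.ne_zero hD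
  have hsq : Squarefree D.natAbs := Int.squarefree_natAbs.2 (h2n.squarefree_of_dvd hD)
  have habs : sqClass ((D.natAbs : ℕ) : ℚ) ∈ (curvePiThird n).genSubgroup := by
    rw [← Nat.prod_primeFactors_of_squarefree hsq,
      sqClass_natCast_prod fun p hp => (Nat.prime_of_mem_primeFactors hp).ne_zero]
    refine Subgroup.prod_mem _ fun p hp => Subgroup.subset_closure (Or.inr ⟨p, ?_, ?_, rfl⟩)
    · exact Nat.prime_of_mem_primeFactors hp
    · have hpp := Nat.prime_of_mem_primeFactors hp
      rw [h.prime_dvd_disc_iff hpp, ← Nat.prime_dvd_prime_iff_eq hpp Nat.prime_two,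
        ← hpp.dvd_mul, ← Int.natCast_dvd_natCast]
      push_cast
      exact (Int.natCast_dvd.2 (Nat.dvd_of_mem_primeFactors hp)).trans hD
  rcases Int.natAbs_eq D with h' | h'
  · rw [h']; exact habs
  · have : (D : ℚ) = (-1) * (D.natAbs : ℕ) := by
      conv_lhs => rw [h']
      rw [Int.cast_neg, Int.cast_natCast, neg_one_mul]
    rw [this, sqClass_mul (by norm_num) (by exact_mod_cast Int.natAbs_ne_zero.2 hD0)]
    exact Subgroup.mul_mem _ (Subgroup.subset_closure (Or.inl rfl)) habs

/-- Together with `mem_genSubgroup_of_dvd` this identifies `D(E)` with the set of divisors of `2n`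
of either sign. -/
theorem exists_dvd_of_mem_genSubgroup (h : IsAdmissible n) {c : SqClass ℚ} (hc : c ∈ (curvePiThird n).genSubgroup) :
    ∃ D : ℤ, D ∣ 2 * n ∧ sqClass (D : ℚ) = c := by
  have h2n : (2 * n : ℤ) ≠ 0 := h.squarefree_two_mul.ne_zero
  induction hc using Subgroup.closure_induction with
  | mem c hc =>
    rcases hc with rfl | ⟨p, hp, hpd, rfl⟩
    · exact ⟨-1, by simp, by norm_num⟩
    · refine ⟨p, ?_, by norm_num⟩
      rcases (h.prime_dvd_disc_iff hp).1 hpd with rfl | h1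
      · exact dvd_mul_right _ _
      · exact (Int.natCast_dvd_natCast.2 h1).mul_left 2
  | one => exact ⟨1, one_dvd _, by rw [Int.cast_one, sqClass_one]⟩
  | mul a b _ _ iha ihb =>
    obtain ⟨A, hA, rfl⟩ := iha
    obtain ⟨B, hB, rfl⟩ := ihb
    exact exists_dvd_sqClass_mul h2n hA hB
  | inv a _ iha => rwa [SqClass.inv_eq_self]

end IsAdmissible

theorem sqClass_intCast_mem_localConditions_iff {E F : CurveData} {D : ℤ} (hD : D ≠ 0) :
    sqClass (D : ℚ) ∈ E.localConditions F ↔ sqClass (D : ℚ) ∈ E.genSubgroup ∧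
      sqClass (D : ℝ) ∈ Set.range (F.descent ℝ) ∧ ∀ (p : ℕ) [Fact p.Prime], (p : ℤ) ∣ E.disc →
        sqClass (D : ℚ_[p]) ∈ Set.range (F.descent ℚ_[p]) := by
  have hD' : (D : ℚ) ≠ 0 := by exact_mod_cast hD
  have key : ∀ (K : Type) [Field K] [CharZero K],
      sqClassMap K (sqClass (D : ℚ)) = sqClass (D : K) := by
    intro K _ _
    rw [sqClassMap_sqClass K _ hD', Rat.cast_intCast]
  simp only [CurveData.localConditions, Set.mem_ofPred_eq, key]

/-! ### The Selmer conditions in terms of integers -/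

/-- For `p ∣ m` and `D ∣ m` with `m` squarefree, this says that `D` or `m D` is a square
in `ℚ_p`. -/
def IsGoodAt (m D : ℤ) (p : ℕ) : Prop :=
  jacobiSym (if (p : ℤ) ∣ D then m / D else D) p = 1

theorem not_dvd_ediv_of_squarefree {p m D : ℤ} (hp : Prime p) (hm : Squarefree m) (hD : D ∣ m)
    (hpD : p ∣ D) : ¬p ∣ m / D := by
  obtain ⟨e, rfl⟩ := hD
  have hD0 : D ≠ 0 := left_ne_zero_of_mul hm.ne_zero
  rw [Int.mul_ediv_cancel_left _ hD0]
  intro h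
  exact hp.not_isUnit (hm p (mul_dvd_mul hpD h))

namespace Padic

variable {p : ℕ} [hp : Fact p.Prime]

theorem not_isSquare_of_dvd {D : ℤ} (hD : Squarefree D) (hpD : (p : ℤ) ∣ D) :
    ¬IsSquare (D : ℚ_[p]) := by
  intro h
  have := even_valuation_of_isSquare h
  rw [valuation_intCast_of_dvd_of_squarefree hpD hD] at this
  exact absurd this (by decide)

/-- Since `m` has valuation `1`, exactly one of `D` and `m D` has even valuation. That one is `D` if
`p ∤ D`, and otherwise `(m / D) D²`, so the symbol of a unit decides. -/
theorem isSquare_or_iff_isGoodAt (hp2 : p ≠ 2) {m D : ℤ} (hm : Squarefree m) (hpm : (p : ℤ) ∣ m)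
    (hD : D ∣ m) : IsSquare (D : ℚ_[p]) ∨ IsSquare ((D : ℚ_[p]) * m) ↔ IsGoodAt m D p := by
  have hp' := Nat.prime_iff_prime_int.1 hp.out
  have hD0 : (D : ℚ_[p]) ≠ 0 := by exact_mod_cast ne_zero_of_dvd_ne_zero hm.ne_zero hD
  have hm0 : (m : ℚ_[p]) ≠ 0 := by exact_mod_cast hm.ne_zero
  unfold IsGoodAt
  split_ifs with h
  · have hndvd := not_dvd_ediv_of_squarefree hp' hm hD h
    have h1 : ¬IsSquare (D : ℚ_[p]) := not_isSquare_of_dvd (hm.squarefree_of_dvd hD) h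
    have h2 : (D : ℚ_[p]) * m = ((m / D : ℤ) : ℚ_[p]) * (D : ℚ_[p]) ^ 2 := by
      have : m = D * (m / D) := (Int.mul_ediv_cancel' hD).symm
      conv_lhs => rw [this]
      push_cast
      ring
    rw [h2, isSquare_mul_sq_iff hD0, isSquare_intCast_iff hp2 hndvd]
    exact or_iff_right h1
  · have h1 : ¬IsSquare ((D : ℚ_[p]) * m) := by
      intro h1
      have := even_valuation_of_isSquare h1
      rw [valuation_mul hD0 hm0, valuation_intCast_eq_zero h,
        valuation_intCast_of_dvd_of_squarefree hpm hm] at this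
      exact absurd this (by decide)
    rw [isSquare_intCast_iff hp2 h]
    exact or_iff_left h1

theorem jacobiSym_neg_three (hp2 : p ≠ 2) (hp3 : p ≠ 3) :
    jacobiSym (-3) p = if p % 3 = 1 then 1 else -1 := by
  have hodd := hp.out.odd_of_ne_two hp2
  have h3 : p % 3 ≠ 0 := fun h =>
    hp3 ((Nat.prime_dvd_prime_iff_eq Nat.prime_three hp.out).1 (Nat.dvd_of_mod_eq_zero h)).symm
  -- By reciprocity the symbol depends only on `p` modulo `4 · 3 = 12`.
  rw [jacobiSym.mod_right _ hodd]
  have h12 : p % 12 = 1 ∨ p % 12 = 5 ∨ p % 12 = 7 ∨ p % 12 = 11 := by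
    rw [Nat.odd_iff] at hodd; omega
  simp only [Int.reduceNeg, Int.natAbs_neg, Int.reduceAbs, Nat.reduceMul]
  rcases h12 with h | h | h | h <;> rw [h]
  · rw [if_pos (by omega)]; norm_num
  · rw [if_neg (by omega)]; norm_num
  · rw [if_pos (by omega)]; norm_num
  · rw [if_neg (by omega)]; norm_num

theorem isSquare_neg_three_iff (hp2 : p ≠ 2) (hp3 : p ≠ 3) :
    IsSquare (-3 : ℚ_[p]) ↔ p % 3 = 1 := by
  have h : ¬(p : ℤ) ∣ -3 := by
    rw [dvd_neg]
    intro h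
    exact hp3 ((Nat.prime_dvd_prime_iff_eq hp.out Nat.prime_three).1 (by exact_mod_cast h))
  have := isSquare_intCast_iff hp2 h
  rw [jacobiSym_neg_three hp2 hp3] at this
  push_cast at this
  rw [this]
  split_ifs with h <;> simp [h]

end Padic

namespace IsAdmissible

variable {n : ℕ}

theorem natCast_eq (h : IsAdmissible n) : (n : ℤ) = 3 * ((n / 3 : ℕ) : ℤ) := by
  have := Nat.mul_div_cancel' h.three_dvd
  exact_mod_cast this.symm

theorem div_three_emod (h : IsAdmissible n) : n / 3 % 3 = 1 ∨ n / 3 % 3 = 2 := by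
  have : n / 3 % 3 ≠ 0 := by
    intro h0
    obtain ⟨k, hk⟩ := Nat.dvd_of_mod_eq_zero h0
    have h1 := Nat.mul_div_cancel' h.three_dvd
    have := h.squarefree 3 ⟨k, by rw [← h1, hk]; ring⟩
    simp at this
  omega

theorem ne_two_of_dvd (h : IsAdmissible n) {p : ℕ} (hp : p ∣ n) : p ≠ 2 := by
  rintro rfl
  exact (Nat.not_even_iff_odd.2 h.odd) (even_iff_two_dvd.2 hp)

theorem valuation_eq_one (h : IsAdmissible n) {p : ℕ} [Fact p.Prime] (hp : p ∣ n) :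
    (n : ℚ_[p]).valuation = 1 := by
  have := Padic.valuation_intCast_of_dvd_of_squarefree (p := p) (a := n)
    (Int.natCast_dvd_natCast.2 hp) h.int_squarefree
  rwa [Int.cast_natCast] at this

theorem prime_eq_three_or (p : ℕ) [hp : Fact p.Prime] : p = 3 ∨ p % 3 = 1 ∨ p % 3 = 2 := by
  have : p % 3 = 0 → p = 3 := fun h =>
    ((Nat.prime_dvd_prime_iff_eq Nat.prime_three hp.out).1 (Nat.dvd_of_mod_eq_zero h)).symm
  omega

/-- Integers satisfying the local conditions lie in `S'(E)`. -/
theorem mem_selmer'_of (h : IsAdmissible n) {D : ℤ} (hodd : Odd D)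
    (hgen : sqClass (D : ℚ) ∈ (curvePiThird n).genSubgroup)
    (hp : ∀ (p : ℕ) [Fact p.Prime], p ∣ n → p % 3 = 1 →
      IsSquare (D : ℚ_[p]) ∨ IsSquare ((D : ℚ_[p]) * n))
    (h3 : n / 3 % 3 = 2 → IsSquare (D : ℚ_[3]) ∨ IsSquare ((D : ℚ_[3]) * (-3))) :
    sqClass (D : ℚ) ∈ (curvePiThird n).selmer' := by
  have hD0 : D ≠ 0 := by rintro rfl; simp at hodd
  refine (sqClass_intCast_mem_localConditions_iff hD0).2
    ⟨hgen, mem_range_descent_real h.ne_zero (by exact_mod_cast hD0), ?_⟩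
  intro p hpf hpd
  have hDp : (D : ℚ_[p]) ≠ 0 := by exact_mod_cast hD0
  rcases (h.prime_dvd_disc_iff hpf.out).1 hpd with rfl | hpn
  · exact Padic.mem_range_descent_two h.mod_eight hodd
  have hp2 := h.ne_two_of_dvd hpn
  have hv := h.valuation_eq_one hpn
  by_cases hp3 : p = 3
  · subst hp3
    rcases h.div_three_emod with h' | h'
    · exact Padic.mem_range_descent_three (by exact_mod_cast h') h.natCast_eq hDp
    · exact (Padic.mem_range_descent_three_iff (by exact_mod_cast h') h.natCast_eq hDp).2 (h3 h')
  by_cases hsq : IsSquare (-3 : ℚ_[p])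
  · exact (Padic.mem_range_descent_split_iff hp2 hp3 hv hsq hDp).2
      (hp p hpn ((Padic.isSquare_neg_three_iff hp2 hp3).1 hsq))
  · exact Padic.mem_range_descent_of_not_isSquare hp2 hp3 hv hsq hDp

theorem odd_of_even_valuation (h : IsAdmissible n) {D : ℤ} (hD : D ∣ 2 * n)
    (hv : Even (D : ℚ_[2]).valuation) : Odd D := by
  rw [← Int.not_even_iff_odd, even_iff_two_dvd]
  intro h2
  rw [Padic.valuation_intCast_of_dvd_of_squarefree (p := 2) (by exact_mod_cast h2)
    (h.squarefree_two_mul.squarefree_of_dvd hD)] at hv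
  exact absurd hv (by decide)

/-- Elements of `S'(E)` satisfy the local conditions. -/
theorem of_mem_selmer' (h : IsAdmissible n) {D : ℤ} (hD : D ∣ 2 * n)
    (hmem : sqClass (D : ℚ) ∈ (curvePiThird n).selmer') :
    Odd D ∧ (∀ (p : ℕ) [Fact p.Prime], p ∣ n → p % 3 = 1 →
      IsSquare (D : ℚ_[p]) ∨ IsSquare ((D : ℚ_[p]) * n)) ∧
    (n / 3 % 3 = 2 → IsSquare (D : ℚ_[3]) ∨ IsSquare ((D : ℚ_[3]) * (-3))) := by
  have hD0 : D ≠ 0 := ne_zero_of_dvd_ne_zero h.squarefree_two_mul.ne_zero hD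
  obtain ⟨-, -, hloc⟩ := (sqClass_intCast_mem_localConditions_iff hD0).1 hmem
  refine ⟨h.odd_of_even_valuation hD ?_, ?_, ?_⟩
  · exact Padic.even_valuation_of_mem_range_descent_two h.odd (by exact_mod_cast hD0)
      (hloc 2 ((h.prime_dvd_disc_iff Nat.prime_two).2 (Or.inl rfl)))
  · intro p hpf hpn hp1
    have hp2 := h.ne_two_of_dvd hpn
    have hp3 : p ≠ 3 := by rintro rfl; simp at hp1
    exact (Padic.mem_range_descent_split_iff hp2 hp3 (h.valuation_eq_one hpn)
      ((Padic.isSquare_neg_three_iff hp2 hp3).2 hp1) (by exact_mod_cast hD0)).1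
      (hloc p ((h.prime_dvd_disc_iff hpf.out).2 (Or.inr hpn)))
  · intro h'
    exact (Padic.mem_range_descent_three_iff (by exact_mod_cast h') h.natCast_eq
      (by exact_mod_cast hD0)).1
      (hloc 3 ((h.prime_dvd_disc_iff Nat.prime_three).2 (Or.inr h.three_dvd)))

theorem isSquare_or_mul {K : Type*} [Field K] {a b t : K} (ht : t ≠ 0)
    (ha : IsSquare a ∨ IsSquare (a * t)) (hb : IsSquare b ∨ IsSquare (b * t)) :
    IsSquare (a * b) ∨ IsSquare (a * b * t) := by
  rcases ha with ha | ha <;> rcases hb with hb | hb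
  · exact Or.inl (ha.mul hb)
  · exact Or.inr ((ha.mul hb).of_eq (by ring))
  · exact Or.inr ((ha.mul hb).of_eq (by ring))
  · exact Or.inl ((isSquare_mul_sq_iff ht).1 ((ha.mul hb).of_eq (by ring)))

/-- The product of two divisors of `2n` need not divide `2n`; this is why `mem_selmer'_of` accepts
any odd integer whose class lies in `D(E)`. -/
theorem mul_mem_selmer' (h : IsAdmissible n) {c d : SqClass ℚ}
    (hc : c ∈ (curvePiThird n).selmer') (hd : d ∈ (curvePiThird n).selmer') :
    c * d ∈ (curvePiThird n).selmer' := by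
  obtain ⟨C, hC, rfl⟩ := h.exists_dvd_of_mem_genSubgroup hc.1
  obtain ⟨D, hD, rfl⟩ := h.exists_dvd_of_mem_genSubgroup hd.1
  obtain ⟨hC1, hC2, hC3⟩ := h.of_mem_selmer' hC hc
  obtain ⟨hD1, hD2, hD3⟩ := h.of_mem_selmer' hD hd
  have hC0 : (C : ℚ) ≠ 0 := by
    exact_mod_cast ne_zero_of_dvd_ne_zero h.squarefree_two_mul.ne_zero hC
  have hD0 : (D : ℚ) ≠ 0 := by
    exact_mod_cast ne_zero_of_dvd_ne_zero h.squarefree_two_mul.ne_zero hD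
  have hgen := Subgroup.mul_mem _ hc.1 hd.1
  rw [← sqClass_mul hC0 hD0, ← Int.cast_mul] at hgen ⊢
  refine h.mem_selmer'_of (hC1.mul hD1) hgen ?_ ?_
  · intro p hpf hpn hp1
    rw [Int.cast_mul]
    exact isSquare_or_mul (by exact_mod_cast h.ne_zero) (hC2 p hpn hp1) (hD2 p hpn hp1)
  · intro h'
    rw [Int.cast_mul]
    exact isSquare_or_mul (by norm_num) (hC3 h') (hD3 h')

theorem isSquare_or_mul_neg_three_iff {D : ℤ} (hD : Squarefree D) :
    IsSquare (D : ℚ_[3]) ∨ IsSquare ((D : ℚ_[3]) * (-3)) ↔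
      D % 3 = 1 ∨ (3 : ℤ) ∣ D ∧ D / 3 % 3 = 2 := by
  have hD0 : (D : ℚ_[3]) ≠ 0 := by exact_mod_cast hD.ne_zero
  by_cases h3 : (3 : ℤ) ∣ D
  · have h1 : ¬IsSquare (D : ℚ_[3]) := Padic.not_isSquare_of_dvd hD (by exact_mod_cast h3)
    obtain ⟨e, rfl⟩ := h3
    have he : ¬(3 : ℤ) ∣ e := fun he =>
      Int.prime_three.not_isUnit (hD 3 (mul_dvd_mul_left 3 he))
    have h2 : ((3 * e : ℤ) : ℚ_[3]) * (-3) = ((-e : ℤ) : ℚ_[3]) * 3 ^ 2 := by push_cast; ring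
    rw [h2, isSquare_mul_sq_iff (by norm_num), or_iff_right h1,
      Padic.isSquare_intCast_three_iff (a := -e) (by omega)]
    omega
  · have h1 : ¬IsSquare ((D : ℚ_[3]) * (-3)) := by
      intro h
      have := Padic.even_valuation_of_isSquare (h.of_eq
        (show _ = ((-D : ℤ) : ℚ_[3]) * ((3 : ℕ) : ℚ_[3]) by push_cast; ring))
      rw [Padic.valuation_mul (by push_cast; exact neg_ne_zero.2 hD0) (by norm_num),
        Padic.valuation_p, Padic.valuation_intCast_eq_zero (by push_cast; omega)] at this
      exact absurd this (by decide)
    rw [or_iff_left h1, Padic.isSquare_intCast_three_iff h3]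
    tauto

theorem isSquare_or_mul_three_iff {D : ℤ} (hD : Squarefree D) :
    IsSquare (D : ℚ_[3]) ∨ IsSquare ((D : ℚ_[3]) * 3) ↔
      D % 3 = 1 ∨ (3 : ℤ) ∣ D ∧ D / 3 % 3 = 1 := by
  have hD0 : (D : ℚ_[3]) ≠ 0 := by exact_mod_cast hD.ne_zero
  by_cases h3 : (3 : ℤ) ∣ D
  · have h1 : ¬IsSquare (D : ℚ_[3]) := Padic.not_isSquare_of_dvd hD (by exact_mod_cast h3)
    obtain ⟨e, rfl⟩ := h3
    have he : ¬(3 : ℤ) ∣ e := fun he =>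
      Int.prime_three.not_isUnit (hD 3 (mul_dvd_mul_left 3 he))
    have h2 : ((3 * e : ℤ) : ℚ_[3]) * 3 = (e : ℚ_[3]) * 3 ^ 2 := by push_cast; ring
    rw [h2, isSquare_mul_sq_iff (by norm_num), or_iff_right h1,
      Padic.isSquare_intCast_three_iff (a := e) he]
    omega
  · have h1 : ¬IsSquare ((D : ℚ_[3]) * 3) := by
      intro h
      have := Padic.even_valuation_of_isSquare (h.of_eq
        (show _ = (D : ℚ_[3]) * ((3 : ℕ) : ℚ_[3]) by push_cast; ring))
      rw [Padic.valuation_mul hD0 (by norm_num), Padic.valuation_p,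
        Padic.valuation_intCast_eq_zero (by exact_mod_cast h3)] at this
      exact absurd this (by decide)
    rw [or_iff_left h1, Padic.isSquare_intCast_three_iff h3]
    tauto

theorem dvd_of_odd {D : ℤ} (hD : D ∣ 2 * n) (hodd : Odd D) : D ∣ n := by
  refine IsCoprime.dvd_of_dvd_mul_left ?_ hD
  obtain ⟨k, hk⟩ := hodd
  exact ⟨1, -k, by rw [hk]; ring⟩

/-- The group `S'(E)` in terms of divisors of `n`. -/
theorem mem_selmer'_iff (h : IsAdmissible n) {D : ℤ} (hD : D ∣ n) :
    sqClass (D : ℚ) ∈ (curvePiThird n).selmer' ↔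
      (∀ p : ℕ, p.Prime → p ∣ n → p % 3 = 1 → IsGoodAt n D p) ∧
      (n / 3 % 3 = 2 → D % 3 = 1 ∨ (3 : ℤ) ∣ D ∧ D / 3 % 3 = 2) := by
  have hsq := h.int_squarefree
  have hodd : Odd D := by
    have : Odd (n : ℤ) := by exact_mod_cast h.odd
    obtain ⟨e, he⟩ := hD
    exact (Int.odd_mul.1 (he ▸ this)).1
  rw [← isSquare_or_mul_neg_three_iff (hsq.squarefree_of_dvd hD)]
  constructor
  · intro hmem
    obtain ⟨-, h2, h3⟩ := h.of_mem_selmer' (hD.mul_left 2) hmem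
    refine ⟨fun p hp hpn hp1 => ?_, h3⟩
    have : Fact p.Prime := ⟨hp⟩
    rw [← Padic.isSquare_or_iff_isGoodAt (h.ne_two_of_dvd hpn) hsq
      (Int.natCast_dvd_natCast.2 hpn) hD]
    exact_mod_cast h2 p hpn hp1
  · rintro ⟨h2, h3⟩
    refine h.mem_selmer'_of hodd (h.mem_genSubgroup_of_dvd (hD.mul_left 2)) ?_ h3
    intro p hpf hpn hp1
    have := (Padic.isSquare_or_iff_isGoodAt (h.ne_two_of_dvd hpn) hsq
      (Int.natCast_dvd_natCast.2 hpn) hD).2 (h2 p hpf.out hpn hp1)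
    exact_mod_cast this

theorem exists_dvd_of_mem_selmer' (h : IsAdmissible n) {c : SqClass ℚ}
    (hc : c ∈ (curvePiThird n).selmer') : ∃ D : ℤ, D ∣ n ∧ sqClass (D : ℚ) = c := by
  obtain ⟨D, hD, rfl⟩ := h.exists_dvd_of_mem_genSubgroup hc.1
  exact ⟨D, dvd_of_odd hD (h.of_mem_selmer' hD hc).1, rfl⟩

/-- The group `S(E)` in terms of divisors of `n`. -/
theorem mem_selmer_iff (h : IsAdmissible n) {D : ℤ} (hD : D ∣ 2 * n) :
    sqClass (D : ℚ) ∈ (curvePiThird n).selmer ↔ 0 < D ∧ D % 4 = 1 ∧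
      (∀ q : ℕ, q.Prime → q ∣ n → q % 3 = 2 → ¬(q : ℤ) ∣ D ∧ jacobiSym D q = 1) ∧
      (∀ p : ℕ, p.Prime → p ∣ n → p % 3 = 1 → IsGoodAt (-n) D p) ∧
      (n / 3 % 3 = 1 → D % 3 = 1) ∧
      (n / 3 % 3 = 2 → D % 3 = 1 ∨ (3 : ℤ) ∣ D ∧ D / 3 % 3 = 1) := by
  have hsq2 := h.squarefree_two_mul
  have hD0 : D ≠ 0 := ne_zero_of_dvd_ne_zero hsq2.ne_zero hD
  have hDsq := hsq2.squarefree_of_dvd hD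
  have hnsq : Squarefree (-n : ℤ) := by
    rw [← Int.squarefree_natAbs, Int.natAbs_neg, Int.squarefree_natAbs]
    exact h.int_squarefree
  have hD0' : ∀ (p : ℕ) [Fact p.Prime], (D : ℚ_[p]) ≠ 0 := fun p _ => by exact_mod_cast hD0
  have real_iff : sqClass (D : ℝ) ∈ Set.range ((curvePiThird n).dual.descent ℝ) ↔ 0 < D := by
    rw [mem_range_dual_descent_real_iff h.ne_zero (by exact_mod_cast hD0)]
    exact Int.cast_pos
  have two_iff : sqClass (D : ℚ_[2]) ∈ Set.range ((curvePiThird n).dual.descent ℚ_[2]) ↔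
      D % 4 = 1 := by
    rw [Padic.mem_range_dual_descent_two_iff h.mod_eight (hD0' 2)]
    have h5 : (5 : ℚ_[2]).valuation = 0 := by
      exact_mod_cast Padic.valuation_intCast_eq_zero (p := 2) (a := 5) (by norm_num)
    constructor
    · intro h2
      have hev : Even (D : ℚ_[2]).valuation := by
        rcases h2 with h2 | h2
        · exact Padic.even_valuation_of_isSquare h2
        · have := Padic.even_valuation_of_isSquare h2
          rwa [Padic.valuation_mul (hD0' 2) (by norm_num), h5, add_zero] at this
      exact (Padic.isSquare_or_mul_five_iff (h.odd_of_even_valuation hD hev)).1 h2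
    · intro h4
      exact (Padic.isSquare_or_mul_five_iff (by rw [Int.odd_iff]; omega)).2 h4
  have inert_iff : ∀ (q : ℕ) [Fact q.Prime], q ∣ n → q % 3 = 2 →
      (sqClass (D : ℚ_[q]) ∈ Set.range ((curvePiThird n).dual.descent ℚ_[q]) ↔
        ¬(q : ℤ) ∣ D ∧ jacobiSym D q = 1) := by
    intro q hqf hqn hq
    have hq2 := h.ne_two_of_dvd hqn
    have hq3 : q ≠ 3 := by rintro rfl; simp at hq
    rw [Padic.mem_range_dual_descent_of_not_isSquare_iff hq2 hq3 (h.valuation_eq_one hqn)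
      (by rw [Padic.isSquare_neg_three_iff hq2 hq3]; omega) (hD0' q)]
    by_cases hqD : (q : ℤ) ∣ D
    · simp [Padic.not_isSquare_of_dvd hDsq hqD, hqD]
    · rw [Padic.isSquare_intCast_iff hq2 hqD]
      simp [hqD]
  have split_iff : D ∣ n → ∀ (p : ℕ) [Fact p.Prime], p ∣ n → p % 3 = 1 →
      (sqClass (D : ℚ_[p]) ∈ Set.range ((curvePiThird n).dual.descent ℚ_[p]) ↔
        IsGoodAt (-n) D p) := by
    intro hDn p hpf hpn hp
    have hp2 := h.ne_two_of_dvd hpn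
    have hp3 : p ≠ 3 := by rintro rfl; simp at hp
    rw [Padic.mem_range_dual_descent_split_iff hp2 (h.valuation_eq_one hpn)
      ((Padic.isSquare_neg_three_iff hp2 hp3).2 hp) (hD0' p),
      ← Padic.isSquare_or_iff_isGoodAt hp2 hnsq
        ((dvd_neg).2 (Int.natCast_dvd_natCast.2 hpn)) ((dvd_neg).2 hDn)]
    push_cast
    rfl
  have three_one_iff : n / 3 % 3 = 1 →
      (sqClass (D : ℚ_[3]) ∈ Set.range ((curvePiThird n).dual.descent ℚ_[3]) ↔ D % 3 = 1) := by
    intro h1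
    rw [Padic.mem_range_dual_descent_three_of_one_iff (by exact_mod_cast h1) h.natCast_eq
      (hD0' 3)]
    by_cases h3D : (3 : ℤ) ∣ D
    · have := Padic.not_isSquare_of_dvd (p := 3) hDsq (by exact_mod_cast h3D)
      simp only [this, false_iff]
      omega
    · exact Padic.isSquare_intCast_three_iff h3D
  have three_two_iff : n / 3 % 3 = 2 →
      (sqClass (D : ℚ_[3]) ∈ Set.range ((curvePiThird n).dual.descent ℚ_[3]) ↔
        D % 3 = 1 ∨ (3 : ℤ) ∣ D ∧ D / 3 % 3 = 1) := by
    intro h2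
    rw [Padic.mem_range_dual_descent_three_of_two_iff (by exact_mod_cast h2) h.natCast_eq
      (hD0' 3), isSquare_or_mul_three_iff hDsq]
  have disc_of_dvd : ∀ {p : ℕ} (_ : p.Prime), p ∣ n → (p : ℤ) ∣ (curvePiThird n).disc :=
    fun hp hpn => (h.prime_dvd_disc_iff hp).2 (Or.inr hpn)
  refine (sqClass_intCast_mem_localConditions_iff hD0).trans ?_
  rw [real_iff]
  constructor
  · rintro ⟨-, hpos, hloc⟩
    have h4 := two_iff.1 (hloc 2 ((h.prime_dvd_disc_iff Nat.prime_two).2 (Or.inl rfl)))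
    -- The condition at `2` makes `D` odd, so `D ∣ n`, which the description at `p ≡ 1 (mod 3)` by
    -- `IsGoodAt` requires.
    have hDn := dvd_of_odd hD (by rw [Int.odd_iff]; omega)
    have hthree := hloc 3 (disc_of_dvd Nat.prime_three h.three_dvd)
    refine ⟨hpos, h4, fun q hq hqn hq2 => ?_, fun p hp hpn hp1 => ?_,
      fun h1 => (three_one_iff h1).1 hthree, fun h2 => (three_two_iff h2).1 hthree⟩
    · have : Fact q.Prime := ⟨hq⟩
      exact (inert_iff q hqn hq2).1 (hloc q (disc_of_dvd hq hqn))
    · have : Fact p.Prime := ⟨hp⟩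
      exact (split_iff hDn p hpn hp1).1 (hloc p (disc_of_dvd hp hpn))
  · rintro ⟨hpos, h4, hq, hp, h1, h2⟩
    have hDn := dvd_of_odd hD (by rw [Int.odd_iff]; omega)
    refine ⟨h.mem_genSubgroup_of_dvd hD, hpos, fun p hpf hpd => ?_⟩
    rcases (h.prime_dvd_disc_iff hpf.out).1 hpd with rfl | hpn
    · exact two_iff.2 h4
    rcases prime_eq_three_or p with rfl | hp1 | hp2
    · rcases h.div_three_emod with h' | h'
      · exact (three_one_iff h').2 (h1 h')
      · exact (three_two_iff h').2 (h2 h')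
    · exact (split_iff hDn p hpn hp1).2 (hp p hpf.out hpn hp1)
    · exact (inert_iff p hpn hp2).2 (hq p hpf.out hpn hp2)

end IsAdmissible

/-! ### Partitions of G(m) and divisors of m. -/

section Graph

variable {m : ℤ}

theorem mem_graphVertices_iff (hm : m ≠ 0) {v : ℤ} :
    v ∈ graphVertices m ↔ (∃ p : ℕ, p.Prime ∧ (p : ℤ) ∣ m ∧ v = p) ∨ (m < 0 ∧ v = -1) := by
  unfold graphVertices
  rw [mem_union, mem_image]
  have h1 : v ∈ (if m < 0 then ({-1} : Finset ℤ) else ∅) ↔ m < 0 ∧ v = -1 := by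
    split_ifs with h <;> simp [h]
  rw [h1]
  refine or_congr_left ⟨?_, ?_⟩
  · rintro ⟨p, hp, rfl⟩
    exact ⟨p, Nat.prime_of_mem_primeFactors hp,
      Int.natCast_dvd.2 (Nat.dvd_of_mem_primeFactors hp), rfl⟩
  · rintro ⟨p, hp, hpm, rfl⟩
    exact ⟨p, Nat.mem_primeFactors.2 ⟨hp, Int.natCast_dvd.1 hpm, Int.natAbs_ne_zero.2 hm⟩, rfl⟩

theorem prod_image_primeFactors {D : ℤ} (hD : Squarefree D) :
    ∏ v ∈ D.natAbs.primeFactors.image (fun p : ℕ => (p : ℤ)), v = D.natAbs := by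
  rw [prod_image fun a _ b _ hab => by exact_mod_cast hab, ← Nat.cast_prod,
    Nat.prod_primeFactors_of_squarefree (Int.squarefree_natAbs.2 hD)]

theorem prod_graphVertices (hm : Squarefree m) : ∏ v ∈ graphVertices m, v = m := by
  have hdisj : Disjoint (m.natAbs.primeFactors.image (fun p : ℕ => (p : ℤ)))
      (if m < 0 then ({-1} : Finset ℤ) else ∅) := by
    split_ifs
    · rw [disjoint_singleton_right, mem_image]
      rintro ⟨p, -, hp⟩
      omega
    · exact disjoint_empty_right _
  rw [graphVertices, prod_union hdisj, prod_image_primeFactors hm]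
  split_ifs with h
  · rw [prod_singleton]; omega
  · rw [prod_empty]; omega

theorem vertexProd_mul_compl (hm : Squarefree m) (V₁ : Finset (graphVertices m)) :
    vertexProd V₁ * vertexProd V₁ᶜ = m := by
  unfold vertexProd
  rw [prod_mul_prod_compl V₁ (fun v => (v : ℤ)), prod_coe_sort (graphVertices m) (fun v => v),
    prod_graphVertices hm]

theorem vertexProd_dvd (hm : Squarefree m) (V₁ : Finset (graphVertices m)) :
    vertexProd V₁ ∣ m := ⟨_, (vertexProd_mul_compl hm V₁).symm⟩

theorem prime_dvd_vertex_iff (hm : m ≠ 0) {p : ℕ} (hp : p.Prime) (v : graphVertices m) :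
    (p : ℤ) ∣ v ↔ (v : ℤ) = p := by
  constructor
  · intro h
    rcases (mem_graphVertices_iff hm).1 v.2 with ⟨q, hq, -, hv⟩ | ⟨-, hv⟩
    · rw [hv] at h ⊢
      rw [(Nat.prime_dvd_prime_iff_eq hp hq).1 (Int.natCast_dvd_natCast.1 h)]
    · rw [hv, dvd_neg] at h
      exact absurd (by exact_mod_cast h) hp.not_dvd_one
  · intro h; rw [h]

theorem prime_dvd_vertexProd_iff (hm : m ≠ 0) {p : ℕ} (hp : p.Prime)
    (V₁ : Finset (graphVertices m)) :
    (p : ℤ) ∣ vertexProd V₁ ↔ ∃ v ∈ V₁, (v : ℤ) = p := by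
  unfold vertexProd
  rw [Prime.dvd_finsetProd_iff (Nat.prime_iff_prime_int.1 hp)]
  simp only [prime_dvd_vertex_iff hm hp]

theorem jacobiSym_prod {ι : Type*} (s : Finset ι) (f : ι → ℤ) (p : ℕ) :
    jacobiSym (∏ i ∈ s, f i) p = ∏ i ∈ s, jacobiSym (f i) p := by
  classical
  induction s using Finset.induction_on with
  | empty => simp
  | insert a s ha ih => rw [prod_insert ha, prod_insert ha, jacobiSym.mul_left, ih]

/-- The symbol of the product is the product of the symbols of its vertices. Each is `±1` because
`p` is not in `s`, and the arcs count the factors `-1`. -/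
theorem odd_ncard_adj_iff (hm : m ≠ 0) {p : ℕ} (hp : p.Prime) (hp3 : p % 3 = 1)
    {u : graphVertices m} (hu : (u : ℤ) = p) {s : Finset (graphVertices m)} (hus : u ∉ s) :
    Odd {v : graphVertices m | v ∈ s ∧ (graphG m).Adj u v}.ncard ↔
      jacobiSym (vertexProd s) p = -1 := by
  have : Fact p.Prime := ⟨hp⟩
  have hset : {v : graphVertices m | v ∈ s ∧ (graphG m).Adj u v} =
      ↑(s.filter fun v : graphVertices m => jacobiSym (v : ℤ) p = -1) := by
    ext v
    rw [Set.mem_ofPred_eq, coe_filter, Set.mem_ofPred_eq]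
    refine and_congr_right fun _ => ⟨?_, fun h => ⟨p, hp, hu, hp3, h⟩⟩
    rintro ⟨q, -, huq, -, hq⟩
    have : p = q := by exact_mod_cast hu.symm.trans huq
    rwa [this]
  have hval : ∀ v ∈ s, jacobiSym (v : ℤ) p =
      if jacobiSym (v : ℤ) p = -1 then -1 else 1 := by
    intro v hv
    have hpv : ¬(p : ℤ) ∣ v := by
      rw [prime_dvd_vertex_iff hm hp]
      intro h
      exact hus ((Subtype.ext (h.trans hu.symm) : v = u) ▸ hv)
    rcases Padic.jacobiSym_eq_one_or hpv with h | h <;> rw [h] <;> norm_num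
  rw [hset, Set.ncard_coe_finset, vertexProd, jacobiSym_prod, prod_congr rfl hval, prod_ite,
    prod_const, prod_const_one, mul_one, neg_one_pow_eq_neg_one_iff_odd (by norm_num)]

/-- A partition is not odd iff its product satisfies the local conditions at the primes
`p ≡ 1 (mod 3)`. -/
theorem not_isOddPartition_iff (hm : Squarefree m) (V₁ : Finset (graphVertices m)) :
    ¬IsOddPartition (graphG m) V₁ ↔
      ∀ p : ℕ, p.Prime → (p : ℤ) ∣ m → p % 3 = 1 → IsGoodAt m (vertexProd V₁) p := by
  have hm0 := hm.ne_zero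
  have hD0 : vertexProd V₁ ≠ 0 := ne_zero_of_dvd_ne_zero hm0 (vertexProd_dvd hm V₁)
  have hdiv : m / vertexProd V₁ = vertexProd V₁ᶜ :=
    Int.ediv_eq_of_eq_mul_right hD0 (vertexProd_mul_compl hm V₁).symm
  have hadj : ∀ (u : graphVertices m) (s : Finset (graphVertices m)), u ∉ s →
      Odd {v : graphVertices m | v ∈ s ∧ (graphG m).Adj u v}.ncard →
      ∃ p : ℕ, p.Prime ∧ (p : ℤ) ∣ m ∧ p % 3 = 1 ∧ (u : ℤ) = p ∧
        jacobiSym (vertexProd s) p = -1 := by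
    intro u s hus hodd
    have hne : {v : graphVertices m | v ∈ s ∧ (graphG m).Adj u v}.Nonempty := by
      rw [Set.nonempty_iff_ne_empty]
      intro h
      rw [h, Set.ncard_empty] at hodd
      exact absurd hodd (by decide)
    obtain ⟨v, -, p, hp, hup, hp3, -⟩ := hne
    refine ⟨p, hp, ?_, hp3, hup, (odd_ncard_adj_iff hm0 hp hp3 hup hus).1 hodd⟩
    rcases (mem_graphVertices_iff hm0).1 u.2 with ⟨q, -, hqm, huq⟩ | ⟨-, hu⟩
    · rwa [← hup, huq]
    · omega
  constructor
  · intro h p hp hpm hp3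
    have : Fact p.Prime := ⟨hp⟩
    have hpu : (p : ℤ) ∈ graphVertices m :=
      (mem_graphVertices_iff hm0).2 (Or.inl ⟨p, hp, hpm, rfl⟩)
    by_contra hbad
    apply h
    unfold IsGoodAt at hbad
    split_ifs at hbad with hpD
    · obtain ⟨u, hu, hup⟩ := (prime_dvd_vertexProd_iff hm0 hp V₁).1 hpD
      refine Or.inl ⟨u, hu, (odd_ncard_adj_iff hm0 hp hp3 hup (by simpa using hu)).2 ?_⟩
      rw [← hdiv]
      exact (Padic.jacobiSym_eq_one_or (not_dvd_ediv_of_squarefree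
        (Nat.prime_iff_prime_int.1 hp) hm (vertexProd_dvd hm V₁) hpD)).resolve_left hbad
    · have hu : (⟨p, hpu⟩ : graphVertices m) ∉ V₁ := fun hu =>
        hpD ((prime_dvd_vertexProd_iff hm0 hp V₁).2 ⟨_, hu, rfl⟩)
      exact Or.inr ⟨⟨p, hpu⟩, by simpa using hu, (odd_ncard_adj_iff hm0 hp hp3 rfl hu).2
        ((Padic.jacobiSym_eq_one_or hpD).resolve_left hbad)⟩
  · rintro h (⟨u, hu, hodd⟩ | ⟨u, hu, hodd⟩)
    · obtain ⟨p, hp, hpm, hp3, hup, hj⟩ := hadj u _ (by simpa using hu) hodd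
      have hgood := h p hp hpm hp3
      unfold IsGoodAt at hgood
      rw [if_pos ((prime_dvd_vertexProd_iff hm0 hp V₁).2 ⟨u, hu, hup⟩), hdiv, hj] at hgood
      exact absurd hgood (by decide)
    · rw [mem_compl] at hu
      obtain ⟨p, hp, hpm, hp3, hup, hj⟩ := hadj u _ hu hodd
      have hgood := h p hp hpm hp3
      unfold IsGoodAt at hgood
      rw [if_neg (fun hpD => by
        obtain ⟨v, hv, hvp⟩ := (prime_dvd_vertexProd_iff hm0 hp V₁).1 hpD
        exact hu ((Subtype.ext (hup.trans hvp.symm) : u = v) ▸ hv)), hj] at hgood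
      exact absurd hgood (by decide)

theorem isOddPartition_compl_iff (V₁ : Finset (graphVertices m)) :
    IsOddPartition (graphG m) V₁ᶜ ↔ IsOddPartition (graphG m) V₁ := by
  unfold IsOddPartition
  rw [compl_compl]
  exact or_comm

/-- Every positive divisor of `m` is the product of a set of vertices. -/
theorem exists_vertexProd_eq (hm : Squarefree m) {D : ℤ} (hD : D ∣ m) (hpos : 0 < D) :
    ∃ V₁ : Finset (graphVertices m), vertexProd V₁ = D ∧
      ∀ v ∈ V₁, ∃ p : ℕ, p.Prime ∧ (p : ℤ) ∣ D ∧ (v : ℤ) = p := by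
  set s := D.natAbs.primeFactors.image (fun p : ℕ => (p : ℤ)) with hs
  have hmem : ∀ v ∈ s, ∃ p : ℕ, p.Prime ∧ (p : ℤ) ∣ D ∧ v = p := by
    intro v hv
    obtain ⟨p, hp, rfl⟩ := mem_image.1 hv
    exact ⟨p, Nat.prime_of_mem_primeFactors hp,
      Int.natCast_dvd.2 (Nat.dvd_of_mem_primeFactors hp), rfl⟩
  refine ⟨s.subtype (· ∈ graphVertices m), ?_, fun v hv => hmem v (mem_subtype.1 hv)⟩
  unfold vertexProd
  rw [prod_subtype_of_mem (fun v : ℤ => v), prod_image_primeFactors (hm.squarefree_of_dvd hD)]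
  · omega
  · intro v hv
    obtain ⟨p, hp, hpD, rfl⟩ := hmem v hv
    exact (mem_graphVertices_iff hm.ne_zero).2 (Or.inl ⟨p, hp, hpD.trans hD, rfl⟩)

theorem vertexProd_ne_one (hm : m ≠ 0) {V₁ : Finset (graphVertices m)} (hne : V₁.Nonempty)
    (hpos : ∀ v ∈ V₁, 0 < (v : ℤ)) : vertexProd V₁ ≠ 1 := by
  obtain ⟨v, hv⟩ := hne
  intro h
  rcases (mem_graphVertices_iff hm).1 v.2 with ⟨q, hq, -, hvq⟩ | ⟨-, hvq⟩
  · have h1 := (prime_dvd_vertexProd_iff hm hq V₁).2 ⟨v, hv, hvq⟩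
    rw [h] at h1
    exact hq.not_dvd_one (by exact_mod_cast h1)
  · have := hpos v hv
    omega

theorem vertex_pos (hm : 0 < m) (v : graphVertices m) : 0 < (v : ℤ) := by
  rcases (mem_graphVertices_iff hm.ne').1 v.2 with ⟨q, hq, -, hvq⟩ | ⟨h, -⟩
  · rw [hvq]; exact_mod_cast hq.pos
  · omega

end Graph

/-! ### Residues modulo 3 and the torsion classes inside S'(E). -/

theorem Nat.emod_three_eq_one {d : ℕ} (h : ∀ p : ℕ, p.Prime → p ∣ d → p % 3 = 1) : d % 3 = 1 := by
  induction d using Nat.recOnMul with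
  | zero => exact absurd (h 2 Nat.prime_two (dvd_zero 2)) (by norm_num)
  | one => rfl
  | prime p hp => exact h p hp dvd_rfl
  | mul a b iha ihb =>
    rw [Nat.mul_mod, iha fun p hp hpa => h p hp (hpa.mul_right b),
      ihb fun p hp hpb => h p hp (hpb.mul_left a)]

theorem Int.emod_three_eq_one {d : ℤ} (hd : 0 < d)
    (h : ∀ p : ℕ, p.Prime → (p : ℤ) ∣ d → p % 3 = 1) : d % 3 = 1 := by
  have := Nat.emod_three_eq_one (d := d.natAbs) fun p hp hpd => h p hp (Int.natCast_dvd.2 hpd)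
  omega

/-- The set `{1, n, -n/3, -3}` of square classes. -/
def torsionClasses (n : ℕ) : Set (SqClass ℚ) :=
  {1, sqClass (n : ℚ), sqClass (-(n : ℚ) / 3), sqClass (-3 : ℚ)}

namespace IsAdmissible

variable {n : ℕ}

theorem cast_ne_zero (h : IsAdmissible n) : (n : ℚ) ≠ 0 := by exact_mod_cast h.ne_zero

theorem sqClass_neg_div_three (h : IsAdmissible n) :
    sqClass (-(n : ℚ) / 3) = sqClass (n : ℚ) * sqClass (-3 : ℚ) := by
  have := h.cast_ne_zero
  have h3 : (n : ℚ) * (-3) ≠ 0 := mul_ne_zero this (by norm_num)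
  rw [← sqClass_mul this (by norm_num),
    sqClass_eq_iff (div_ne_zero (neg_ne_zero.2 this) (by norm_num)) h3]
  exact ⟨n, by ring⟩

theorem isGoodAt_one {m : ℤ} {p : ℕ} (hp : p.Prime) : IsGoodAt m 1 p := by
  unfold IsGoodAt
  rw [if_neg fun h => hp.not_dvd_one (by exact_mod_cast h), jacobiSym.one_left]

theorem one_mem_selmer' (h : IsAdmissible n) : (1 : SqClass ℚ) ∈ (curvePiThird n).selmer' := by
  have := (h.mem_selmer'_iff (one_dvd _)).2
    ⟨fun p hp _ _ => isGoodAt_one hp, fun _ => Or.inl (by norm_num)⟩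
  rwa [Int.cast_one, sqClass_one] at this

theorem natCast_mem_selmer' (h : IsAdmissible n) :
    sqClass (n : ℚ) ∈ (curvePiThird n).selmer' := by
  have hn0 : (n : ℤ) ≠ 0 := by exact_mod_cast h.ne_zero
  have := (h.mem_selmer'_iff (dvd_refl (n : ℤ))).2 ⟨fun p hp hpn _ => by
      unfold IsGoodAt
      rw [if_pos (Int.natCast_dvd_natCast.2 hpn), Int.ediv_self hn0, jacobiSym.one_left],
    fun h2 => Or.inr ⟨by exact_mod_cast h.three_dvd, by exact_mod_cast h2⟩⟩
  rwa [Int.cast_natCast] at this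

theorem neg_three_mem_selmer' (h : IsAdmissible n) :
    sqClass (-3 : ℚ) ∈ (curvePiThird n).selmer' := by
  have hd : (-3 : ℤ) ∣ n := by rw [neg_dvd]; exact_mod_cast h.three_dvd
  have := (h.mem_selmer'_iff hd).2 ⟨fun p hp hpn hp1 => by
      have : Fact p.Prime := ⟨hp⟩
      have hp3 : p ≠ 3 := by rintro rfl; simp at hp1
      unfold IsGoodAt
      rw [if_neg, Padic.jacobiSym_neg_three (h.ne_two_of_dvd hpn) hp3, if_pos hp1]
      rw [dvd_neg]
      intro h3
      exact hp3 ((Nat.prime_dvd_prime_iff_eq hp Nat.prime_three).1 (by exact_mod_cast h3)),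
    fun _ => Or.inr ⟨by norm_num, by norm_num⟩⟩
  exact_mod_cast this

theorem torsionClasses_subset (h : IsAdmissible n) :
    torsionClasses n ⊆ (curvePiThird n).selmer' := by
  rintro c (rfl | rfl | rfl | rfl)
  · exact h.one_mem_selmer'
  · exact h.natCast_mem_selmer'
  · rw [h.sqClass_neg_div_three]
    exact h.mul_mem_selmer' h.natCast_mem_selmer' h.neg_three_mem_selmer'
  · exact h.neg_three_mem_selmer'

theorem mul_mem_torsionClasses (h : IsAdmissible n) {c d : SqClass ℚ}
    (hc : c ∈ torsionClasses n) (hd : d ∈ torsionClasses n) : c * d ∈ torsionClasses n := by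
  have hmem : ∀ e : SqClass ℚ, e ∈ torsionClasses n ↔ e = 1 ∨ e = sqClass (n : ℚ) ∨
      e = sqClass (n : ℚ) * sqClass (-3 : ℚ) ∨ e = sqClass (-3 : ℚ) := by
    intro e
    rw [← h.sqClass_neg_div_three]
    rfl
  rw [hmem] at hc hd ⊢
  -- The set is the subgroup `{1, a, ab, b}` generated by the two involutions `a` and `b`; closure
  -- is its multiplication table.
  generalize sqClass (n : ℚ) = a at *
  generalize sqClass (-3 : ℚ) = b at *
  have ha := SqClass.mul_self a
  have hb := SqClass.mul_self b
  have hab := SqClass.mul_self (a * b)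
  have h1 : a * (a * b) = b := by rw [← mul_assoc, ha, one_mul]
  have h2 : a * b * b = a := by rw [mul_assoc, hb, mul_one]
  have h3 : a * b * a = b := by rw [mul_comm, h1]
  have h4 : b * (a * b) = a := by rw [mul_comm, h2]
  have h5 : b * a = a * b := mul_comm b a
  rcases hc with rfl | rfl | rfl | rfl <;> rcases hd with rfl | rfl | rfl | rfl <;>
    simp only [one_mul, mul_one, ha, hb, hab, h1, h2, h3, h4, h5, true_or, or_true]

/-- This allows a class to be normalised by multiplying it with `n` or `-3` before it is shown to be
a torsion class. -/
theorem mem_torsionClasses_of_mul (h : IsAdmissible n) {c d : SqClass ℚ}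
    (hd : d ∈ torsionClasses n) (hcd : c * d ∈ torsionClasses n) : c ∈ torsionClasses n := by
  have := h.mul_mem_torsionClasses hcd hd
  rwa [mul_assoc, SqClass.mul_self, mul_one] at this

theorem one_mem_torsionClasses : (1 : SqClass ℚ) ∈ torsionClasses n := Or.inl rfl

theorem natCast_mem_torsionClasses : sqClass (n : ℚ) ∈ torsionClasses n := Or.inr (Or.inl rfl)

theorem neg_three_mem_torsionClasses : sqClass (-3 : ℚ) ∈ torsionClasses n :=
  Or.inr (Or.inr (Or.inr rfl))

/-- The positive divisors of `n` whose class lies in `{1, n, -n/3, -3}` are `1` and `n`. -/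
theorem eq_one_or_of_mem_torsionClasses (h : IsAdmissible n) {D : ℤ} (hD : D ∣ n) (hpos : 0 < D)
    (hmem : sqClass (D : ℚ) ∈ torsionClasses n) : D = 1 ∨ D = n := by
  have hneg : ∀ {E : ℤ}, E < 0 → E ∣ n → sqClass (D : ℚ) = sqClass (E : ℚ) → False := by
    intro E hE hEn he
    have := sqClass_intCast_injective h.int_squarefree hD hEn he
    omega
  have hn0 := Nat.pos_of_ne_zero h.ne_zero
  have hn3 := h.natCast_eq
  rcases hmem with hc | hc | hc | hc
  · left
    refine sqClass_intCast_injective h.int_squarefree hD (one_dvd _) ?_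
    rw [hc, Int.cast_one, sqClass_one]
  · right
    refine sqClass_intCast_injective h.int_squarefree hD dvd_rfl ?_
    rw [hc, Int.cast_natCast]
  · refine (hneg (E := -((n / 3 : ℕ) : ℤ)) (by omega) ⟨-3, by rw [hn3]; push_cast; omega⟩ ?_).elim
    rw [hc]
    congr 1
    have : (n : ℚ) = 3 * ((n / 3 : ℕ) : ℚ) := by exact_mod_cast congrArg (Int.cast (R := ℚ)) hn3
    rw [Int.cast_neg, Int.cast_natCast, this]
    ring
  · refine (hneg (E := -3) (by norm_num) ?_ ?_).elim
    · rw [neg_dvd]; exact_mod_cast h.three_dvd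
    · rw [hc]; norm_num

/-- Multiplication by the class of `n` exchanges the divisors `D` and `n / D`. -/
theorem sqClass_ediv (h : IsAdmissible n) {D : ℤ} (hD : D ∣ n) :
    sqClass ((n / D : ℤ) : ℚ) = sqClass (D : ℚ) * sqClass (n : ℚ) := by
  have hn0 : (n : ℤ) ≠ 0 := by exact_mod_cast h.ne_zero
  have hD0 := ne_zero_of_dvd_ne_zero hn0 hD
  have hD0' : (D : ℚ) ≠ 0 := by exact_mod_cast hD0
  have he := Int.mul_ediv_cancel' hD
  have hE0 : n / D ≠ 0 := by intro h0; rw [h0, mul_zero] at he; exact hn0 he.symm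
  rw [← sqClass_mul hD0' h.cast_ne_zero,
    sqClass_eq_iff (by exact_mod_cast hE0) (mul_ne_zero hD0' h.cast_ne_zero)]
  have : (n : ℚ) = D * ((n / D : ℤ) : ℚ) := by exact_mod_cast he.symm
  exact ⟨D * ((n / D : ℤ) : ℚ), by rw [this]; ring_nf⟩

/-- Multiplication by the class of `-3` on divisors of `n`. -/
theorem exists_sqClass_mul_neg_three (h : IsAdmissible n) {D : ℤ} (hD : D ∣ n) :
    ∃ E : ℤ, E ∣ n ∧ sqClass (E : ℚ) = sqClass (D : ℚ) * sqClass (-3 : ℚ) ∧ E * D < 0 ∧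
      ((3 : ℤ) ∣ D → ¬(3 : ℤ) ∣ E) ∧ ∀ q : ℕ, q.Prime → q ≠ 3 → ((q : ℤ) ∣ E ↔ (q : ℤ) ∣ D) := by
  have hsq := h.int_squarefree
  have hD0 := ne_zero_of_dvd_ne_zero hsq.ne_zero hD
  have hD0' : (D : ℚ) ≠ 0 := by exact_mod_cast hD0
  have hq3 : ∀ q : ℕ, q.Prime → q ≠ 3 → ∀ e : ℤ, (q : ℤ) ∣ 3 * e ↔ (q : ℤ) ∣ e := by
    intro q hq hq3 e
    rw [(Nat.prime_iff_prime_int.1 hq).dvd_mul, or_iff_right]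
    intro h3
    exact hq3 ((Nat.prime_dvd_prime_iff_eq hq Nat.prime_three).1 (by exact_mod_cast h3))
  by_cases h3 : (3 : ℤ) ∣ D
  · obtain ⟨e, rfl⟩ := h3
    have he0 : e ≠ 0 := right_ne_zero_of_mul hD0
    refine ⟨-e, (neg_dvd.2 (dvd_mul_left e 3)).trans hD, ?_, ?_, fun _ he => ?_,
      fun q hq hq' => ?_⟩
    · rw [← sqClass_mul hD0' (by norm_num), sqClass_eq_iff (by exact_mod_cast neg_ne_zero.2 he0)
        (mul_ne_zero hD0' (by norm_num))]
      exact ⟨3 * e, by push_cast; ring⟩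
    · nlinarith [mul_self_pos.2 he0]
    · rw [dvd_neg] at he
      exact Int.prime_three.not_isUnit ((hsq.squarefree_of_dvd hD) 3 (mul_dvd_mul_left 3 he))
    · rw [dvd_neg, hq3 q hq hq']
  · refine ⟨-(3 * D), ?_, ?_, ?_, fun h' => absurd h' h3, fun q hq hq' => ?_⟩
    · rw [neg_dvd]
      exact ((Int.prime_three.coprime_iff_not_dvd).2 h3).mul_dvd
        (by exact_mod_cast h.three_dvd) hD
    · rw [← sqClass_mul hD0' (by norm_num)]
      congr 1
      push_cast
      ring
    · nlinarith [mul_self_pos.2 hD0]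
    · rw [dvd_neg, hq3 q hq hq']

/-- The partitions with a given positive product in `S'(E)` are not odd. -/
theorem vertexProd_mem_selmer' (h : IsAdmissible n) {V₁ : Finset (graphVertices (n : ℤ))}
    (hodd : ¬IsOddPartition (graphG (n : ℤ)) V₁)
    (h3 : n / 3 % 3 = 2 → vertexProd V₁ % 3 = 1) :
    sqClass (vertexProd V₁ : ℚ) ∈ (curvePiThird n).selmer' :=
  (h.mem_selmer'_iff (vertexProd_dvd h.int_squarefree V₁)).2
    ⟨fun p hp hpn hp1 => (not_isOddPartition_iff h.int_squarefree V₁).1 hodd p hp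
      (Int.natCast_dvd_natCast.2 hpn) hp1, fun h2 => Or.inl (h3 h2)⟩

theorem vertexProd_pos (h : IsAdmissible n) (V₁ : Finset (graphVertices (n : ℤ))) :
    0 < vertexProd V₁ :=
  prod_pos fun v _ => vertex_pos (by exact_mod_cast Nat.pos_of_ne_zero h.ne_zero) v

/-- If `S'(E)` is minimal, the partitions giving elements of `S'(E)` are trivial. -/
theorem not_isNontrivialPartition (h : IsAdmissible n)
    (hS : (curvePiThird n).selmer' ⊆ torsionClasses n) {V₁ : Finset (graphVertices (n : ℤ))}
    (hmem : sqClass (vertexProd V₁ : ℚ) ∈ (curvePiThird n).selmer') :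
    ¬IsNontrivialPartition V₁ := by
  rintro ⟨hne, hne'⟩
  have hm := h.int_squarefree
  have hm0 : (0 : ℤ) < n := by exact_mod_cast Nat.pos_of_ne_zero h.ne_zero
  rcases h.eq_one_or_of_mem_torsionClasses (vertexProd_dvd hm V₁) (h.vertexProd_pos V₁)
    (hS hmem) with h1 | h1
  · exact vertexProd_ne_one hm0.ne' hne (fun v _ => vertex_pos hm0 v) h1
  · refine vertexProd_ne_one hm0.ne' hne' (fun v _ => vertex_pos hm0 v) ?_
    have := vertexProd_mul_compl hm V₁
    rw [h1] at this
    exact mul_left_cancel₀ hm0.ne' (by rw [this, mul_one])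

end IsAdmissible

/-! ### The pigeonhole bound and minimality of the Selmer groups. -/

namespace IsAdmissible

variable {n : ℕ}

/-- Modulo the class of `m`, the integer `D` agrees with the integer whose symbol `IsGoodAt` tests.
-/
theorem isSquare_mul_or_of_dvd {p : ℕ} [Fact p.Prime] {m D : ℤ} (hD : D ∣ m) :
    IsSquare ((D : ℚ_[p]) * ((if (p : ℤ) ∣ D then m / D else D : ℤ) : ℚ_[p])) ∨
      IsSquare ((D : ℚ_[p]) * ((if (p : ℤ) ∣ D then m / D else D : ℤ) : ℚ_[p]) * m) := by
  split_ifs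
  · right
    rw [← Int.cast_mul, Int.mul_ediv_cancel' hD]
    exact ⟨m, rfl⟩
  · exact Or.inl ⟨D, rfl⟩

/-- Two divisors of `n` with the same local behaviour differ by an element of `S'(E)`. -/
theorem mul_mem_selmer'_of_iff (h : IsAdmissible n) {a b : ℤ} (ha : a ∣ n) (hb : b ∣ n)
    (hgood : ∀ p : ℕ, p.Prime → p ∣ n → p % 3 = 1 → (IsGoodAt n a p ↔ IsGoodAt n b p))
    (h3 : n / 3 % 3 = 2 → a * b % 3 = 1) :
    sqClass (a : ℚ) * sqClass (b : ℚ) ∈ (curvePiThird n).selmer' := by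
  have hsq := h.int_squarefree
  have hn0 := hsq.ne_zero
  have ha0 := ne_zero_of_dvd_ne_zero hn0 ha
  have hb0 := ne_zero_of_dvd_ne_zero hn0 hb
  have hgen := Subgroup.mul_mem _ (h.mem_genSubgroup_of_dvd (ha.mul_left 2))
    (h.mem_genSubgroup_of_dvd (hb.mul_left 2))
  have hodd : ∀ {D : ℤ}, D ∣ n → Odd D := by
    rintro D ⟨e, he⟩
    have : Odd (n : ℤ) := by exact_mod_cast h.odd
    exact (Int.odd_mul.1 (he ▸ this)).1
  rw [← sqClass_mul (by exact_mod_cast ha0) (by exact_mod_cast hb0), ← Int.cast_mul] at hgen ⊢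
  refine h.mem_selmer'_of ((hodd ha).mul (hodd hb)) hgen ?_ ?_
  · intro p hpf hpn hp1
    have hp2 := h.ne_two_of_dvd hpn
    have hunit : ∀ {D : ℤ}, D ∣ n → ¬(p : ℤ) ∣ (if (p : ℤ) ∣ D then (n : ℤ) / D else D) := by
      intro D hD
      split_ifs with hpD
      · exact not_dvd_ediv_of_squarefree (Nat.prime_iff_prime_int.1 hpf.out) hsq hD hpD
      · exact hpD
    have hj := hgood p hpf.out hpn hp1
    unfold IsGoodAt at hj
    -- The units tested for `a` and `b` have equal symbols, hence equal classes; so `a b` is trivial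
    -- modulo the class of `n`.
    have hcd := Padic.isSquare_intCast_mul hp2 (hunit ha) (hunit hb) (by
      rcases Padic.jacobiSym_eq_one_or (hunit ha) with h1 | h1 <;>
        rcases Padic.jacobiSym_eq_one_or (hunit hb) with h2 | h2 <;>
        rw [h1, h2] at hj ⊢ <;> norm_num at hj)
    have hne : ∀ {D : ℤ}, D ∣ n →
        ((if (p : ℤ) ∣ D then (n : ℤ) / D else D : ℤ) : ℚ_[p]) ≠ 0 := by
      intro D hD
      rw [Int.cast_ne_zero]
      intro h0
      exact hunit hD (h0 ▸ dvd_zero _)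
    have hn0' : ((n : ℤ) : ℚ_[p]) ≠ 0 := by exact_mod_cast hn0
    have key := isSquare_or_mul hn0' (isSquare_mul_or_of_dvd (p := p) ha)
      (isSquare_mul_or_of_dvd (p := p) hb)
    have hcd0 := mul_ne_zero (hne ha) (hne hb)
    rw [Int.cast_natCast] at key
    rw [Int.cast_mul]
    rcases key with key | key
    · exact Or.inl (isSquare_of_isSquare_mul hcd0 (key.of_eq (by ring)) hcd)
    · exact Or.inr (isSquare_of_isSquare_mul hcd0 (key.of_eq (by ring)) hcd)
  · intro h2
    have := h3 h2
    exact Or.inl ((Padic.isSquare_intCast_three_iff (by omega)).2 this)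

/-- Distinct positive divisors of `n` prime to `3` are independent modulo `{1, n, -n/3, -3}`. -/
theorem eq_of_mul_mem_torsionClasses (h : IsAdmissible n) {a b : ℤ} (ha : a ∣ n) (hb : b ∣ n)
    (ha0 : 0 < a) (hb0 : 0 < b) (ha3 : ¬(3 : ℤ) ∣ a) (hb3 : ¬(3 : ℤ) ∣ b)
    (hmem : sqClass (a : ℚ) * sqClass (b : ℚ) ∈ torsionClasses n) : a = b := by
  have hsq := h.int_squarefree
  have hn0 : (0 : ℤ) < n := by exact_mod_cast Nat.pos_of_ne_zero h.ne_zero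
  have hclass : sqClass (a : ℚ) = sqClass (b : ℚ) * (sqClass (a : ℚ) * sqClass (b : ℚ)) := by
    rw [mul_comm (sqClass (a : ℚ)), ← mul_assoc, SqClass.mul_self, one_mul]
  obtain ⟨E, hE, hEc, hEb, -, -⟩ := h.exists_sqClass_mul_neg_three hb
  have hE0 : E < 0 := by nlinarith
  -- The class `1` gives `a = b`. The class of `n` would give `a = n / b` and make `3` divide `a` or
  -- `b`; the remaining two classes would make `a` negative.
  rcases hmem with hc | hc | hc | hc <;> rw [hc] at hclass
  · rw [mul_one] at hclass
    exact sqClass_intCast_injective hsq ha hb hclass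
  · rw [← h.sqClass_ediv hb] at hclass
    have := sqClass_intCast_injective hsq ha (Int.ediv_dvd_of_dvd hb) hclass
    have h3 : (3 : ℤ) ∣ b * (n / b) := by
      rw [Int.mul_ediv_cancel' hb]; exact_mod_cast h.three_dvd
    rcases Int.prime_three.dvd_or_dvd h3 with h' | h'
    · exact absurd h' hb3
    · exact absurd (this ▸ h') ha3
  · rw [h.sqClass_neg_div_three, mul_comm (sqClass (n : ℚ)), ← mul_assoc, ← hEc,
      ← h.sqClass_ediv hE] at hclass
    have := sqClass_intCast_injective hsq ha (Int.ediv_dvd_of_dvd hE) hclass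
    have h1 := Int.mul_ediv_cancel' hE
    rw [← this] at h1
    nlinarith
  · rw [← hEc] at hclass
    have := sqClass_intCast_injective hsq ha hE hclass
    omega

open Classical in
/-- If `S'(E)` is minimal, few prime divisors of `n` are `2 (mod 3)`: any invariant `g` with
values in `R`, fine enough to detect the condition at `3`, satisfies `2 ^ s ≤ #R`. -/
theorem two_pow_card_le (h : IsAdmissible n) {ps qs : Finset ℕ}
    (hps : ∀ p, p ∈ ps ↔ p.Prime ∧ p ∣ n ∧ p % 3 = 1)
    (hqs : ∀ q, q ∈ qs ↔ q.Prime ∧ q ∣ n ∧ q % 3 = 2)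
    (hS : (curvePiThird n).selmer' ⊆ torsionClasses n) (R : Finset ℕ) (g : ℕ → ℕ)
    (hg : ∀ d : ℕ, ¬3 ∣ d → g d ∈ R)
    (hg3 : ∀ a b : ℕ, ¬3 ∣ a → ¬3 ∣ b → g a = g b → n / 3 % 3 = 2 → a * b % 3 = 1) :
    2 ^ qs.card ≤ R.card := by
  by_contra hlt
  rw [not_le] at hlt
  have hdisj : Disjoint ps qs := by
    rw [disjoint_left]
    intro p hp hq
    have h1 := (hps p).1 hp
    have h2 := (hqs p).1 hq
    omega
  have hprime : ∀ p ∈ ps ∪ qs, p.Prime ∧ p ∣ n ∧ p ≠ 3 := by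
    intro p hp
    rcases mem_union.1 hp with hp | hp
    · obtain ⟨h1, h2, h3⟩ := (hps p).1 hp
      exact ⟨h1, h2, by rintro rfl; simp at h3⟩
    · obtain ⟨h1, h2, h3⟩ := (hqs p).1 hp
      exact ⟨h1, h2, by rintro rfl; simp at h3⟩
  have hdvd : ∀ A ∈ (ps ∪ qs).powerset, ∏ p ∈ A, p ∣ n := fun A hA =>
    prod_primes_dvd n (fun p hp => (hprime p (mem_powerset.1 hA hp)).1.prime)
      fun p hp => (hprime p (mem_powerset.1 hA hp)).2.1
  have hthree : ∀ A ∈ (ps ∪ qs).powerset, ¬3 ∣ ∏ p ∈ A, p := by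
    intro A hA h3
    obtain ⟨p, hp, h3p⟩ := (Nat.prime_three.prime.dvd_finsetProd_iff _).1 h3
    have := hprime p (mem_powerset.1 hA hp)
    exact this.2.2 ((Nat.prime_dvd_prime_iff_eq Nat.prime_three this.1).1 h3p).symm
  -- Pigeonhole: there are `2 ^ (t + s)` subsets of the primes, but only `2 ^ t · #R` pairs formed
  -- by the set of good `p` and the value of `g`. Two subsets with the same pair give an element of
  -- `S'(E)` outside the torsion classes.
  obtain ⟨A, hA, B, hB, hAB, heq⟩ := exists_ne_map_eq_of_card_lt_of_maps_to
    (s := (ps ∪ qs).powerset) (t := ps.powerset ×ˢ R)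
    (f := fun A => (ps.filter fun p => IsGoodAt n ((∏ p ∈ A, p : ℕ) : ℤ) p, g (∏ p ∈ A, p)))
    (by
      rw [card_product, card_powerset, card_powerset, card_union_of_disjoint hdisj, pow_add]
      exact Nat.mul_lt_mul_of_pos_left hlt (by positivity))
    (fun A hA => mem_product.2 ⟨mem_powerset.2 (filter_subset _ _), hg _ (hthree A hA)⟩)
  rw [Prod.mk.injEq] at heq
  have hpos : ∀ A ∈ (ps ∪ qs).powerset, 0 < ∏ p ∈ A, p := fun A hA =>
    prod_pos fun p hp => (hprime p (mem_powerset.1 hA hp)).1.pos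
  have hmem := h.mul_mem_selmer'_of_iff (Int.natCast_dvd_natCast.2 (hdvd A hA))
    (Int.natCast_dvd_natCast.2 (hdvd B hB)) (fun p hp hpn hp1 => by
      have hpps := (hps p).2 ⟨hp, hpn, hp1⟩
      have := Finset.ext_iff.1 heq.1 p
      simpa [hpps] using this)
    (fun h2 => by exact_mod_cast hg3 _ _ (hthree A hA) (hthree B hB) heq.2 h2)
  have := h.eq_of_mul_mem_torsionClasses (Int.natCast_dvd_natCast.2 (hdvd A hA))
    (Int.natCast_dvd_natCast.2 (hdvd B hB)) (by exact_mod_cast hpos A hA)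
    (by exact_mod_cast hpos B hB) (by exact_mod_cast hthree A hA)
    (by exact_mod_cast hthree B hB) (hS hmem)
  have hprod : ∏ p ∈ A, p = ∏ p ∈ B, p := by exact_mod_cast this
  have hfac := congrArg Nat.primeFactors hprod
  rw [Nat.primeFactors_prod fun p hp => (hprime p (mem_powerset.1 hA hp)).1,
    Nat.primeFactors_prod fun p hp => (hprime p (mem_powerset.1 hB hp)).1] at hfac
  exact hAB hfac

/-! ### The group `S'(E)` -/

/-- Multiplication by the torsion class `-3` changes the sign of the representative. -/
theorem subset_torsionClasses_of_pos (h : IsAdmissible n)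
    (hpos : ∀ D : ℤ, D ∣ n → 0 < D → sqClass (D : ℚ) ∈ (curvePiThird n).selmer' →
      sqClass (D : ℚ) ∈ torsionClasses n) : (curvePiThird n).selmer' ⊆ torsionClasses n := by
  intro c hc
  obtain ⟨D, hD, rfl⟩ := h.exists_dvd_of_mem_selmer' hc
  rcases lt_trichotomy D 0 with h0 | rfl | h0
  · obtain ⟨E, hE, hEc, hED, -⟩ := h.exists_sqClass_mul_neg_three hD
    refine h.mem_torsionClasses_of_mul neg_three_mem_torsionClasses ?_
    rw [← hEc]
    refine hpos E hE (by nlinarith) ?_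
    rw [hEc]
    exact h.mul_mem_selmer' hc h.neg_three_mem_selmer'
  · exact absurd (zero_dvd_iff.1 hD) h.int_squarefree.ne_zero
  · exact hpos D hD h0 hc

/-- There is no condition at `3` here, so the positive elements of `S'(E)` are exactly the products
of non-odd partitions, and the trivial partitions account for `1` and `n`. -/
theorem selmer'_eq_iff_of_one (h : IsAdmissible n) {ps qs : Finset ℕ}
    (hps : ∀ p, p ∈ ps ↔ p.Prime ∧ p ∣ n ∧ p % 3 = 1)
    (hqs : ∀ q, q ∈ qs ↔ q.Prime ∧ q ∣ n ∧ q % 3 = 2) (h1 : n / 3 % 3 = 1) :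
    (curvePiThird n).selmer' = torsionClasses n ↔
      qs.card = 0 ∧ IsOddGraph (graphG (n : ℤ)) := by
  constructor
  · intro hS
    refine ⟨?_, fun V₁ hV₁ => ?_⟩
    -- A constant invariant suffices because the place `3` imposes nothing; the bound reads `2 ^ s ≤
    -- 1`.
    · have := h.two_pow_card_le hps hqs hS.subset {0} (fun _ => 0) (by simp)
        (fun _ _ _ _ _ h2 => by omega)
      rw [card_singleton] at this
      by_contra hne
      have := Nat.one_lt_two_pow hne
      omega
    · by_contra hodd
      exact h.not_isNontrivialPartition hS.subset
        (h.vertexProd_mem_selmer' hodd fun h2 => by omega) hV₁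
  · rintro ⟨-, hG⟩
    refine Set.Subset.antisymm (h.subset_torsionClasses_of_pos fun D hD h0 hmem => ?_)
      h.torsionClasses_subset
    obtain ⟨V₁, rfl, -⟩ := exists_vertexProd_eq h.int_squarefree hD h0
    have hnot : ¬IsOddPartition (graphG (n : ℤ)) V₁ :=
      (not_isOddPartition_iff h.int_squarefree V₁).2 fun p hp hpn hp1 =>
        ((h.mem_selmer'_iff hD).1 hmem).1 p hp (Int.natCast_dvd_natCast.1 hpn) hp1
    by_cases hne : V₁.Nonempty
    · by_cases hne' : V₁ᶜ.Nonempty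
      · exact absurd (hG V₁ ⟨hne, hne'⟩) hnot
      · have hprod := vertexProd_mul_compl h.int_squarefree V₁
        rw [not_nonempty_iff_eq_empty.1 hne', vertexProd, vertexProd, prod_empty, mul_one] at hprod
        rw [vertexProd, hprod, Int.cast_natCast]
        exact natCast_mem_torsionClasses
    · rw [not_nonempty_iff_eq_empty.1 hne, vertexProd, prod_empty, Int.cast_one, sqClass_one]
      exact one_mem_torsionClasses

/-- The condition at `3` costs one factor `2` in the counting bound, so `s ≤ 1`. Conversely,
multiplication by `n` and `-3` removes `q` and `3` from the representative, leaving a product of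
primes `p_i`; these are the partitions that the statement tests. -/
theorem selmer'_eq_iff_of_two (h : IsAdmissible n) {ps qs : Finset ℕ}
    (hps : ∀ p, p ∈ ps ↔ p.Prime ∧ p ∣ n ∧ p % 3 = 1)
    (hqs : ∀ q, q ∈ qs ↔ q.Prime ∧ q ∣ n ∧ q % 3 = 2) (h2 : n / 3 % 3 = 2) :
    (curvePiThird n).selmer' = torsionClasses n ↔ qs.card = 1 ∧
      ∀ V₁ : Finset (graphVertices (n : ℤ)), IsNontrivialPartition V₁ →
        (∀ v ∈ V₁, ∃ p ∈ ps, (v : ℤ) = p) → IsOddPartition (graphG (n : ℤ)) V₁ := by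
  have hsq := h.int_squarefree
  have hn0 : (0 : ℤ) < n := by exact_mod_cast Nat.pos_of_ne_zero h.ne_zero
  constructor
  · intro hS
    refine ⟨?_, fun V₁ hV₁ hsub => ?_⟩
    -- The residue modulo `3` is the extra invariant: `a` and `b` prime to `3` with equal residues
    -- have `a b ≡ 1`.
    · have hle := h.two_pow_card_le hps hqs hS.subset {1, 2} (fun d => d % 3)
        (fun d hd => by
          rw [mem_insert, mem_singleton]
          omega)
        (fun a b ha hb hab _ => by
          have hab' : a % 3 = b % 3 := hab
          have : b % 3 = 1 ∨ b % 3 = 2 := by omega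
          rcases this with hb' | hb' <;> rw [Nat.mul_mod, hab', hb'])
      rw [card_pair (by norm_num)] at hle
      have hle1 : qs.card ≤ 1 := by
        by_contra hgt
        have := Nat.pow_le_pow_right (n := 2) (by norm_num) (show 2 ≤ qs.card by omega)
        omega
      -- Without a prime `2 (mod 3)` the product `n / 3` would be `1 (mod 3)`.
      have hne : qs.card ≠ 0 := by
        intro h0
        rw [card_eq_zero] at h0
        have := Nat.emod_three_eq_one (d := n / 3) fun p hp hpd => by
          have : Fact p.Prime := ⟨hp⟩
          have hpn : p ∣ n := hpd.trans (Nat.div_dvd_of_dvd h.three_dvd)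
          rcases prime_eq_three_or p with rfl | hp1 | hp2
          · omega
          · exact hp1
          · have := (hqs p).2 ⟨hp, hpn, hp2⟩
            rw [h0] at this
            exact absurd this (notMem_empty p)
        omega
      omega
    · by_contra hodd
      refine h.not_isNontrivialPartition hS.subset
        (h.vertexProd_mem_selmer' hodd fun _ => ?_) hV₁
      refine Int.emod_three_eq_one (h.vertexProd_pos V₁) fun p hp hpd => ?_
      obtain ⟨v, hv, hvp⟩ := (prime_dvd_vertexProd_iff hsq.ne_zero hp V₁).1 hpd
      obtain ⟨p', hp', hvp'⟩ := hsub v hv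
      have : p = p' := by exact_mod_cast hvp.symm.trans hvp'
      rw [this]
      exact ((hps p').1 hp').2.2
  · rintro ⟨hcard, hG⟩
    obtain ⟨q, rfl⟩ := card_eq_one.1 hcard
    obtain ⟨hq, hqn, hq2⟩ := (hqs q).1 (mem_singleton_self q)
    have hq3 : q ≠ 3 := by rintro rfl; simp at hq2
    have key : ∀ D : ℤ, D ∣ n → ¬(3 : ℤ) ∣ D → ¬(q : ℤ) ∣ D →
        sqClass (D : ℚ) ∈ (curvePiThird n).selmer' → sqClass (D : ℚ) ∈ torsionClasses n := by
      intro D hD hD3 hDq hmem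
      obtain ⟨hgood, h3⟩ := (h.mem_selmer'_iff hD).1 hmem
      have hD1 : D % 3 = 1 := (h3 h2).resolve_right fun h' => hD3 h'.1
      have hprimes : ∀ p : ℕ, p.Prime → (p : ℤ) ∣ D → p ∈ ps := by
        intro p hp hpD
        have : Fact p.Prime := ⟨hp⟩
        have hpn : p ∣ n := Int.natCast_dvd_natCast.1 (hpD.trans hD)
        rcases prime_eq_three_or p with rfl | hp1 | hp2
        · exact absurd (by exact_mod_cast hpD) hD3
        · exact (hps p).2 ⟨hp, hpn, hp1⟩
        · have := mem_singleton.1 ((hqs p).2 ⟨hp, hpn, hp2⟩)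
          exact absurd (this ▸ hpD) hDq
      -- Up to sign `D` is a product of primes `1 (mod 3)`, so `D ≡ 1 (mod 3)` fixes the sign.
      have hDpos : 0 < D := by
        by_contra hle
        have hneg : 0 < -D := by omega
        have := Int.emod_three_eq_one hneg fun p hp hpD =>
          ((hps p).1 (hprimes p hp (dvd_neg.1 hpD))).2.2
        omega
      obtain ⟨V₁, hV₁, hsub⟩ := exists_vertexProd_eq hsq hD hDpos
      by_cases hne : V₁.Nonempty
      · exfalso
        have h3V : (3 : ℤ) ∈ graphVertices (n : ℤ) := (mem_graphVertices_iff hn0.ne').2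
          (Or.inl ⟨3, Nat.prime_three, by exact_mod_cast h.three_dvd, rfl⟩)
        have h3V₁ : (⟨3, h3V⟩ : graphVertices (n : ℤ)) ∈ V₁ᶜ := by
          rw [mem_compl]
          intro hmem3
          apply hD3
          rw [← hV₁]
          exact_mod_cast (prime_dvd_vertexProd_iff hn0.ne' Nat.prime_three V₁).2 ⟨_, hmem3, rfl⟩
        refine (not_isOddPartition_iff hsq V₁).2 (fun p hp hpn hp1 => ?_)
          (hG V₁ ⟨hne, ⟨_, h3V₁⟩⟩ fun v hv => ?_)
        · rw [hV₁]
          exact hgood p hp (Int.natCast_dvd_natCast.1 hpn) hp1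
        · obtain ⟨p, hp, hpD, hvp⟩ := hsub v hv
          exact ⟨p, hprimes p hp hpD, hvp⟩
      · rw [← hV₁, not_nonempty_iff_eq_empty.1 hne, vertexProd, prod_empty, Int.cast_one,
          sqClass_one]
        exact one_mem_torsionClasses
    have key2 : ∀ D : ℤ, D ∣ n → ¬(q : ℤ) ∣ D →
        sqClass (D : ℚ) ∈ (curvePiThird n).selmer' → sqClass (D : ℚ) ∈ torsionClasses n := by
      intro D hD hDq hmem
      by_cases hD3 : (3 : ℤ) ∣ D
      · obtain ⟨E, hE, hEc, -, hE3, hEq⟩ := h.exists_sqClass_mul_neg_three hD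
        refine h.mem_torsionClasses_of_mul neg_three_mem_torsionClasses ?_
        rw [← hEc]
        refine key E hE (hE3 hD3) (by rwa [hEq q hq hq3]) ?_
        rw [hEc]
        exact h.mul_mem_selmer' hmem h.neg_three_mem_selmer'
      · exact key D hD hD3 hDq hmem
    refine Set.Subset.antisymm (fun c hc => ?_) h.torsionClasses_subset
    obtain ⟨D, hD, rfl⟩ := h.exists_dvd_of_mem_selmer' hc
    -- Multiplication by `n` replaces `D` by `n / D`, which is prime to `q`.
    by_cases hDq : (q : ℤ) ∣ D
    · refine h.mem_torsionClasses_of_mul natCast_mem_torsionClasses ?_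
      rw [← h.sqClass_ediv hD]
      refine key2 _ (Int.ediv_dvd_of_dvd hD)
        (not_dvd_ediv_of_squarefree (Nat.prime_iff_prime_int.1 hq) hsq hD hDq) ?_
      rw [h.sqClass_ediv hD]
      exact h.mul_mem_selmer' hc h.natCast_mem_selmer'
    · exact key2 D hD hDq hc

/-! ### The group `S(E)` -/

theorem selmer_eq_one_iff (h : IsAdmissible n) : (curvePiThird n).selmer = {1} ↔
    ∀ D : ℤ, D ∣ n → sqClass (D : ℚ) ∈ (curvePiThird n).selmer → D = 1 := by
  have hone : (1 : SqClass ℚ) ∈ (curvePiThird n).selmer := by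
    have := (h.mem_selmer_iff (one_dvd _)).2 ⟨one_pos, by norm_num,
      fun q hq _ _ => ⟨fun hq1 => hq.not_dvd_one (by exact_mod_cast hq1), jacobiSym.one_left q⟩,
      fun p hp _ _ => isGoodAt_one hp, fun _ => by norm_num, fun _ => Or.inl (by norm_num)⟩
    rwa [Int.cast_one, sqClass_one] at this
  constructor
  · intro hS D hD hmem
    rw [hS] at hmem
    refine sqClass_intCast_injective h.int_squarefree hD (one_dvd _) ?_
    rw [Int.cast_one, sqClass_one]
    exact hmem
  · intro hS
    refine Set.Subset.antisymm (fun c hc => ?_) (Set.singleton_subset_iff.2 hone)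
    obtain ⟨D, hD, rfl⟩ := h.exists_dvd_of_mem_genSubgroup hc.1
    have h4 := ((h.mem_selmer_iff hD).1 hc).2.1
    rw [hS D (dvd_of_odd hD (by rw [Int.odd_iff]; omega)) hc, Int.cast_one, sqClass_one]
    rfl

/-- The quotients `-n / D` and `(n / 3) / D` differ by the factor `-3`, a square modulo `p`. This is
why `G(n / 3)` appears when `D` is prime to `3`. -/
theorem isGoodAt_neg_iff (h : IsAdmissible n) {D : ℤ} (hD : D ∣ ((n / 3 : ℕ) : ℤ)) {p : ℕ}
    (hp : p.Prime) (hpn : p ∣ n) (hp1 : p % 3 = 1) :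
    IsGoodAt (-n) D p ↔ IsGoodAt ((n / 3 : ℕ) : ℤ) D p := by
  have : Fact p.Prime := ⟨hp⟩
  have hp3 : p ≠ 3 := by rintro rfl; simp at hp1
  have hdiv : -(n : ℤ) / D = -3 * (((n / 3 : ℕ) : ℤ) / D) := by
    rw [← Int.mul_ediv_assoc _ hD, h.natCast_eq]
    congr 1
  unfold IsGoodAt
  split_ifs
  · rw [hdiv, jacobiSym.mul_left, Padic.jacobiSym_neg_three (h.ne_two_of_dvd hpn) hp3,
      if_pos hp1, one_mul]
  · rfl

/-- Positive divisors of `n / 3` are automatically `1 (mod 3)`, so besides the partition only `D ≡ 1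
(mod 4)` matters. The divisor `n / 3` itself must fail it, which means `n ≡ 1 (mod 8)`; then every
partition has a part whose product satisfies it. -/
theorem selmer_eq_one_iff_of_one (h : IsAdmissible n)
    (hall : ∀ p : ℕ, p.Prime → p ∣ n → p = 3 ∨ p % 3 = 1) (h1 : n / 3 % 3 = 1)
    (hn : 1 < n / 3) : (curvePiThird n).selmer = {1} ↔
      n % 8 = 1 ∧ IsOddGraph (graphG ((n / 3 : ℕ) : ℤ)) := by
  have hn3 := h.natCast_eq
  have hdvd : ((n / 3 : ℕ) : ℤ) ∣ n := ⟨3, by rw [mul_comm, ← hn3]⟩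
  have hsq : Squarefree ((n / 3 : ℕ) : ℤ) := h.int_squarefree.squarefree_of_dvd hdvd
  have hm0 : (0 : ℤ) < ((n / 3 : ℕ) : ℤ) := by omega
  have h8 := h.mod_eight
  have mem_of : ∀ D : ℤ, D ∣ ((n / 3 : ℕ) : ℤ) → 0 < D → D % 4 = 1 →
      (∀ p : ℕ, p.Prime → (p : ℤ) ∣ ((n / 3 : ℕ) : ℤ) → p % 3 = 1 →
        IsGoodAt ((n / 3 : ℕ) : ℤ) D p) → sqClass (D : ℚ) ∈ (curvePiThird n).selmer := by
    intro D hD hpos h4 hgood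
    refine (h.mem_selmer_iff ((hD.trans hdvd).mul_left 2)).2 ⟨hpos, h4, fun q hq hqn hq2 => ?_,
      fun p hp hpn hp1 => ?_, fun _ => ?_, fun h2 => by omega⟩
    · rcases hall q hq hqn with rfl | h' <;> omega
    · refine (h.isGoodAt_neg_iff hD hp hpn hp1).2 (hgood p hp ?_ hp1)
      have hp3 : p ≠ 3 := by rintro rfl; simp at hp1
      have hpn' : (p : ℤ) ∣ 3 * ((n / 3 : ℕ) : ℤ) := by
        rw [← hn3]; exact Int.natCast_dvd_natCast.2 hpn
      exact ((Nat.prime_iff_prime_int.1 hp).dvd_or_dvd hpn').resolve_left fun h' =>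
        hp3 ((Nat.prime_dvd_prime_iff_eq hp Nat.prime_three).1 (by exact_mod_cast h'))
    · refine Int.emod_three_eq_one hpos fun p hp hpD => ?_
      have hpm := hpD.trans hD
      rcases hall p hp (Int.natCast_dvd_natCast.1 (hpm.trans hdvd)) with rfl | h'
      · have := Int.natCast_dvd_natCast.1 hpm
        omega
      · exact h'
  rw [h.selmer_eq_one_iff]
  constructor
  · intro hS
    have hmod : n % 8 = 1 := by
      by_contra hne
      -- If `n ≡ 3, 7 (mod 8)`, then `n / 3 ≡ 1 (mod 4)`, and `n / 3 > 1` is a nontrivial element of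
      -- `S(E)`.
      have := hS ((n / 3 : ℕ) : ℤ) hdvd (mem_of _ dvd_rfl hm0 (by omega) fun p hp hpm _ => by
        unfold IsGoodAt
        rw [if_pos hpm, Int.ediv_self hm0.ne', jacobiSym.one_left])
      omega
    refine ⟨hmod, fun V₁ hV₁ => ?_⟩
    by_contra hodd
    have hprod := vertexProd_mul_compl hsq V₁
    have hpos : ∀ V : Finset (graphVertices ((n / 3 : ℕ) : ℤ)), 0 < vertexProd V := fun V =>
      prod_pos fun v _ => vertex_pos hm0 v
    have hfalse : ∀ V : Finset (graphVertices ((n / 3 : ℕ) : ℤ)), V.Nonempty →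
        ¬IsOddPartition (graphG ((n / 3 : ℕ) : ℤ)) V → vertexProd V % 4 ≠ 1 := by
      intro V hV hVodd h4
      exact vertexProd_ne_one hm0.ne' hV (fun v _ => vertex_pos hm0 v)
        (hS _ ((vertexProd_dvd hsq V).trans hdvd) (mem_of _ (vertexProd_dvd hsq V) (hpos V) h4
          ((not_isOddPartition_iff hsq V).1 hVodd)))
    have ha := hfalse V₁ hV₁.1 hodd
    have hb := hfalse V₁ᶜ hV₁.2 (by rwa [isOddPartition_compl_iff])
    -- The products of the two parts multiply to `3 (mod 4)`, so one of them is `1 (mod 4)`.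
    have hm4 : ((n / 3 : ℕ) : ℤ) % 4 = 3 := by omega
    rw [← hprod, Int.mul_emod] at hm4
    have ha4 : vertexProd V₁ % 4 = 0 ∨ vertexProd V₁ % 4 = 2 ∨ vertexProd V₁ % 4 = 3 := by omega
    have hb4 : vertexProd V₁ᶜ % 4 = 0 ∨ vertexProd V₁ᶜ % 4 = 2 ∨ vertexProd V₁ᶜ % 4 = 3 := by
      omega
    rcases ha4 with ha4 | ha4 | ha4 <;> rcases hb4 with hb4 | hb4 | hb4 <;>
      rw [ha4, hb4] at hm4 <;> norm_num at hm4
  · rintro ⟨hmod, hG⟩ D hD hmem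
    obtain ⟨hpos, h4, -, hgood, hD1, -⟩ := (h.mem_selmer_iff (hD.mul_left 2)).1 hmem
    have hD3 := hD1 h1
    have hDm : D ∣ ((n / 3 : ℕ) : ℤ) := by
      rw [hn3] at hD
      exact (Int.prime_three.coprime_iff_not_dvd.2 (by omega)).symm.dvd_of_dvd_mul_left hD
    obtain ⟨V₁, rfl, -⟩ := exists_vertexProd_eq hsq hDm hpos
    by_cases hne : V₁.Nonempty
    · exfalso
      by_cases hne' : V₁ᶜ.Nonempty
      · refine (not_isOddPartition_iff hsq V₁).2 (fun p hp hpm hp1 => ?_) (hG V₁ ⟨hne, hne'⟩)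
        have hpn := Int.natCast_dvd_natCast.1 (hpm.trans hdvd)
        exact (h.isGoodAt_neg_iff hDm hp hpn hp1).1 (hgood p hp hpn hp1)
      -- The full vertex set would give `D = n / 3 ≡ 3 (mod 4)`.
      · have hprod := vertexProd_mul_compl hsq V₁
        rw [not_nonempty_iff_eq_empty.1 hne', vertexProd, vertexProd, prod_empty, mul_one] at hprod
        rw [vertexProd, hprod] at h4
        omega
    · rw [not_nonempty_iff_eq_empty.1 hne, vertexProd, prod_empty]

/-- Elements of `S(E)` are positive and prime to `q`, so they are products over `{3, p_1, …, p_t}`.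
The condition at `3` is automatic, since removing a possible factor `3` leaves primes `1 (mod 3)`;
the conditions at `2` and `q` survive as restrictions on `V₁`. -/
theorem selmer_eq_one_iff_of_two (h : IsAdmissible n) {ps : Finset ℕ} {q : ℕ}
    (hps : ∀ p, p ∈ ps ↔ p.Prime ∧ p ∣ n ∧ p % 3 = 1)
    (hqs : ∀ r, r = q ↔ r.Prime ∧ r ∣ n ∧ r % 3 = 2) (h2 : n / 3 % 3 = 2) :
    (curvePiThird n).selmer = {1} ↔
      ∀ V₁ : Finset (graphVertices (-(n : ℤ))), IsNontrivialPartition V₁ →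
        (∀ v ∈ V₁, (v : ℤ) = 3 ∨ ∃ p ∈ ps, (v : ℤ) = p) →
        vertexProd V₁ % 4 = 1 → jacobiSym (vertexProd V₁) q = 1 →
        IsOddPartition (graphG (-(n : ℤ))) V₁ := by
  have hn0 : (0 : ℤ) < n := by exact_mod_cast Nat.pos_of_ne_zero h.ne_zero
  have hm0 : -(n : ℤ) ≠ 0 := by omega
  have hsq : Squarefree (-n : ℤ) := by
    rw [← Int.squarefree_natAbs, Int.natAbs_neg, Int.squarefree_natAbs]
    exact h.int_squarefree
  obtain ⟨hq, hqn, hq2⟩ := (hqs q).1 rfl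
  have hq3 : q ≠ 3 := by rintro rfl; simp at hq2
  rw [h.selmer_eq_one_iff]
  constructor
  · intro hS V₁ hV₁ hsub h4 hj
    by_contra hodd
    have hvpos : ∀ v ∈ V₁, 0 < (v : ℤ) := by
      intro v hv
      rcases hsub v hv with h' | ⟨p, hp, h'⟩
      · omega
      · rw [h']; exact_mod_cast ((hps p).1 hp).1.pos
    have hpos : 0 < vertexProd V₁ := prod_pos hvpos
    have hD : vertexProd V₁ ∣ n := dvd_neg.1 (vertexProd_dvd hsq V₁)
    have hprimes : ∀ p : ℕ, p.Prime → (p : ℤ) ∣ vertexProd V₁ → p = 3 ∨ p % 3 = 1 := by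
      intro p hp hpD
      obtain ⟨v, hv, hvp⟩ := (prime_dvd_vertexProd_iff hm0 hp V₁).1 hpD
      rcases hsub v hv with h' | ⟨p', hp', h'⟩
      · left; exact_mod_cast hvp.symm.trans h'
      · right
        have : p = p' := by exact_mod_cast hvp.symm.trans h'
        rw [this]; exact ((hps p').1 hp').2.2
    refine vertexProd_ne_one hm0 hV₁.1 hvpos (hS _ hD
      ((h.mem_selmer_iff (hD.mul_left 2)).2 ⟨hpos, h4, fun r hr hrn hr2 => ?_,
        fun p hp hpn hp1 => (not_isOddPartition_iff hsq V₁).1 hodd p hp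
          (dvd_neg.2 (Int.natCast_dvd_natCast.2 hpn)) hp1, fun h' => by omega, fun _ => ?_⟩))
    · obtain rfl := (hqs r).2 ⟨hr, hrn, hr2⟩
      refine ⟨fun hrD => ?_, hj⟩
      rcases hprimes r hr hrD with h' | h' <;> omega
    · by_cases h3 : (3 : ℤ) ∣ vertexProd V₁
      · right
        obtain ⟨e, he⟩ := h3
        have hediv : vertexProd V₁ / 3 = e := by omega
        refine ⟨⟨e, he⟩, hediv ▸ Int.emod_three_eq_one (by omega) fun p hp hpe => ?_⟩
        rcases hprimes p hp (he ▸ hpe.mul_left 3) with rfl | h'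
        · exfalso
          have hsqD := h.int_squarefree.squarefree_of_dvd hD
          rw [he] at hsqD
          exact Int.prime_three.not_isUnit (hsqD 3 (mul_dvd_mul_left 3 (by exact_mod_cast hpe)))
        · exact h'
      · left
        refine Int.emod_three_eq_one hpos fun p hp hpD => ?_
        rcases hprimes p hp hpD with rfl | h'
        · exact absurd (by exact_mod_cast hpD) h3
        · exact h'
  · intro hG D hD hmem
    obtain ⟨hpos, h4, hinert, hgood, -, -⟩ := (h.mem_selmer_iff (hD.mul_left 2)).1 hmem
    obtain ⟨hqD, hj⟩ := hinert q hq hqn hq2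
    obtain ⟨V₁, rfl, hsub⟩ := exists_vertexProd_eq hsq (dvd_neg.2 hD) hpos
    by_cases hne : V₁.Nonempty
    · exfalso
      -- The vertex `-1` lies in the complement because `V₁` consists of primes, so the partition is
      -- nontrivial as soon as `V₁` is nonempty.
      have hneg : (-1 : ℤ) ∈ graphVertices (-(n : ℤ)) :=
        (mem_graphVertices_iff hm0).2 (Or.inr ⟨by omega, rfl⟩)
      have hnegV : (⟨-1, hneg⟩ : graphVertices (-(n : ℤ))) ∈ V₁ᶜ := by
        rw [mem_compl]
        intro hv
        obtain ⟨p, -, -, hp⟩ := hsub _ hv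
        have : (-1 : ℤ) = p := hp
        omega
      refine (not_isOddPartition_iff hsq V₁).2 (fun p hp hpn hp1 => hgood p hp
        (Int.natCast_dvd_natCast.1 (dvd_neg.1 hpn)) hp1)
        (hG V₁ ⟨hne, ⟨_, hnegV⟩⟩ (fun v hv => ?_) h4 hj)
      obtain ⟨p, hp, hpD, hvp⟩ := hsub v hv
      have : Fact p.Prime := ⟨hp⟩
      have hpn : p ∣ n := Int.natCast_dvd_natCast.1 (hpD.trans hD)
      rcases prime_eq_three_or p with rfl | hp1 | hp2
      · left; exact_mod_cast hvp
      · exact Or.inr ⟨p, (hps p).2 ⟨hp, hpn, hp1⟩, hvp⟩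
      · have := (hqs p).2 ⟨hp, hpn, hp2⟩
        exact absurd (this ▸ hpD) hqD
    · rw [not_nonempty_iff_eq_empty.1 hne, vertexProd, prod_empty]

end IsAdmissible

/-! ### From the prime factorisation of n to the theorem. -/

theorem isAdmissible_of_prime_factors {ps qs : Finset ℕ}
    (hps : ∀ p ∈ ps, p.Prime ∧ Odd p ∧ p % 3 = 1) (hqs : ∀ q ∈ qs, q.Prime ∧ Odd q ∧ q % 3 = 2)
    {n : ℕ} (hn : n = 3 * ((∏ p ∈ ps, p) * ∏ q ∈ qs, q))
    (hn24 : n % 24 = 3 ∨ n % 24 = 9 ∨ n % 24 = 15) :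
    IsAdmissible n ∧ (∀ p, p ∈ ps ↔ p.Prime ∧ p ∣ n ∧ p % 3 = 1) ∧
      (∀ q, q ∈ qs ↔ q.Prime ∧ q ∣ n ∧ q % 3 = 2) := by
  have hdvd : ∀ r : ℕ, r.Prime → (r ∣ n ↔ r = 3 ∨ r ∈ ps ∨ r ∈ qs) := by
    intro r hr
    rw [hn, hr.dvd_mul, hr.dvd_mul, Nat.prime_dvd_prime_iff_eq hr Nat.prime_three,
      hr.prime.dvd_finsetProd_iff, hr.prime.dvd_finsetProd_iff]
    refine or_congr_right (or_congr ⟨?_, fun h => ⟨r, h, dvd_rfl⟩⟩ ⟨?_, fun h => ⟨r, h, dvd_rfl⟩⟩)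
    · rintro ⟨p, hp, hrp⟩
      rwa [(Nat.prime_dvd_prime_iff_eq hr (hps p hp).1).1 hrp]
    · rintro ⟨q, hq, hrq⟩
      rwa [(Nat.prime_dvd_prime_iff_eq hr (hqs q hq).1).1 hrq]
  have hsqf : ∀ s : Finset ℕ, (∀ p ∈ s, p.Prime) → Squarefree (∏ p ∈ s, p) := by
    intro s hs
    refine Finset.squarefree_prod_of_pairwise_isCoprime (fun p hp q hq hpq => ?_)
      fun p hp => (hs p hp).prime.squarefree
    exact Nat.coprime_iff_isRelPrime.1 ((Nat.coprime_primes (hs p hp) (hs q hq)).2 hpq)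
  have hcop : Disjoint ps qs := by
    rw [disjoint_left]
    intro p hp hq
    have h1 := (hps p hp).2.2
    have h2 := (hqs p hq).2.2
    omega
  have h3 : 3 ∉ ps ∪ qs := by
    rw [mem_union]
    rintro (h | h)
    · exact absurd (hps 3 h).2.2 (by norm_num)
    · exact absurd (hqs 3 h).2.2 (by norm_num)
  refine ⟨⟨?_, ⟨_, hn⟩, by omega⟩, fun p => ⟨fun hp => ?_, ?_⟩, fun q => ⟨fun hq => ?_, ?_⟩⟩
  · have hprod : n = ∏ p ∈ insert 3 (ps ∪ qs), p := by
      rw [hn, prod_insert h3, prod_union hcop]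
    rw [hprod]
    refine hsqf _ fun p hp => ?_
    rcases mem_insert.1 hp with rfl | hp
    · exact Nat.prime_three
    rcases mem_union.1 hp with hp | hp
    · exact (hps p hp).1
    · exact (hqs p hp).1
  · exact ⟨(hps p hp).1, (hdvd p (hps p hp).1).2 (Or.inr (Or.inl hp)), (hps p hp).2.2⟩
  · rintro ⟨hp, hpn, hp1⟩
    rcases (hdvd p hp).1 hpn with rfl | h | h
    · simp at hp1
    · exact h
    · have := (hqs p h).2.2
      omega
  · exact ⟨(hqs q hq).1, (hdvd q (hqs q hq).1).2 (Or.inr (Or.inr hq)), (hqs q hq).2.2⟩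
  · rintro ⟨hq, hqn, hq2⟩
    rcases (hdvd q hq).1 hqn with rfl | h | h
    · simp at hq2
    · have := (hps q h).2.2
      omega
    · exact h

theorem theorem5p1 (ps qs : Finset ℕ)
    (hps : ∀ p ∈ ps, p.Prime ∧ Odd p ∧ p % 3 = 1)
    (hqs : ∀ q ∈ qs, q.Prime ∧ Odd q ∧ q % 3 = 2)
    (hcard : 1 ≤ ps.card + qs.card)
    (P Q n : ℕ) (hP : P = ∏ p ∈ ps, p) (hQ : Q = ∏ q ∈ qs, q) (hn : n = 3 * P * Q)
    (hn24 : n % 24 = 3 ∨ n % 24 = 9 ∨ n % 24 = 15) :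
    -- the group S'(E) when PQ ≡ 1 (mod 3)
    (P * Q % 3 = 1 →
      ((curvePiThird n).selmer' =
          {1, sqClass (n : ℚ), sqClass (-(n : ℚ) / 3), sqClass (-3 : ℚ)} ↔
        qs.card = 0 ∧ IsOddGraph (graphG (n : ℤ)))) ∧
    -- the group S'(E) when PQ ≡ 2 (mod 3)
    (P * Q % 3 = 2 →
      ((curvePiThird n).selmer' =
          {1, sqClass (n : ℚ), sqClass (-(n : ℚ) / 3), sqClass (-3 : ℚ)} ↔
        qs.card = 1 ∧
          ∀ V₁ : Finset (graphVertices (n : ℤ)), IsNontrivialPartition V₁ →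
            (∀ v ∈ V₁, ∃ p ∈ ps, (v : ℤ) = p) →
            IsOddPartition (graphG (n : ℤ)) V₁)) ∧
    -- the group S(E) when PQ ≡ 1 (mod 3) and s = 0
    (P * Q % 3 = 1 → qs.card = 0 →
      ((curvePiThird n).selmer = {1} ↔
        n % 24 = 9 ∧ IsOddGraph (graphG ((n / 3 : ℕ) : ℤ)))) ∧
    -- the group S(E) when PQ ≡ 2 (mod 3) and s = 1
    (P * Q % 3 = 2 → ∀ q₁ : ℕ, qs = {q₁} →
      ((curvePiThird n).selmer = {1} ↔
        ∀ V₁ : Finset (graphVertices (-(n : ℤ))), IsNontrivialPartition V₁ →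
          (∀ v ∈ V₁, (v : ℤ) = 3 ∨ ∃ p ∈ ps, (v : ℤ) = p) →
          vertexProd V₁ % 4 = 1 →
          jacobiSym (vertexProd V₁) q₁ = 1 →
          IsOddPartition (graphG (-(n : ℤ))) V₁)) := by
  subst hP hQ
  rw [mul_assoc] at hn
  obtain ⟨h, hps', hqs'⟩ := isAdmissible_of_prime_factors hps hqs hn hn24
  have hdiv : (∏ p ∈ ps, p) * ∏ q ∈ qs, q = n / 3 := by omega
  rw [hdiv]
  refine ⟨h.selmer'_eq_iff_of_one hps' hqs', h.selmer'_eq_iff_of_two hps' hqs', ?_, ?_⟩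
  · intro h1 hs
    rw [card_eq_zero] at hs
    subst hs
    have hall : ∀ p : ℕ, p.Prime → p ∣ n → p = 3 ∨ p % 3 = 1 := by
      intro p hp hpn
      have : Fact p.Prime := ⟨hp⟩
      rcases IsAdmissible.prime_eq_three_or p with h' | h' | h'
      · exact Or.inl h'
      · exact Or.inr h'
      · exact absurd ((hqs' p).2 ⟨hp, hpn, h'⟩) (notMem_empty p)
    -- With `s = 0`, the assumption `t + s ≥ 1` supplies a prime `p ∣ n / 3`.
    have hgt : 1 < n / 3 := by
      obtain ⟨p, hp⟩ := card_pos.1 (by simpa using hcard : 0 < ps.card)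
      have hle : p ≤ n / 3 := by
        rw [← hdiv, prod_empty, mul_one]
        exact Nat.le_of_dvd (prod_pos fun r hr => (hps r hr).1.pos) (dvd_prod_of_mem _ hp)
      exact (hps p hp).1.one_lt.trans_le hle
    rw [h.selmer_eq_one_iff_of_one hall h1 hgt]
    -- Among the residues `3`, `9`, `15` modulo `24`, only `9` is `1` modulo `8`.
    exact and_congr_left fun _ => by omega
  · intro h2 q hq
    subst hq
    exact h.selmer_eq_one_iff_of_two hps' (fun r => by rw [← hqs', mem_singleton]) h2
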